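/- **Theorem 1.** Let $\mathcal X_1,\mathcal X_2,\mathcal Y$ be finite alphabets and let $P_{Y|X_1X_2}$ be a two-user discrete memoryless multiple-access channel (MAC) with noiseless feedback to both encoders. All logarithms are to base $2$. For $M_1,M_2\ge 1$, an $(N,M_1,M_2)$ transmission system consists of encoding maps $e_{in}:\{1,\dots,M_i\}\times\mathcal Y^{n-1}\to\mathcal X_i$ ($i=1,2$, $1\le n\le N$) and a decoding map $g:\mathcal Y^N\to\{1,\dots,M_1\}\times\{1,\dots,M_2\}$; the channel inputs are $X_{in}=e_{in}(W_i,Y^{n-1})$, the messages $(W_1,W_2)$ are uniform on $\{1,\dots,M_1\}\times\{1,\dots,M_2\}$, and $\tau=\Pr(g(Y^N)\ne(W_1,W_2))$ is the average error probability. A pair $(R_1,R_2)$ is *achievable* if for every $\epsilon>0$ there is $N(\epsilon)$ such that for every $N>N(\epsilon)$ there is an $(N,M_1,M_2)$ transmission system with $\frac1N\log M_1\ge R_1-\epsilon$, $\frac1N\log M_2\ge R_2-\epsilon$ and $\tau\le\epsilon$. Let $\mathcal U,\mathcal A,\mathcal B$ be arbitrary finite sets and let $P=P_U\,P_{AB}\,P_{X_1|UA}\,P_{X_2|UB}\,P_{Y|X_1X_2}$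 be a distribution on $\mathcal U\times\mathcal A\times\mathcal B\times\mathcal X_1\times\mathcal X_2\times\mathcal Y$. Let $(\tilde U,\tilde A,\tilde B,\tilde X_1,\tilde X_2,\tilde Y)\sim P$ and write $\tilde S=(\tilde U,\tilde A,\tilde B,\tilde Y)$, with range $\mathcal S=\mathcal U\times\mathcal A\times\mathcal B\times\mathcal Y$. Let $Q_{A|\tilde S\tilde X_1}$ and $Q_{B|\tilde S\tilde X_2}$ be conditional distributions satisfying the consistency condition $$\sum_{\tilde s,\tilde x_1,\tilde x_2}P(\tilde s,\tilde x_1,\tilde x_2)\,Q_{A|\tilde S\tilde X_1}(a|\tilde s,\tilde x_1)\,Q_{B|\tilde S\tilde X_2}(b|\tilde s,\tilde x_2)=P_{AB}(a,b)\qquad\text{for all }(a,b)\in\mathcal A\times\mathcal B .$$ Let all the variables $(\tilde U,\tilde A,\tilde B,\tilde Y,\tilde X_1,\tilde X_2,U,A,B,Y,X_1,X_2)$ have the joint law $P_{\tilde S\tilde X_1\tilde X_2}\,Q_{A|\tilde S\tilde X_1}\,Q_{B|\tilde S\tilde X_2}\,P_{UX_1X_2Y|AB}$, where $P_{UX_1X_2Y|AB}=P_U\,P_{X_1|UA}\,P_{X_2|UB}\,P_{Y|X_1X_2}$,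 and let $x^+=\max(0,x)$. Then every pair $(R_1,R_2)$ with $$\begin{aligned} R_1&\le I(X_1;Y|X_2BU\tilde S\tilde X_2)-\bigl(I(A;X_2|YBU\tilde S\tilde X_2)-I(U;Y|\tilde U\tilde Y)\bigr)^+,\\ R_2&\le I(X_2;Y|X_1AU\tilde S\tilde X_1)-\bigl(I(B;X_1|YAU\tilde S\tilde X_1)-I(U;Y|\tilde U\tilde Y)\bigr)^+,\\ R_1+R_2&\le I(X_1X_2;Y|U\tilde S)+I(U;Y|\tilde U\tilde Y) \end{aligned}$$ is achievable. Moreover, if $\mathcal A$ and $\mathcal B$ are one-point sets ($A=B=\emptyset$), then every pair of conditional distributions is consistent, and the set of pairs described by these three inequalities is the Cover–Leung region $$R_1\le I(X_1;Y|X_2U),\qquad R_2\le I(X_2;Y|X_1U),\qquad R_1+R_2\le I(X_1X_2;Y)$$ of the law $P_UP_{X_1|U}P_{X_2|U}P_{Y|X_1X_2}$. -/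

import Mathlib

namespace MACFeedback

/-! ### Entropies of finitely valued random variables

`stdSimplex ℝ α` is the set of probability distributions on the finite set `α`. All logarithms are
to base two. A random variable is a function on a finite set `Ω` with probability mass function `p`.
-/

section Entropy

variable {Ω α β γ : Type*} [Fintype Ω] [Fintype α] [Fintype β] [Fintype γ]

open Classical in
/-- The probability that the random variable `f` takes the value `a`. -/
noncomputable def prob (p : Ω → ℝ) (f : Ω → α) (a : α) : ℝ :=
  ∑ ω, if f ω = a then p ω else 0

/-- The entropy `H(f) = -∑ₐ P(f = a) log₂ P(f = a)`, with `0 log 0 = 0`. -/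
noncomputable def entropy (p : Ω → ℝ) (f : Ω → α) : ℝ :=
  -∑ a, prob p f a * Real.logb 2 (prob p f a)

/-- The conditional entropy `H(f | h) = H(f, h) - H(h)`. -/
noncomputable def condEntropy (p : Ω → ℝ) (f : Ω → α) (h : Ω → γ) : ℝ :=
  entropy p (fun ω => (f ω, h ω)) - entropy p h

/-- The mutual information `I(f ; g) = H(f) - H(f | g)`. -/
noncomputable def mutualInfo (p : Ω → ℝ) (f : Ω → α) (g : Ω → β) : ℝ :=
  entropy p f - condEntropy p f g

/-- The conditional mutual information `I(f ; g | h) = H(f | h) - H(f | g, h)`. -/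
noncomputable def condMutualInfo (p : Ω → ℝ) (f : Ω → α) (g : Ω → β) (h : Ω → γ) : ℝ :=
  condEntropy p f h - condEntropy p f (fun ω => (g ω, h ω))

end Entropy

/-! ### Transmission systems for the MAC with noiseless feedback to both encoders

The channel is a family `W x₁ x₂` of distributions on the output alphabet. -/

section Coding

variable {𝒳₁ 𝒳₂ 𝒴 : Type*} [Fintype 𝒴]

/-- An `(N, M₁, M₂)` transmission system. Time and messages are numbered from `0`: the inputs at
time `n : Fin N` are functions of the message and of the `n` earlier outputs. -/
structure TransmissionSystem (𝒳₁ 𝒳₂ 𝒴 : Type*) (N M₁ M₂ : ℕ) where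
  enc₁ : (n : Fin N) → Fin M₁ → (Fin n → 𝒴) → 𝒳₁
  enc₂ : (n : Fin N) → Fin M₂ → (Fin n → 𝒴) → 𝒳₂
  dec : (Fin N → 𝒴) → Fin M₁ × Fin M₂

/-- The outputs received strictly before time `n`. -/
def past {N : ℕ} (y : Fin N → 𝒴) (n : Fin N) : Fin n → 𝒴 :=
  fun k => y (Fin.castLE n.isLt.le k)

/-- The probability that the output sequence is `y`, given the messages `w₁, w₂`, when the channel
is memoryless and both encoders receive noiseless feedback. -/
noncomputable def outputProb (W : 𝒳₁ → 𝒳₂ → stdSimplex ℝ 𝒴) {N M₁ M₂ : ℕ}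
    (T : TransmissionSystem 𝒳₁ 𝒳₂ 𝒴 N M₁ M₂) (w₁ : Fin M₁) (w₂ : Fin M₂) (y : Fin N → 𝒴) : ℝ :=
  ∏ n, W (T.enc₁ n w₁ (past y n)) (T.enc₂ n w₂ (past y n)) (y n)

/-- The average error probability, for messages uniform on `Fin M₁ × Fin M₂`. -/
noncomputable def avgErrorProb (W : 𝒳₁ → 𝒳₂ → stdSimplex ℝ 𝒴) {N M₁ M₂ : ℕ}
    (T : TransmissionSystem 𝒳₁ 𝒳₂ 𝒴 N M₁ M₂) : ℝ :=
  (1 / ((M₁ : ℝ) * M₂)) * ∑ w₁, ∑ w₂, ∑ y,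
    if T.dec y ≠ (w₁, w₂) then outputProb W T w₁ w₂ y else 0

/-- Achievability of a rate pair (in bits per channel use). -/
def Achievable (W : 𝒳₁ → 𝒳₂ → stdSimplex ℝ 𝒴) (R₁ R₂ : ℝ) : Prop :=
  ∀ ε : ℝ, 0 < ε → ∃ N₀ : ℕ, ∀ N : ℕ, N₀ < N →
    ∃ M₁ M₂ : ℕ, 0 < M₁ ∧ 0 < M₂ ∧ ∃ T : TransmissionSystem 𝒳₁ 𝒳₂ 𝒴 N M₁ M₂,
      (1 / (N : ℝ)) * Real.logb 2 M₁ ≥ R₁ - ε ∧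
      (1 / (N : ℝ)) * Real.logb 2 M₂ ≥ R₂ - ε ∧
      avgErrorProb W T ≤ ε

/-- The capacity region with feedback: the set of all achievable rate pairs. -/
def capacityRegion (W : 𝒳₁ → 𝒳₂ → stdSimplex ℝ 𝒴) : Set (ℝ × ℝ) :=
  {R | Achievable W R.1 R.2}

end Coding

/-! ### The sample space and its coordinates -/

section Coordinates

/-- The range of one collection `S = (U, A, B, Y)`. -/
abbrev State (𝒰 𝒜 ℬ 𝒴 : Type*) := 𝒰 × 𝒜 × ℬ × 𝒴

/-- The sample space of the two sets of variables `(S̃, X̃₁, X̃₂)` and `(S, X₁, X₂)`. -/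
abbrev Sample (𝒰 𝒜 ℬ 𝒳₁ 𝒳₂ 𝒴 : Type*) :=
  (State 𝒰 𝒜 ℬ 𝒴 × 𝒳₁ × 𝒳₂) × (State 𝒰 𝒜 ℬ 𝒴 × 𝒳₁ × 𝒳₂)

/-! The coordinate random variables; a final `t` stands for a tilde. -/

variable {𝒰 𝒜 ℬ 𝒳₁ 𝒳₂ 𝒴 : Type*} (ω : Sample 𝒰 𝒜 ℬ 𝒳₁ 𝒳₂ 𝒴)

/-- `S̃` -/
def St : State 𝒰 𝒜 ℬ 𝒴 := ω.1.1
/-- `Ũ` -/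
def Ut : 𝒰 := ω.1.1.1
/-- `Ỹ` -/
def Yt : 𝒴 := ω.1.1.2.2.2
/-- `X̃₁` -/
def X₁t : 𝒳₁ := ω.1.2.1
/-- `X̃₂` -/
def X₂t : 𝒳₂ := ω.1.2.2
/-- `U` -/
def U : 𝒰 := ω.2.1.1
/-- `A` -/
def A : 𝒜 := ω.2.1.2.1
/-- `B` -/
def B : ℬ := ω.2.1.2.2.1
/-- `Y` -/
def Y : 𝒴 := ω.2.1.2.2.2
/-- `X₁` -/
def X₁ : 𝒳₁ := ω.2.2.1
/-- `X₂` -/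
def X₂ : 𝒳₂ := ω.2.2.2

end Coordinates

/-! ### The single-letter rate region -/

section Region

/-- The factors `P_U`, `P_{AB}`, `P_{X₁|UA}`, `P_{X₂|UB}` chosen by the code designer. -/
structure InputLaw (𝒰 𝒜 ℬ 𝒳₁ 𝒳₂ : Type*)
    [Fintype 𝒰] [Fintype 𝒜] [Fintype ℬ] [Fintype 𝒳₁] [Fintype 𝒳₂] where
  PU : stdSimplex ℝ 𝒰
  PAB : stdSimplex ℝ (𝒜 × ℬ)
  PX₁ : 𝒰 → 𝒜 → stdSimplex ℝ 𝒳₁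
  PX₂ : 𝒰 → ℬ → stdSimplex ℝ 𝒳₂

variable {𝒰 𝒜 ℬ 𝒳₁ 𝒳₂ 𝒴 : Type*}
  [Fintype 𝒰] [Fintype 𝒜] [Fintype ℬ] [Fintype 𝒳₁] [Fintype 𝒳₂] [Fintype 𝒴]

/-- `P_{U X₁ X₂ Y | AB}(u, x₁, x₂, y | a, b)`. -/
noncomputable def InputLaw.condLaw (P : InputLaw 𝒰 𝒜 ℬ 𝒳₁ 𝒳₂) (W : 𝒳₁ → 𝒳₂ → stdSimplex ℝ 𝒴)
    (s : State 𝒰 𝒜 ℬ 𝒴) (x₁ : 𝒳₁) (x₂ : 𝒳₂) : ℝ :=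
  match s with
  | (u, a, b, y) => P.PU u * P.PX₁ u a x₁ * P.PX₂ u b x₂ * W x₁ x₂ y

/-- The joint law `P_{S X₁ X₂} = P_U P_{AB} P_{X₁|UA} P_{X₂|UB} P_{Y|X₁X₂}`. -/
noncomputable def InputLaw.law (P : InputLaw 𝒰 𝒜 ℬ 𝒳₁ 𝒳₂) (W : 𝒳₁ → 𝒳₂ → stdSimplex ℝ 𝒴)
    (s : State 𝒰 𝒜 ℬ 𝒴) (x₁ : 𝒳₁) (x₂ : 𝒳₂) : ℝ :=
  match s with
  | (u, a, b, y) => P.PU u * P.PAB (a, b) * P.PX₁ u a x₁ * P.PX₂ u b x₂ * W x₁ x₂ y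

/-- The consistency condition: if `(S̃, X̃₁, X̃₂)` has law `P`, and `A`, `B` are drawn from
`QA (· | S̃, X̃₁)` and `QB (· | S̃, X̃₂)`, conditionally independently, then `(A, B)` has law
`P_{AB}`. -/
def Consistent (P : InputLaw 𝒰 𝒜 ℬ 𝒳₁ 𝒳₂) (W : 𝒳₁ → 𝒳₂ → stdSimplex ℝ 𝒴)
    (QA : State 𝒰 𝒜 ℬ 𝒴 → 𝒳₁ → stdSimplex ℝ 𝒜)
    (QB : State 𝒰 𝒜 ℬ 𝒴 → 𝒳₂ → stdSimplex ℝ ℬ) : Prop :=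
  ∀ (a : 𝒜) (b : ℬ),
    ∑ s, ∑ x₁, ∑ x₂, P.law W s x₁ x₂ * QA s x₁ a * QB s x₂ b = P.PAB (a, b)

/-- The joint law `P_{S̃ X̃₁ X̃₂} Q_{A|S̃ X̃₁} Q_{B|S̃ X̃₂} P_{U X₁ X₂ Y|AB}`. -/
noncomputable def jointLaw (P : InputLaw 𝒰 𝒜 ℬ 𝒳₁ 𝒳₂) (W : 𝒳₁ → 𝒳₂ → stdSimplex ℝ 𝒴)
    (QA : State 𝒰 𝒜 ℬ 𝒴 → 𝒳₁ → stdSimplex ℝ 𝒜)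
    (QB : State 𝒰 𝒜 ℬ 𝒴 → 𝒳₂ → stdSimplex ℝ ℬ) : Sample 𝒰 𝒜 ℬ 𝒳₁ 𝒳₂ 𝒴 → ℝ
  | ((s', x₁', x₂'), ((u, a, b, y), x₁, x₂)) =>
      P.law W s' x₁' x₂' * QA s' x₁' a * QB s' x₂' b * P.condLaw W (u, a, b, y) x₁ x₂

/-- The rate region determined by `P`, `QA`, `QB`; here `x⁺ = max 0 x`. -/
noncomputable def rateRegion (P : InputLaw 𝒰 𝒜 ℬ 𝒳₁ 𝒳₂) (W : 𝒳₁ → 𝒳₂ → stdSimplex ℝ 𝒴)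
    (QA : State 𝒰 𝒜 ℬ 𝒴 → 𝒳₁ → stdSimplex ℝ 𝒜)
    (QB : State 𝒰 𝒜 ℬ 𝒴 → 𝒳₂ → stdSimplex ℝ ℬ) : Set (ℝ × ℝ) :=
  let p := jointLaw P W QA QB
  let IU := condMutualInfo p U Y (fun ω => (Ut ω, Yt ω))
  {R |
    R.1 ≤ condMutualInfo p X₁ Y (fun ω => (X₂ ω, B ω, U ω, St ω, X₂t ω)) -
        max 0 (condMutualInfo p A X₂ (fun ω => (Y ω, B ω, U ω, St ω, X₂t ω)) - IU) ∧
    R.2 ≤ condMutualInfo p X₂ Y (fun ω => (X₁ ω, A ω, U ω, St ω, X₁t ω)) -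
        max 0 (condMutualInfo p B X₁ (fun ω => (Y ω, A ω, U ω, St ω, X₁t ω)) - IU) ∧
    R.1 + R.2 ≤ condMutualInfo p (fun ω => (X₁ ω, X₂ ω)) Y (fun ω => (U ω, St ω)) + IU}

/-- The Cover–Leung region of a law `P_U P_{X₁|U} P_{X₂|U} P_{Y|X₁X₂}` on
`𝒰 × 𝒳₁ × 𝒳₂ × 𝒴`. -/
noncomputable def coverLeungRegion (PU : stdSimplex ℝ 𝒰) (PX₁ : 𝒰 → stdSimplex ℝ 𝒳₁)
    (PX₂ : 𝒰 → stdSimplex ℝ 𝒳₂) (W : 𝒳₁ → 𝒳₂ → stdSimplex ℝ 𝒴) : Set (ℝ × ℝ) :=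
  let p : 𝒰 × 𝒳₁ × 𝒳₂ × 𝒴 → ℝ := fun (u, x₁, x₂, y) => PU u * PX₁ u x₁ * PX₂ u x₂ * W x₁ x₂ y
  {R |
    R.1 ≤ condMutualInfo p (fun (_, x₁, _, _) => x₁) (fun (_, _, _, y) => y)
        (fun (u, _, x₂, _) => (x₂, u)) ∧
    R.2 ≤ condMutualInfo p (fun (_, _, x₂, _) => x₂) (fun (_, _, _, y) => y)
        (fun (u, x₁, _, _) => (x₁, u)) ∧
    R.1 + R.2 ≤ mutualInfo p (fun (_, x₁, x₂, _) => (x₁, x₂)) (fun (_, _, _, y) => y)}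

end Region

end MACFeedback

/-! Time is cut into `l + 2` blocks of `n` letters. In block `k` each user sends a codeword of
strategies indexed by a fresh message; the common word `u` of block `k + 2` is indexed by the pair
of messages sent in block `k`. A strategy computes the channel input from the common and private
letters, and the private letter of the next block from the state `S` of the current one. A message
sent in block `k` thus affects the outputs of blocks `k` and `k + 1` through its strategy, and of
block `k + 2` through `u`. Each encoder identifies the other message from blocks `k` and `k + 1`,
just in time to choose `u`; the decoder uses all three blocks.

A strategy is a random table with independent entries (`tableStrategies`). Strategies are therefore
independent of everything else, yet reading them reproduces the prescribed conditional laws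
(`expect_block_next`). Consistency says exactly that the private letters keep the law `P_AB` from
block to block (`tableLaws_stationary`). Hence all windows of three blocks have the same law
(`Laws.Stationary.expect_window`), and their first two blocks have the law `jointLaw`
(`prob_sample`).

Candidates are accepted when a product of letterwise likelihood ratios is large (`exists_test`). A
wrong candidate is independent of the window and its ratio has mean at most one, so Markov's
inequality bounds false acceptance; a Chernoff bound handles the true candidate. As long as all
tests are right, the encoders act as if a genie had told them the messages
(`exists_output_of_identifies`). A union bound then makes the error vanish when the rates lie below
the mean logarithms of the tests (`exists_error_exponent`, `achievable_of_tests`).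

These mean logarithms are nearly the mutual informations between a strategy and the observations of
two blocks. For user one's message at encoder two the chain rule yields H(Ỹ|Ũ Ã B̃ X̃₂) - H(Ỹ|X̃₁
X̃₂) from the first block and H(Y|X₂ B U S̃ X̃₂) - H(Y|U A B X₂) from the second. By stationarity
the entropies given U, A, B, X₂ cancel, leaving I(X₁;Y|X₂ B U S̃ X̃₂) (`le_mutualInfo_encoder`). The
decoder does not know X₂ in the second block, which costs I(A;X₂|Y B U S̃ X̃₂)
(`le_mutualInfo_decoder`); the test of the common letter gives back I(U;Y|Ũ Ỹ). Requiring both the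
encoder's and the decoder's bound produces the positive part.

With one-point A and B nothing is carried from one block to the next, so the two blocks are
independent, the correction terms vanish, and I(X₁X₂;Y|U) + I(U;Y) = I(X₁X₂;Y). -/

namespace MACFeedback

/-! ### Expectations over finite probability spaces -/

section Expectation

variable {α β ι κ : Type*}

open Classical in
/-- The indicator of a proposition. -/
noncomputable def ind (P : Prop) : ℝ := if P then 1 else 0

theorem ind_of {P : Prop} (h : P) : ind P = 1 := by simp [ind, h]

theorem ind_of_not {P : Prop} (h : ¬P) : ind P = 0 := by simp [ind, h]

theorem ind_nonneg (P : Prop) : 0 ≤ ind P := by unfold ind; split_ifs <;> norm_num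

theorem ind_le_one (P : Prop) : ind P ≤ 1 := by unfold ind; split_ifs <;> norm_num

theorem ind_mono {P Q : Prop} (h : P → Q) : ind P ≤ ind Q := by
  by_cases hP : P
  · rw [ind_of hP, ind_of (h hP)]
  · rw [ind_of_not hP]; exact ind_nonneg Q

theorem ind_or_le (P Q : Prop) : ind (P ∨ Q) ≤ ind P + ind Q := by
  by_cases hP : P
  · rw [ind_of (Or.inl hP), ind_of hP]; linarith [ind_nonneg Q]
  · by_cases hQ : Q
    · rw [ind_of (Or.inr hQ), ind_of hQ]; linarith [ind_nonneg P]
    · rw [ind_of_not (by tauto)]; exact add_nonneg (ind_nonneg P) (ind_nonneg Q)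

theorem ind_exists_le {s : Finset α} {P : α → Prop} :
    ind (∃ a ∈ s, P a) ≤ ∑ a ∈ s, ind (P a) := by
  by_cases h : ∃ a ∈ s, P a
  · rw [ind_of h]
    obtain ⟨a, ha, hP⟩ := h
    calc (1 : ℝ) = ind (P a) := (ind_of hP).symm
      _ ≤ _ := Finset.single_le_sum (f := fun a => ind (P a)) (fun i _ => ind_nonneg _) ha
  · rw [ind_of_not h]; exact Finset.sum_nonneg fun i _ => ind_nonneg _

variable [Fintype α] [Fintype β]

/-- The expectation of `f` under the weights `p`. -/
noncomputable def expect (p : α → ℝ) (f : α → ℝ) : ℝ := ∑ a, p a * f a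

/-- The product of two laws. -/
def prodLaw (p : α → ℝ) (q : β → ℝ) : α × β → ℝ := fun x => p x.1 * q x.2

/-- The product of a family of laws. -/
def piLaw [Fintype ι] (p : ι → α → ℝ) : (ι → α) → ℝ := fun x => ∏ i, p i (x i)

theorem expect_congr {p : α → ℝ} {f g : α → ℝ} (h : ∀ a, f a = g a) : expect p f = expect p g :=
  congrArg _ (funext h)

theorem expect_const {p : α → ℝ} (hp : p ∈ stdSimplex ℝ α) (c : ℝ) :
    expect p (fun _ => c) = c := by
  rw [expect, ← Finset.sum_mul, hp.2, one_mul]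

theorem expect_mono {p : α → ℝ} (hp : p ∈ stdSimplex ℝ α) {f g : α → ℝ} (h : ∀ a, f a ≤ g a) :
    expect p f ≤ expect p g :=
  Finset.sum_le_sum fun a _ => mul_le_mul_of_nonneg_left (h a) (hp.1 a)

theorem expect_le {p : α → ℝ} (hp : p ∈ stdSimplex ℝ α) {f : α → ℝ} {c : ℝ} (h : ∀ a, f a ≤ c) :
    expect p f ≤ c :=
  (expect_mono hp h).trans_eq (expect_const hp c)

theorem expect_nonneg {p : α → ℝ} (hp : p ∈ stdSimplex ℝ α) {f : α → ℝ} (h : ∀ a, 0 ≤ f a) :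
    0 ≤ expect p f :=
  Finset.sum_nonneg fun a _ => mul_nonneg (hp.1 a) (h a)

theorem expect_add (p : α → ℝ) (f g : α → ℝ) :
    expect p (fun a => f a + g a) = expect p f + expect p g := by
  simp only [expect, mul_add, Finset.sum_add_distrib]

theorem expect_sub (p : α → ℝ) (f g : α → ℝ) :
    expect p (fun a => f a - g a) = expect p f - expect p g := by
  simp only [expect, mul_sub, Finset.sum_sub_distrib]

theorem expect_mul_left (p : α → ℝ) (c : ℝ) (f : α → ℝ) :
    expect p (fun a => c * f a) = c * expect p f := by
  simp only [expect, Finset.mul_sum]; exact Finset.sum_congr rfl fun a _ => by ring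

theorem expect_mul_right (p : α → ℝ) (c : ℝ) (f : α → ℝ) :
    expect p (fun a => f a * c) = expect p f * c := by
  simp only [expect, Finset.sum_mul]; exact Finset.sum_congr rfl fun a _ => by ring

theorem expect_sum (p : α → ℝ) (s : Finset κ) (f : κ → α → ℝ) :
    expect p (fun a => ∑ k ∈ s, f k a) = ∑ k ∈ s, expect p (f k) := by
  simp only [expect, Finset.mul_sum]; exact Finset.sum_comm

theorem expect_comm (p : α → ℝ) (q : β → ℝ) (f : α → β → ℝ) :
    expect p (fun a => expect q (f a)) = expect q (fun b => expect p fun a => f a b) := by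
  simp only [expect, Finset.mul_sum]
  rw [Finset.sum_comm]
  exact Finset.sum_congr rfl fun a _ => Finset.sum_congr rfl fun b _ => by ring

theorem exists_le_of_expect_le {p : α → ℝ} (hp : p ∈ stdSimplex ℝ α) {f : α → ℝ} {c : ℝ}
    (h : expect p f ≤ c) : ∃ a, f a ≤ c := by
  by_contra! hc
  have h1 : expect p f - c = ∑ a, p a * (f a - c) := by
    simp only [mul_sub, Finset.sum_sub_distrib, ← Finset.sum_mul, hp.2, one_mul, expect]
  have h2 : ∀ a ∈ Finset.univ, p a * (f a - c) = 0 := by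
    rw [← Finset.sum_eq_zero_iff_of_nonneg
      (fun a _ => mul_nonneg (hp.1 a) (sub_nonneg.2 (hc a).le))]
    refine le_antisymm (by rw [← h1]; linarith) (Finset.sum_nonneg fun a _ =>
      mul_nonneg (hp.1 a) (sub_nonneg.2 (hc a).le))
  have h3 : ∀ a, p a = 0 := fun a => by
    rcases mul_eq_zero.1 (h2 a (Finset.mem_univ a)) with h | h
    · exact h
    · linarith [hc a]
  have := hp.2
  simp [h3] at this

theorem prodLaw_mem {p : α → ℝ} {q : β → ℝ} (hp : p ∈ stdSimplex ℝ α) (hq : q ∈ stdSimplex ℝ β) :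
    prodLaw p q ∈ stdSimplex ℝ (α × β) := by
  refine ⟨fun x => mul_nonneg (hp.1 _) (hq.1 _), ?_⟩
  simp only [prodLaw, Fintype.sum_prod_type, ← Finset.mul_sum, hq.2, mul_one, hp.2]

theorem expect_prodLaw (p : α → ℝ) (q : β → ℝ) (f : α × β → ℝ) :
    expect (prodLaw p q) f = expect p fun a => expect q fun b => f (a, b) := by
  simp only [expect, prodLaw, Fintype.sum_prod_type, Finset.mul_sum, mul_assoc]

variable [Fintype ι] [Fintype κ]

theorem expect_comp_equiv (e : α ≃ β) (p : β → ℝ) (f : β → ℝ) :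
    expect (fun a => p (e a)) (fun a => f (e a)) = expect p f :=
  Equiv.sum_comp e fun b => p b * f b

variable [DecidableEq ι] [DecidableEq κ]

theorem expect_piLaw_prod (p : ι → α → ℝ) (g : ι → α → ℝ) :
    expect (piLaw p) (fun x => ∏ i, g i (x i)) = ∏ i, expect (p i) (g i) := by
  simp only [expect, piLaw, ← Finset.prod_mul_distrib]
  rw [Finset.prod_univ_sum, Fintype.piFinset_univ]

theorem piLaw_mem {p : ι → α → ℝ} (hp : ∀ i, p i ∈ stdSimplex ℝ α) :
    piLaw p ∈ stdSimplex ℝ (ι → α) := by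
  refine ⟨fun x => Finset.prod_nonneg fun i _ => (hp i).1 _, ?_⟩
  have := expect_piLaw_prod p (fun _ _ => 1)
  simpa [expect, (hp _).2] using this

/-- Coordinate `i` of a product law may be drawn afresh. -/
theorem expect_piLaw_update {p : ι → α → ℝ} (hp : ∀ i, p i ∈ stdSimplex ℝ α) (i : ι)
    (f : (ι → α) → ℝ) :
    expect (piLaw p) f =
      expect (piLaw p) fun x => expect (p i) fun a => f (Function.update x i a) := by
  -- Exchanging coordinate `i` with the extra letter is an involution that preserves the product
  -- weights.
  let e : (ι → α) × α → (ι → α) × α := fun z => (Function.update z.1 i z.2, z.1 i)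
  have he : Function.Involutive e := fun z => by simp [e]
  have h1 : ∑ z : (ι → α) × α, piLaw p z.1 * p i z.2 * f z.1 = expect (piLaw p) f := by
    rw [Fintype.sum_prod_type]
    refine Finset.sum_congr rfl fun x _ => ?_
    simp only
    rw [← Finset.sum_mul, ← Finset.mul_sum, (hp i).2, mul_one]
  rw [← h1, ← Equiv.sum_comp (he.toPerm e), Fintype.sum_prod_type, expect]
  refine Finset.sum_congr rfl fun x _ => ?_
  rw [expect, Finset.mul_sum]
  refine Finset.sum_congr rfl fun a _ => ?_
  have h2 : piLaw p (Function.update x i a) * p i (x i) = piLaw p x * p i a := by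
    simp only [piLaw]
    rw [← Finset.mul_prod_erase _ _ (Finset.mem_univ i),
      ← Finset.mul_prod_erase Finset.univ (fun j => p j (x j)) (Finset.mem_univ i),
      Function.update_self, Finset.prod_congr rfl fun j hj => by
        rw [Function.update_of_ne (Finset.ne_of_mem_erase hj)]]
    ring
  simp only [Function.Involutive.coe_toPerm, e]
  rw [h2]; ring

theorem expect_piLaw_eval {p : ι → α → ℝ} (hp : ∀ i, p i ∈ stdSimplex ℝ α) (i : ι) (f : α → ℝ) :
    expect (piLaw p) (fun x => f (x i)) = expect (p i) f := by
  rw [expect_piLaw_update hp i]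
  simp only [Function.update_self]
  exact expect_const (piLaw_mem hp) _

/-- A selection of distinct coordinates of an i.i.d. family is i.i.d. -/
theorem expect_piLaw_comp {p : α → ℝ} (hp : p ∈ stdSimplex ℝ α) {e : κ → ι}
    (he : Function.Injective e) (f : (κ → α) → ℝ) :
    expect (piLaw fun _ : ι => p) (fun x => f (fun k => x (e k))) =
      expect (piLaw fun _ : κ => p) f := by
  classical
  -- Indicators of single points factor over the coordinates; a coordinate outside the range of `e`
  -- contributes total mass one.
  have key : ∀ y : κ → α, expect (piLaw fun _ : ι => p) (fun x => ind (∀ k, x (e k) = y k)) =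
      piLaw (fun _ => p) y := by
    intro y
    have h1 : ∀ x : ι → α, ind (∀ k, x (e k) = y k) =
        ∏ i, (fun i a => ∏ k, if e k = i then ind (a = y k) else 1) i (x i) := by
      intro x
      simp only
      rw [Finset.prod_comm]
      simp only [Finset.prod_ite_eq, Finset.mem_univ, if_true, ind]
      rw [Finset.prod_ite_zero]
      simp
    rw [funext h1, expect_piLaw_prod (fun _ => p)
      fun i a => ∏ k, if e k = i then ind (a = y k) else 1]
    have h2 : ∀ i, expect p (fun a => ∏ k, if e k = i then ind (a = y k) else 1) =
        ∏ k, if e k = i then p (y k) else 1 := by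
      intro i
      by_cases hi : ∃ k, e k = i
      · obtain ⟨k, rfl⟩ := hi
        simp only [he.eq_iff, Finset.prod_ite_eq', Finset.mem_univ, if_true]
        simp [expect, ind]
      · push Not at hi
        simp only [hi, if_false, Finset.prod_const_one]
        exact expect_const hp 1
    simp only [h2]
    rw [Finset.prod_comm]
    simp [piLaw]
  have h3 : ∀ x : ι → α, f (fun k => x (e k)) = ∑ y : κ → α, ind (∀ k, x (e k) = y k) * f y := by
    intro x
    rw [Finset.sum_eq_single fun k => x (e k)]
    · rw [ind_of fun _ => rfl, one_mul]
    · intro y _ hy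
      rw [ind_of_not fun h => hy (funext fun k => (h k).symm), zero_mul]
    · simp
  simp only [h3]
  rw [expect_sum, expect]
  refine Finset.sum_congr rfl fun y _ => ?_
  rw [expect_mul_right, key]

theorem expect_piLaw_curry (p : α → ℝ) (f : (ι × κ → α) → ℝ) :
    expect (piLaw fun _ : ι × κ => p) f =
      expect (piLaw fun _ : ι => piLaw fun _ : κ => p) fun x => f fun z => x z.1 z.2 := by
  rw [← expect_comp_equiv (Equiv.curry ι κ α).symm]
  simp only [expect, piLaw, Fintype.prod_prod_type]
  rfl

theorem expect_piLaw_prodLaw (p : α → ℝ) (q : β → ℝ) (f : (ι → α × β) → ℝ) :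
    expect (piLaw fun _ : ι => prodLaw p q) f =
      expect (piLaw fun _ : ι => p) fun x => expect (piLaw fun _ : ι => q) fun y =>
        f fun i => (x i, y i) := by
  rw [← expect_prodLaw _ _ fun z : (ι → α) × (ι → β) => f fun i => (z.1 i, z.2 i),
    ← expect_comp_equiv (Equiv.arrowProdEquivProdArrow ι (fun _ => α) (fun _ => β)).symm]
  simp only [expect, piLaw, prodLaw, ← Finset.prod_mul_distrib]
  rfl

end Expectation

/-! ### Entropy inequalities -/

section EntropyInequalities

variable {Ω Ω' α β γ δ : Type*} [Fintype Ω] [Fintype Ω']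

theorem prob_eq_expect (p : Ω → ℝ) (f : Ω → α) (a : α) :
    prob p f a = expect p fun ω => ind (f ω = a) := by
  simp [prob, expect, ind]

theorem prob_nonneg {p : Ω → ℝ} (hp : p ∈ stdSimplex ℝ Ω) (f : Ω → α) (a : α) :
    0 ≤ prob p f a := by
  rw [prob_eq_expect]; exact expect_nonneg hp fun _ => ind_nonneg _

theorem prob_pos {p : Ω → ℝ} (hp : p ∈ stdSimplex ℝ Ω) (f : Ω → α) {ω : Ω} (hω : 0 < p ω) :
    0 < prob p f (f ω) := by
  unfold prob
  refine Finset.sum_pos' (fun i _ => ?_) ⟨ω, Finset.mem_univ _, by simpa using hω⟩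
  split_ifs
  exacts [hp.1 i, le_rfl]

variable [Fintype α]

theorem expect_prob (p : Ω → ℝ) (f : Ω → α) (φ : α → ℝ) :
    expect (prob p f) φ = expect p fun ω => φ (f ω) := by
  simp only [expect, prob, Finset.sum_mul]
  rw [Finset.sum_comm]
  refine Finset.sum_congr rfl fun ω _ => ?_
  rw [Finset.sum_eq_single (f ω)]
  · rw [if_pos rfl]
  · intro a _ ha
    rw [if_neg fun h => ha h.symm, zero_mul]
  · exact fun h => absurd (Finset.mem_univ _) h

theorem prob_mem {p : Ω → ℝ} (hp : p ∈ stdSimplex ℝ Ω) (f : Ω → α) :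
    prob p f ∈ stdSimplex ℝ α := by
  refine ⟨prob_nonneg hp f, ?_⟩
  have := expect_prob p f fun _ => 1
  rw [expect_const hp] at this
  simpa [expect] using this

theorem prob_comp (p : Ω → ℝ) (φ : Ω → α) (f : α → β) :
    prob (prob p φ) f = prob p fun ω => f (φ ω) := by
  ext b
  rw [prob_eq_expect, expect_prob, ← prob_eq_expect]

theorem entropy_prob [Fintype β] (p : Ω → ℝ) (φ : Ω → α) (f : α → β) :
    entropy (prob p φ) f = entropy p fun ω => f (φ ω) := by
  simp only [entropy, prob_comp]

theorem entropy_eq_expect (p : Ω → ℝ) (f : Ω → α) :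
    entropy p f = -expect p fun ω => Real.logb 2 (prob p f (f ω)) := by
  rw [entropy, ← expect_prob p f fun a => Real.logb 2 (prob p f a), expect]

theorem entropy_congr [Fintype β] (p : Ω → ℝ) {f : Ω → α} {g : Ω → β}
    (h : ∀ ω ω', f ω = f ω' ↔ g ω = g ω') : entropy p f = entropy p g := by
  rw [entropy_eq_expect, entropy_eq_expect]
  have : ∀ ω, prob p f (f ω) = prob p g (g ω) := fun ω => by
    rw [prob_eq_expect, prob_eq_expect]
    simp only [h]
  simp only [this]

/-- Expectations only depend on the values on the support. -/
theorem expect_congr_supp {p : Ω → ℝ} (hp : p ∈ stdSimplex ℝ Ω) {f g : Ω → ℝ}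
    (h : ∀ ω, 0 < p ω → f ω = g ω) : expect p f = expect p g := by
  refine Finset.sum_congr rfl fun ω _ => ?_
  rcases (hp.1 ω).eq_or_lt' with h0 | h0
  · rw [h0, zero_mul, zero_mul]
  · rw [h ω h0]

theorem expect_mono_supp {p : Ω → ℝ} (hp : p ∈ stdSimplex ℝ Ω) {f g : Ω → ℝ}
    (h : ∀ ω, 0 < p ω → f ω ≤ g ω) : expect p f ≤ expect p g := by
  refine Finset.sum_le_sum fun ω _ => ?_
  rcases (hp.1 ω).eq_or_lt' with h0 | h0
  · rw [h0, zero_mul, zero_mul]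
  · exact mul_le_mul_of_nonneg_left (h ω h0) (hp.1 ω)

/-- Jensen's inequality in the form log x ≤ x - 1; the only analytic input to the entropy
inequalities. -/
theorem expect_logb_nonpos {p : Ω → ℝ} (hp : p ∈ stdSimplex ℝ Ω) {x : Ω → ℝ}
    (hx : ∀ ω, 0 < p ω → 0 < x ω) (h : expect p x ≤ 1) :
    expect p (fun ω => Real.logb 2 (x ω)) ≤ 0 := by
  have h2 : 0 < Real.log 2 := Real.log_pos one_lt_two
  have h1 : expect p (fun ω => Real.logb 2 (x ω)) ≤
      expect p (fun ω => (x ω - 1) * (Real.log 2)⁻¹) := by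
    refine expect_mono_supp hp fun ω hω => ?_
    rw [Real.logb, div_eq_mul_inv]
    exact mul_le_mul_of_nonneg_right (Real.log_le_sub_one_of_pos (hx ω hω)) (inv_nonneg.2 h2.le)
  rw [expect_mul_right, expect_sub, expect_const hp] at h1
  exact h1.trans (mul_nonpos_of_nonpos_of_nonneg (by linarith) (inv_nonneg.2 h2.le))

theorem sum_prob_pair_left (p : Ω → ℝ) (f : Ω → α) (g : Ω → β) (b : β) :
    ∑ a, prob p (fun ω => (f ω, g ω)) (a, b) = prob p g b := by
  classical
  simp only [prob]
  rw [Finset.sum_comm]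
  refine Finset.sum_congr rfl fun ω _ => ?_
  by_cases h : g ω = b <;> simp [h]

variable [Fintype β] [Fintype γ]

/-- Submodularity of entropy. -/
theorem entropy_submodular {p : Ω → ℝ} (hp : p ∈ stdSimplex ℝ Ω) (f : Ω → α) (g : Ω → β)
    (h : Ω → γ) :
    entropy p (fun ω => (f ω, g ω, h ω)) + entropy p h ≤
      entropy p (fun ω => (f ω, h ω)) + entropy p (fun ω => (g ω, h ω)) := by
  let P := prob p (fun ω => (f ω, g ω, h ω))
  let Pf := prob p (fun ω => (f ω, h ω))
  let Pg := prob p (fun ω => (g ω, h ω))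
  let Ph := prob p h
  -- The mean of `logb 2 x` is the left side minus the right side, and `x` has mean at most one
  -- because Pf · Pg / Ph sums to at most one.
  let x : Ω → ℝ := fun ω => Pf (f ω, h ω) * Pg (g ω, h ω) / (P (f ω, g ω, h ω) * Ph (h ω))
  have hpos : ∀ ω, 0 < p ω → 0 < P (f ω, g ω, h ω) ∧ 0 < Pf (f ω, h ω) ∧ 0 < Pg (g ω, h ω) ∧
      0 < Ph (h ω) := fun ω hω =>
    ⟨prob_pos hp (fun ω => (f ω, g ω, h ω)) hω, prob_pos hp (fun ω => (f ω, h ω)) hω,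
      prob_pos hp (fun ω => (g ω, h ω)) hω, prob_pos hp h hω⟩
  have hle : expect p x ≤ 1 := by
    have h1 : expect p x = expect P fun z : α × β × γ =>
        Pf (z.1, z.2.2) * Pg (z.2.1, z.2.2) / (P z * Ph z.2.2) :=
      (expect_prob p (fun ω => (f ω, g ω, h ω)) fun z : α × β × γ =>
        Pf (z.1, z.2.2) * Pg (z.2.1, z.2.2) / (P z * Ph z.2.2)).symm
    have h2 : expect p x ≤ ∑ z : α × β × γ, Pf (z.1, z.2.2) * Pg (z.2.1, z.2.2) / Ph z.2.2 := by
      rw [h1]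
      refine Finset.sum_le_sum fun z _ => ?_
      have hr : 0 ≤ Pf (z.1, z.2.2) * Pg (z.2.1, z.2.2) / Ph z.2.2 :=
        div_nonneg (mul_nonneg (prob_nonneg hp _ _) (prob_nonneg hp _ _)) (prob_nonneg hp _ _)
      rcases (prob_nonneg hp (fun ω => (f ω, g ω, h ω)) z).eq_or_lt' with h0 | h0
      · change P z = 0 at h0
        rw [h0, zero_mul]; exact hr
      · change 0 < P z at h0
        rw [mul_div_assoc', mul_div_mul_left _ _ h0.ne']
    refine h2.trans ?_
    have h3 : ∑ z : α × β × γ, Pf (z.1, z.2.2) * Pg (z.2.1, z.2.2) / Ph z.2.2 =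
        ∑ c, (∑ a, Pf (a, c)) * (∑ b, Pg (b, c)) / Ph c := by
      simp only [Fintype.sum_prod_type]
      rw [Finset.sum_congr rfl fun a _ => Finset.sum_comm, Finset.sum_comm]
      refine Finset.sum_congr rfl fun c _ => ?_
      rw [Finset.sum_mul_sum, Finset.sum_div]
      exact Finset.sum_congr rfl fun a _ => (Finset.sum_div _ _ _).symm
    rw [h3]
    calc ∑ c, (∑ a, Pf (a, c)) * (∑ b, Pg (b, c)) / Ph c ≤ ∑ c, Ph c := by
          refine Finset.sum_le_sum fun c _ => ?_
          rw [sum_prob_pair_left p f h c, sum_prob_pair_left p g h c]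
          exact (mul_self_div_self (Ph c)).le
      _ = 1 := (prob_mem hp h).2
  have hlog := expect_logb_nonpos hp (x := x) (fun ω hω => by
    obtain ⟨h1, h2, h3, h4⟩ := hpos ω hω
    exact div_pos (mul_pos h2 h3) (mul_pos h1 h4)) hle
  have hsplit : expect p (fun ω => Real.logb 2 (x ω)) =
      expect p (fun ω => Real.logb 2 (Pf (f ω, h ω)) + Real.logb 2 (Pg (g ω, h ω)) -
        (Real.logb 2 (P (f ω, g ω, h ω)) + Real.logb 2 (Ph (h ω)))) := by
    refine expect_congr_supp hp fun ω hω => ?_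
    obtain ⟨h1, h2, h3, h4⟩ := hpos ω hω
    rw [Real.logb_div (mul_pos h2 h3).ne' (mul_pos h1 h4).ne', Real.logb_mul h2.ne' h3.ne',
      Real.logb_mul h1.ne' h4.ne']
  rw [hsplit, expect_sub, expect_add, expect_add] at hlog
  rw [entropy_eq_expect, entropy_eq_expect, entropy_eq_expect, entropy_eq_expect]
  linarith

/-- Conditioning on more reduces entropy: `g` determines `h`. -/
theorem condEntropy_anti {p : Ω → ℝ} (hp : p ∈ stdSimplex ℝ Ω) (f : Ω → α) {g : Ω → β} {h : Ω → γ}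
    (hgh : ∀ ω ω', g ω = g ω' → h ω = h ω') : condEntropy p f g ≤ condEntropy p f h := by
  have h1 := entropy_submodular hp f g h
  have h2 : entropy p (fun ω => (f ω, g ω, h ω)) = entropy p fun ω => (f ω, g ω) :=
    entropy_congr p fun ω ω' => by
      simp only [Prod.mk.injEq]
      have := hgh ω ω'
      tauto
  have h3 : entropy p (fun ω => (g ω, h ω)) = entropy p g :=
    entropy_congr p fun ω ω' => by
      simp only [Prod.mk.injEq]
      have := hgh ω ω'
      tauto
  simp only [condEntropy]
  linarith

theorem condEntropy_congr [Fintype δ] (p : Ω → ℝ) {f : Ω → α} {f' : Ω → δ} {g : Ω → β} {h : Ω → γ}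
    (hf : ∀ ω ω', f ω = f ω' ↔ f' ω = f' ω')
    (hgh : ∀ ω ω', g ω = g ω' ↔ h ω = h ω') : condEntropy p f g = condEntropy p f' h := by
  simp only [condEntropy]
  rw [entropy_congr p hgh, entropy_congr p (f := fun ω => (f ω, g ω)) (g := fun ω => (f' ω, h ω))]
  simp only [Prod.mk.injEq, hf, hgh, implies_true]

/-- The entropy of the output of a channel with input determined by `g`, whatever else is known. -/
theorem condEntropy_eq_of_kernel {p : Ω → ℝ} (hp : p ∈ stdSimplex ℝ Ω) (f : Ω → α) (g : Ω → β)
    (V : Ω → ℝ) (h : ∀ ω, prob p (fun ω => (f ω, g ω)) (f ω, g ω) = prob p g (g ω) * V ω) :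
    condEntropy p f g = -expect p fun ω => Real.logb 2 (V ω) := by
  rw [condEntropy, entropy_eq_expect, entropy_eq_expect,
    expect_congr_supp hp (g := fun ω => Real.logb 2 (prob p g (g ω)) + Real.logb 2 (V ω)),
    expect_add]
  · ring
  · intro ω hω
    have h1 := prob_pos hp (fun ω => (f ω, g ω)) hω
    have h2 := prob_pos hp g hω
    rw [h] at h1 ⊢
    rw [Real.logb_mul h2.ne' (pos_of_mul_pos_right h1 h2.le).ne']

end EntropyInequalities

/-! ### Likelihood-ratio tests -/

section LikelihoodTests

variable {Ω τ υ : Type*} [Fintype Ω] [Fintype τ] [Fintype υ]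

/-- A positive test function whose mean under an independent candidate is at most one, and whose
mean logarithm is almost the mutual information. -/
theorem exists_test {p : Ω → ℝ} (hp : p ∈ stdSimplex ℝ Ω) (T : Ω → τ) (V : Ω → υ) {δ : ℝ}
    (hδ : 0 < δ) : ∃ r : τ → υ → ℝ, (∀ t v, 0 < r t v) ∧
      (∀ v, expect (prob p T) (fun t => r t v) ≤ 1) ∧
      mutualInfo p T V - δ ≤ expect p fun ω => Real.logb 2 (r (T ω) (V ω)) := by
  let P := prob p fun ω => (T ω, V ω)
  let r₀ : τ → υ → ℝ := fun t v => P (t, v) / (prob p T t * prob p V v)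
  -- Mixing the likelihood ratio with the constant one keeps the mean at most one and makes the test
  -- positive everywhere, as the logarithms and negative powers below require. The price is log₂ c =
  -- -δ.
  let c : ℝ := 2 ^ (-δ)
  have hc : 0 < c := Real.rpow_pos_of_pos two_pos _
  have hc1 : c < 1 := Real.rpow_lt_one_of_one_lt_of_neg one_lt_two (neg_lt_zero.2 hδ)
  have hr₀ : ∀ t v, 0 ≤ r₀ t v := fun t v =>
    div_nonneg (prob_nonneg hp _ _) (mul_nonneg (prob_nonneg hp _ _) (prob_nonneg hp _ _))
  refine ⟨fun t v => c * r₀ t v + (1 - c), fun t v => ?_, fun v => ?_, ?_⟩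
  · have := mul_nonneg hc.le (hr₀ t v)
    linarith
  · rw [expect_add, expect_mul_left, expect_const (prob_mem hp T)]
    have h1 : expect (prob p T) (fun t => r₀ t v) ≤ 1 := by
      have h2 : expect (prob p T) (fun t => r₀ t v) ≤ ∑ t, P (t, v) / prob p V v := by
        refine Finset.sum_le_sum fun t _ => ?_
        rcases (prob_nonneg hp T t).eq_or_lt' with h0 | h0
        · rw [h0, zero_mul]
          exact div_nonneg (prob_nonneg hp _ _) (prob_nonneg hp _ _)
        · rw [mul_div_assoc', mul_div_mul_left _ _ h0.ne']
      refine h2.trans ?_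
      rw [← Finset.sum_div, sum_prob_pair_left p T V v]
      exact div_self_le_one _
    nlinarith
  · have h1 : expect p (fun ω => Real.logb 2 (P (T ω, V ω)) - Real.logb 2 (prob p T (T ω)) -
        Real.logb 2 (prob p V (V ω)) - δ) ≤
        expect p fun ω => Real.logb 2 (c * r₀ (T ω) (V ω) + (1 - c)) := by
      refine expect_mono_supp hp fun ω hω => ?_
      have hP : 0 < P (T ω, V ω) := prob_pos hp (fun ω => (T ω, V ω)) hω
      have hT := prob_pos hp T hω
      have hV := prob_pos hp V hω
      have hr : 0 < r₀ (T ω) (V ω) := div_pos hP (mul_pos hT hV)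
      calc _ = Real.logb 2 (c * r₀ (T ω) (V ω)) := by
            rw [Real.logb_mul hc.ne' hr.ne', Real.logb_div hP.ne' (mul_pos hT hV).ne',
              Real.logb_mul hT.ne' hV.ne', Real.logb_rpow two_pos (by norm_num)]
            ring
        _ ≤ _ := Real.logb_le_logb_of_le one_lt_two (mul_pos hc hr) (by linarith)
    refine le_trans (le_of_eq ?_) h1
    rw [expect_sub, expect_sub, expect_sub, expect_const hp, mutualInfo, condEntropy,
      entropy_eq_expect, entropy_eq_expect, entropy_eq_expect]
    ring

/-- An exponential moment for the lower tail of a likelihood ratio. -/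
theorem exists_moment_lt_one {p : Ω → ℝ} (hp : p ∈ stdSimplex ℝ Ω) {r : Ω → ℝ}
    (hr : ∀ ω, 0 < r ω) {g : ℝ} (h : g < expect p fun ω => Real.logb 2 (r ω)) :
    ∃ s : ℝ, 0 < s ∧ expect p (fun ω => (r ω / 2 ^ g) ^ (-s)) < 1 := by
  have hl2 : 0 < Real.log 2 := Real.log_pos one_lt_two
  let X : Ω → ℝ := fun ω => Real.log (r ω) - g * Real.log 2
  have hX : ∀ ω (s : ℝ), (r ω / 2 ^ g) ^ (-s) = Real.exp (-s * X ω) := fun ω s => by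
    have h2 : (0 : ℝ) < 2 ^ g := Real.rpow_pos_of_pos two_pos _
    rw [Real.rpow_def_of_pos (div_pos (hr ω) h2), Real.log_div (hr ω).ne' h2.ne',
      Real.log_rpow two_pos, mul_comm]
  have hd : 0 < expect p X := by
    have h1 : expect p X = Real.log 2 * (expect p (fun ω => Real.logb 2 (r ω)) - g) := by
      rw [mul_sub, ← expect_mul_left, expect_sub, expect_const hp, mul_comm g]
      congr 2; ext ω
      rw [Real.logb, mul_div_cancel₀ _ hl2.ne']
    rw [h1]; exact mul_pos hl2 (by linarith)
  obtain ⟨K, hK0, hK⟩ : ∃ K : ℝ, 0 < K ∧ ∀ ω, |X ω| ≤ K := by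
    refine ⟨∑ ω, |X ω| + 1, by positivity, fun ω => ?_⟩
    have := Finset.single_le_sum (f := fun ω => |X ω|) (fun i _ => abs_nonneg _)
      (Finset.mem_univ ω)
    linarith
  set d := expect p X
  -- The bound `1 / K` keeps the exponent in [-1, 1], where exp x ≤ 1 + x + x²; the other bound
  -- makes the quadratic term at most half of the linear gain `s * d`.
  let s : ℝ := min (1 / K) (d / (2 * K ^ 2))
  have hs : 0 < s := lt_min (by positivity) (by positivity)
  have hs1 : s * K ≤ 1 := by
    calc s * K ≤ 1 / K * K := mul_le_mul_of_nonneg_right (min_le_left _ _) hK0.le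
      _ = 1 := by field_simp
  have hs2 : s * K ^ 2 ≤ d / 2 := by
    calc s * K ^ 2 ≤ d / (2 * K ^ 2) * K ^ 2 :=
          mul_le_mul_of_nonneg_right (min_le_right _ _) (by positivity)
      _ = d / 2 := by field_simp
  refine ⟨s, hs, ?_⟩
  have hb : ∀ ω, (r ω / 2 ^ g) ^ (-s) ≤ 1 + (-s) * X ω + s ^ 2 * K ^ 2 := fun ω => by
    rw [hX]
    have h1 : |-s * X ω| ≤ s * K := by
      rw [abs_mul, abs_neg, abs_of_pos hs]; exact mul_le_mul_of_nonneg_left (hK ω) hs.le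
    have h2 := (abs_le.1 (Real.abs_exp_sub_one_sub_id_le (h1.trans hs1))).2
    have h3 : (-s * X ω) ^ 2 ≤ (s * K) ^ 2 := sq_le_sq' (abs_le.1 h1).1 (abs_le.1 h1).2
    nlinarith
  refine (expect_mono hp hb).trans_lt ?_
  rw [expect_add, expect_add, expect_const hp, expect_const hp, expect_mul_left]
  change 1 + -s * d + s ^ 2 * K ^ 2 < 1
  nlinarith [mul_pos hs hd, mul_le_mul_of_nonneg_left hs2 hs.le]

end LikelihoodTests

/-! ### Transmission systems in block form, with the channel driven by independent noise -/

section BlockSystems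

variable {𝒳₁ 𝒳₂ 𝒴 Z W₁ W₂ : Type*}

theorem ind_forall {ι : Type*} [Fintype ι] (P : ι → Prop) : ind (∀ i, P i) = ∏ i, ind (P i) := by
  classical
  simp only [ind]
  rw [Finset.prod_ite_zero]
  simp

/-- The output sequence `y` is produced by the noise sequence `ζ`. -/
def Drives (ch : Z → 𝒳₁ → 𝒳₂ → 𝒴) {N M₁ M₂ : ℕ} (T : TransmissionSystem 𝒳₁ 𝒳₂ 𝒴 N M₁ M₂)
    (w₁ : Fin M₁) (w₂ : Fin M₂) (ζ : Fin N → Z) (y : Fin N → 𝒴) : Prop :=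
  ∀ t, ch (ζ t) (T.enc₁ t w₁ (past y t)) (T.enc₂ t w₂ (past y t)) = y t

theorem Drives.unique {ch : Z → 𝒳₁ → 𝒳₂ → 𝒴} {N M₁ M₂ : ℕ}
    {T : TransmissionSystem 𝒳₁ 𝒳₂ 𝒴 N M₁ M₂} {w₁ : Fin M₁} {w₂ : Fin M₂} {ζ : Fin N → Z}
    {y y' : Fin N → 𝒴} (h : Drives ch T w₁ w₂ ζ y) (h' : Drives ch T w₁ w₂ ζ y') : y = y' := by
  have key : ∀ k : ℕ, ∀ hk : k < N, y ⟨k, hk⟩ = y' ⟨k, hk⟩ := by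
    intro k
    induction k using Nat.strong_induction_on with
    | _ k ih =>
      intro hk
      have hp : past y ⟨k, hk⟩ = past y' ⟨k, hk⟩ := by
        funext j
        exact ih j j.isLt (j.isLt.trans hk)
      rw [← h ⟨k, hk⟩, ← h' ⟨k, hk⟩, hp]
  funext t
  exact key t t.isLt

variable [Fintype 𝒴] [Fintype Z] {W : 𝒳₁ → 𝒳₂ → stdSimplex ℝ 𝒴} {ch : Z → 𝒳₁ → 𝒳₂ → 𝒴} {pZ : Z → ℝ}

theorem outputProb_eq_expect
    (hW : ∀ x₁ x₂ y, expect pZ (fun z => ind (ch z x₁ x₂ = y)) = W x₁ x₂ y)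
    {N M₁ M₂ : ℕ} (T : TransmissionSystem 𝒳₁ 𝒳₂ 𝒴 N M₁ M₂) (w₁ : Fin M₁) (w₂ : Fin M₂)
    (y : Fin N → 𝒴) :
    outputProb W T w₁ w₂ y =
      expect (piLaw fun _ => pZ) fun ζ => ind (Drives ch T w₁ w₂ ζ y) := by
  simp only [Drives, ind_forall]
  rw [expect_piLaw_prod (fun _ => pZ) fun t z =>
    ind (ch z (T.enc₁ t w₁ (past y t)) (T.enc₂ t w₂ (past y t)) = y t)]
  simp only [hW, outputProb]

/-- A noise sequence drives at most one output sequence, so the sum over outputs collapses to one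
error indicator per noise sequence. -/
theorem error_le_expect (hp : pZ ∈ stdSimplex ℝ Z)
    (hW : ∀ x₁ x₂ y, expect pZ (fun z => ind (ch z x₁ x₂ = y)) = W x₁ x₂ y)
    {N M₁ M₂ : ℕ} (T : TransmissionSystem 𝒳₁ 𝒳₂ 𝒴 N M₁ M₂) (w₁ : Fin M₁) (w₂ : Fin M₂)
    (G : (Fin N → Z) → Prop)
    (hG : ∀ ζ, G ζ → ∀ y, Drives ch T w₁ w₂ ζ y → T.dec y = (w₁, w₂)) :
    (∑ y, if T.dec y ≠ (w₁, w₂) then outputProb W T w₁ w₂ y else 0) ≤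
      expect (piLaw fun _ => pZ) fun ζ => ind ¬G ζ := by
  have h1 : ∀ y, (if T.dec y ≠ (w₁, w₂) then outputProb W T w₁ w₂ y else 0) =
      expect (piLaw fun _ => pZ) fun ζ =>
        ind (T.dec y ≠ (w₁, w₂)) * ind (Drives ch T w₁ w₂ ζ y) := by
    intro y
    rw [expect_mul_left, ← outputProb_eq_expect hW]
    by_cases h : T.dec y ≠ (w₁, w₂)
    · rw [if_pos h, ind_of h, one_mul]
    · rw [if_neg h, ind_of_not h, zero_mul]
  rw [Finset.sum_congr rfl fun y _ => h1 y, ← expect_sum]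
  refine expect_mono (piLaw_mem fun _ => hp) fun ζ => ?_
  by_cases hgood : G ζ
  · refine le_trans (le_of_eq (Finset.sum_eq_zero fun y _ => ?_)) (ind_nonneg _)
    by_cases hd : Drives ch T w₁ w₂ ζ y
    · rw [ind_of_not (not_not_intro (hG ζ hgood y hd)), zero_mul]
    · rw [ind_of_not hd, mul_zero]
  · rw [ind_of hgood]
    by_cases hex : ∃ y, Drives ch T w₁ w₂ ζ y
    · obtain ⟨y, hy⟩ := hex
      rw [Finset.sum_eq_single y]
      · exact mul_le_one₀ (ind_le_one _) (ind_nonneg _) (ind_le_one _)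
      · intro y' _ hne
        rw [ind_of_not (P := Drives ch T w₁ w₂ ζ y') fun h => hne (h.unique hy), mul_zero]
      · exact fun h => absurd (Finset.mem_univ _) h
    · push Not at hex
      rw [Finset.sum_eq_zero fun y _ => by rw [ind_of_not (hex y), mul_zero]]
      exact zero_le_one

/-- Arrange a finite sequence in blocks of length `n`. -/
def toBlocks (n : ℕ) (y₀ : 𝒴) {t : ℕ} (v : Fin t → 𝒴) : ℕ → Fin n → 𝒴 :=
  fun b i => if h : b * n + i < t then v ⟨b * n + i, h⟩ else y₀

/-- The encoder input in block `b` depends on the outputs in earlier blocks only. -/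
def BlockCausal {n : ℕ} {𝒳 : Type*} (f : (ℕ → Fin n → 𝒴) → ℕ → Fin n → 𝒳) : Prop :=
  ∀ y y' b, (∀ b' < b, y b' = y' b') → f y b = f y' b

/-- It is enough to exhibit, for each good noise, outputs compatible with the encoders on the first
`L` blocks: causality forces them to be the actual ones. The letter `y₀` only fills positions not
yet received. -/
theorem exists_system [Fintype W₁] [Fintype W₂] (hp : pZ ∈ stdSimplex ℝ Z)
    (hW : ∀ x₁ x₂ y, expect pZ (fun z => ind (ch z x₁ x₂ = y)) = W x₁ x₂ y)
    {N L n : ℕ} (hn : 0 < n) (hN : L * n ≤ N) (y₀ : 𝒴)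
    (f₁ : W₁ → (ℕ → Fin n → 𝒴) → ℕ → Fin n → 𝒳₁) (f₂ : W₂ → (ℕ → Fin n → 𝒴) → ℕ → Fin n → 𝒳₂)
    (hf₁ : ∀ w, BlockCausal (f₁ w)) (hf₂ : ∀ w, BlockCausal (f₂ w))
    (d : (ℕ → Fin n → 𝒴) → W₁ × W₂)
    (hd : ∀ y y', (∀ b < L, y b = y' b) → d y = d y')
    (G : W₁ → W₂ → (Fin n → Fin L → Z) → Prop)
    (hG : ∀ w₁ w₂ ζ, G w₁ w₂ ζ → ∃ y : ℕ → Fin n → 𝒴,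
      (∀ (b : Fin L) i, y b i = ch (ζ i b) (f₁ w₁ y b i) (f₂ w₂ y b i)) ∧ d y = (w₁, w₂)) :
    ∃ T : TransmissionSystem 𝒳₁ 𝒳₂ 𝒴 N (Fintype.card W₁) (Fintype.card W₂),
      avgErrorProb W T ≤ (1 / ((Fintype.card W₁ : ℝ) * Fintype.card W₂)) *
        ∑ w₁, ∑ w₂, expect (piLaw fun _ => piLaw fun _ => pZ) fun ζ => ind ¬G w₁ w₂ ζ := by
  let e₁ := (Fintype.equivFin W₁).symm
  let e₂ := (Fintype.equivFin W₂).symm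
  let T : TransmissionSystem 𝒳₁ 𝒳₂ 𝒴 N (Fintype.card W₁) (Fintype.card W₂) :=
    { enc₁ := fun t w v => f₁ (e₁ w) (toBlocks n y₀ v) (t / n) ⟨t % n, Nat.mod_lt _ hn⟩
      enc₂ := fun t w v => f₂ (e₂ w) (toBlocks n y₀ v) (t / n) ⟨t % n, Nat.mod_lt _ hn⟩
      dec := fun y => (e₁.symm (d (toBlocks n y₀ y)).1, e₂.symm (d (toBlocks n y₀ y)).2) }
  have hlt : ∀ (b : Fin L) (i : Fin n), (b : ℕ) * n + i < N := fun b i => by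
    have h1 : ((b : ℕ) + 1) * n ≤ L * n := Nat.mul_le_mul_right _ b.isLt
    have h2 := i.isLt
    rw [Nat.add_mul, one_mul] at h1
    omega
  let tm : Fin n × Fin L → Fin N := fun z => ⟨z.2 * n + z.1, hlt z.2 z.1⟩
  have htm : Function.Injective tm := by
    rintro ⟨i, b⟩ ⟨i', b'⟩ h
    have h1 : (b : ℕ) * n + i = b' * n + i' := congrArg Fin.val h
    have h2 : (b : ℕ) = b' := by
      have := congrArg (· / n) h1
      simpa [Nat.add_comm, Nat.add_mul_div_right _ _ hn, Nat.div_eq_of_lt i.isLt,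
        Nat.div_eq_of_lt i'.isLt] using this
    have h3 : (i : ℕ) = i' := by rw [h2] at h1; omega
    exact Prod.ext (Fin.ext h3) (Fin.ext h2)
  refine ⟨T, mul_le_mul_of_nonneg_left ?_ (by positivity)⟩
  rw [← e₁.sum_comp]
  refine Finset.sum_le_sum fun w₁ _ => ?_
  rw [← e₂.sum_comp]
  refine Finset.sum_le_sum fun w₂ _ => ?_
  refine (error_le_expect hp hW T w₁ w₂
    (fun ζ => G (e₁ w₁) (e₂ w₂) fun i b => ζ (tm (i, b))) ?_).trans (le_of_eq ?_)
  · intro ζ hζ y hy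
    obtain ⟨g, hg, hdg⟩ := hG _ _ _ hζ
    -- At time `b * n + i` the past contains every block before `b`, and block-causal encoders
    -- consult nothing else.
    have key : ∀ b : ℕ, b < L → g b = toBlocks n y₀ y b := by
      intro b
      induction b using Nat.strong_induction_on with
      | _ b ih =>
        intro hb
        funext i
        have ht := hlt ⟨b, hb⟩ i
        simp only at ht
        have hdiv : (b * n + i) / n = b := by
          rw [Nat.add_comm, Nat.add_mul_div_right _ _ hn, Nat.div_eq_of_lt i.isLt, zero_add]
        have hmod : (b * n + i) % n = i := by
          rw [Nat.add_comm, Nat.add_mul_mod_self_right, Nat.mod_eq_of_lt i.isLt]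
        have hpast : ∀ b' < b, toBlocks n y₀ (past y ⟨b * n + i, ht⟩) b' = g b' := by
          intro b' hb'
          rw [ih b' hb' (hb'.trans hb)]
          funext i'
          have h1 : b' * n + i' < b * n + i := by
            have h1 : (b' + 1) * n ≤ b * n := Nat.mul_le_mul_right _ hb'
            have h2 := i'.isLt
            rw [Nat.add_mul, one_mul] at h1
            omega
          simp only [toBlocks, dif_pos h1, dif_pos (h1.trans ht)]
          rfl
        have hyt := hy ⟨b * n + i, ht⟩
        simp only [T, hdiv, hmod] at hyt
        rw [hf₁ _ _ _ b hpast, hf₂ _ _ _ b hpast] at hyt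
        rw [hg ⟨b, hb⟩ i]
        simp only [toBlocks, dif_pos ht]
        exact hyt
    have : d (toBlocks n y₀ y) = (e₁ w₁, e₂ w₂) := by
      rw [← hdg]; exact hd _ _ fun b hb => (key b hb).symm
    simp only [T, this, Equiv.symm_apply_apply]
  -- The noise at the times after the first `L * n` integrates out.
  · rw [expect_piLaw_comp hp htm (f := fun ξ => ind ¬G (e₁ w₁) (e₂ w₂) fun i b => ξ (i, b)),
      expect_piLaw_curry]

end BlockSystems

/-! ### Block-Markov superposition coding with letterwise strategies -/

section Scheme

/-- Letterwise strategies for the two users. A strategy maps the common letter `u` and the private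
letter to a channel input, and the state of the block to the private letter of the next block. -/
structure Strategies (𝒰 𝒜 ℬ 𝒳₁ 𝒳₂ 𝒴 T₁ T₂ Z : Type*) where
  inp₁ : T₁ → 𝒰 → 𝒜 → 𝒳₁
  inp₂ : T₂ → 𝒰 → ℬ → 𝒳₂
  upd₁ : T₁ → State 𝒰 𝒜 ℬ 𝒴 → 𝒜
  upd₂ : T₂ → State 𝒰 𝒜 ℬ 𝒴 → ℬ
  chan : Z → 𝒳₁ → 𝒳₂ → 𝒴

/-- What drives one letter in one block: the common letter, the two strategies, the noise. -/
abbrev Seed (𝒰 T₁ T₂ Z : Type*) := 𝒰 × T₁ × T₂ × Z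

/-- One letter of the codebook for `l` message blocks (and two blocks with dummy messages): the
initial private letters, the common letters, and the strategies of the two users. -/
abbrev CodeLetter (𝒰 𝒜 ℬ T₁ T₂ : Type*) (l m₁ m₂ : ℕ) :=
  (𝒜 × ℬ) × (Fin (l + 2) × Fin m₁ × Fin m₂ → 𝒰) × (Fin (l + 2) × Fin m₁ → T₁) ×
    (Fin (l + 2) × Fin m₂ → T₂)

/-- Letterwise test functions. Encoder `i` tests for the
strategy of the other user with `eᵢ`; the decoder tests for the strategies of user one, user two and
both users with `d₁`, `d₂`, `d₀`, and for the common letter two blocks later with `h`. -/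
structure Tests (𝒰 𝒜 ℬ 𝒴 T₁ T₂ : Type*) where
  e₁ : T₂ → State 𝒰 𝒜 ℬ 𝒴 → T₁ → T₁ → 𝒰 → 𝒴 → ℝ
  e₂ : T₁ → State 𝒰 𝒜 ℬ 𝒴 → T₂ → T₂ → 𝒰 → 𝒴 → ℝ
  d₁ : T₁ → State 𝒰 𝒜 ℬ 𝒴 → T₂ → 𝒰 → 𝒴 → ℝ
  d₂ : T₂ → State 𝒰 𝒜 ℬ 𝒴 → T₁ → 𝒰 → 𝒴 → ℝ
  d₀ : T₁ → T₂ → State 𝒰 𝒜 ℬ 𝒴 → 𝒰 → 𝒴 → ℝ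
  h : 𝒰 → 𝒰 → 𝒴 → 𝒴 → ℝ

/-- The thresholds for the five tests. -/
structure Thresholds where
  e₁ : ℝ
  e₂ : ℝ
  d₁ : ℝ
  d₂ : ℝ
  d₀ : ℝ

variable {𝒰 𝒜 ℬ 𝒳₁ 𝒳₂ 𝒴 T₁ T₂ Z : Type*} {l m₁ m₂ : ℕ}

namespace CodeLetter

/-- The common letter in block `b`. -/
def u (c : CodeLetter 𝒰 𝒜 ℬ T₁ T₂ l m₁ m₂) (b : ℕ) (i : Fin m₁) (j : Fin m₂) : 𝒰 :=
  c.2.1 (Fin.ofNat (l + 2) b, i, j)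

/-- The strategy of user one in block `b`. -/
def t₁ (c : CodeLetter 𝒰 𝒜 ℬ T₁ T₂ l m₁ m₂) (b : ℕ) (i : Fin m₁) : T₁ :=
  c.2.2.1 (Fin.ofNat (l + 2) b, i)

/-- The strategy of user two in block `b`. -/
def t₂ (c : CodeLetter 𝒰 𝒜 ℬ T₁ T₂ l m₁ m₂) (b : ℕ) (j : Fin m₂) : T₂ :=
  c.2.2.2 (Fin.ofNat (l + 2) b, j)

end CodeLetter

namespace Strategies

variable (S : Strategies 𝒰 𝒜 ℬ 𝒳₁ 𝒳₂ 𝒴 T₁ T₂ Z)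

/-- The channel output. -/
def out (d : 𝒜 × ℬ) (σ : Seed 𝒰 T₁ T₂ Z) : 𝒴 :=
  S.chan σ.2.2.2 (S.inp₁ σ.2.1 σ.1 d.1) (S.inp₂ σ.2.2.1 σ.1 d.2)

/-- The state of a block. -/
def state (d : 𝒜 × ℬ) (σ : Seed 𝒰 T₁ T₂ Z) : State 𝒰 𝒜 ℬ 𝒴 := (σ.1, d.1, d.2, S.out d σ)

/-- The private letters of the next block. -/
def next (d : 𝒜 × ℬ) (σ : Seed 𝒰 T₁ T₂ Z) : 𝒜 × ℬ :=
  (S.upd₁ σ.2.1 (S.state d σ), S.upd₂ σ.2.2.1 (S.state d σ))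

/-- The private letters of all blocks. -/
def orbit (d : 𝒜 × ℬ) (σ : ℕ → Seed 𝒰 T₁ T₂ Z) : ℕ → 𝒜 × ℬ
  | 0 => d
  | b + 1 => S.next (orbit d σ b) (σ b)

theorem orbit_congr (d : 𝒜 × ℬ) {σ σ' : ℕ → Seed 𝒰 T₁ T₂ Z} (k : ℕ) (h : ∀ b < k, σ b = σ' b) :
    S.orbit d σ k = S.orbit d σ' k := by
  induction k with
  | zero => rfl
  | succ k ih =>
    rw [orbit, orbit, ih fun b hb => h b (hb.trans k.lt_succ_self), h k k.lt_succ_self]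

variable (c : CodeLetter 𝒰 𝒜 ℬ T₁ T₂ l m₁ m₂) (μ₁ : ℕ → Fin m₁) (μ₂ : ℕ → Fin m₂) (y : ℕ → 𝒴)

/-- The private letters of all blocks, computed from the messages and the channel outputs. Block
`b` carries the messages `μᵢ (b + 2)`, and its common letter those of block `b - 2`. -/
def replay : ℕ → 𝒜 × ℬ
  | 0 => c.1
  | b + 1 =>
    let s : State 𝒰 𝒜 ℬ 𝒴 := (c.u b (μ₁ b) (μ₂ b), (replay b).1, (replay b).2, y b)
    (S.upd₁ (c.t₁ b (μ₁ (b + 2))) s, S.upd₂ (c.t₂ b (μ₂ (b + 2))) s)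

/-- The state of block `b`, computed from the messages and the channel outputs. -/
def replayState (b : ℕ) : State 𝒰 𝒜 ℬ 𝒴 :=
  (c.u b (μ₁ b) (μ₂ b), (S.replay c μ₁ μ₂ y b).1, (S.replay c μ₁ μ₂ y b).2, y b)

/-- The seeds selected by the messages. -/
def seeds (ζ : ℕ → Z) (b : ℕ) : Seed 𝒰 T₁ T₂ Z :=
  (c.u b (μ₁ b) (μ₂ b), c.t₁ b (μ₁ (b + 2)), c.t₂ b (μ₂ (b + 2)), ζ b)

/-- The channel outputs when both encoders know all messages they need. -/
def genie (ζ : ℕ → Z) (b : ℕ) : 𝒴 :=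
  S.out (S.orbit c.1 (seeds c μ₁ μ₂ ζ) b) (seeds c μ₁ μ₂ ζ b)

theorem replay_genie (ζ : ℕ → Z) (b : ℕ) :
    S.replay c μ₁ μ₂ (S.genie c μ₁ μ₂ ζ) b = S.orbit c.1 (seeds c μ₁ μ₂ ζ) b := by
  induction b with
  | zero => rfl
  | succ b ih => simp only [replay, ih]; rfl

theorem replayState_genie (ζ : ℕ → Z) (b : ℕ) :
    S.replayState c μ₁ μ₂ (S.genie c μ₁ μ₂ ζ) b =
      S.state (S.orbit c.1 (seeds c μ₁ μ₂ ζ) b) (seeds c μ₁ μ₂ ζ b) := by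
  simp only [replayState, replay_genie]; rfl

variable {μ₁ μ₂ y} {ν₁ : ℕ → Fin m₁} {ν₂ : ℕ → Fin m₂} {y' : ℕ → 𝒴}

theorem replay_congr {b : ℕ} (h₁ : ∀ j ≤ b + 1, μ₁ j = ν₁ j) (h₂ : ∀ j ≤ b + 1, μ₂ j = ν₂ j)
    (hy : ∀ j < b, y j = y' j) : S.replay c μ₁ μ₂ y b = S.replay c ν₁ ν₂ y' b := by
  induction b with
  | zero => rfl
  | succ b ih =>
    rw [replay, replay, ih (fun j hj => h₁ j (by omega)) (fun j hj => h₂ j (by omega))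
      (fun j hj => hy j (by omega)), h₁ b (by omega), h₂ b (by omega), hy b (by omega),
      h₁ (b + 2) (by omega), h₂ (b + 2) (by omega)]

theorem replayState_congr {b : ℕ} (h₁ : ∀ j ≤ b + 1, μ₁ j = ν₁ j) (h₂ : ∀ j ≤ b + 1, μ₂ j = ν₂ j)
    (hy : ∀ j ≤ b, y j = y' j) : S.replayState c μ₁ μ₂ y b = S.replayState c ν₁ ν₂ y' b := by
  rw [replayState, replayState, S.replay_congr c h₁ h₂ fun j hj => hy j hj.le, h₁ b (by omega),
    h₂ b (by omega), hy b le_rfl]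

/-- The message of user two with index `b + 1` selects only the strategy that user two had in block
`b - 1`, which does not enter user one's letter in block `b`. So encoder one can act in block `b`
knowing the other messages up to index `b`. -/
theorem replay_fst_congr {b : ℕ} (h₁ : ∀ j ≤ b + 1, μ₁ j = ν₁ j) (h₂ : ∀ j ≤ b, μ₂ j = ν₂ j)
    (hy : ∀ j < b, y j = y' j) : (S.replay c μ₁ μ₂ y b).1 = (S.replay c ν₁ ν₂ y' b).1 := by
  cases b with
  | zero => rfl
  | succ b =>
    have h := S.replayState_congr c (b := b) (fun j hj => h₁ j (by omega))
      (fun j hj => h₂ j (by omega)) (fun j hj => hy j (by omega))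
    change S.upd₁ _ (S.replayState c μ₁ μ₂ y b) = S.upd₁ _ (S.replayState c ν₁ ν₂ y' b)
    rw [h, h₁ (b + 2) (by omega)]

theorem replay_snd_congr {b : ℕ} (h₁ : ∀ j ≤ b, μ₁ j = ν₁ j) (h₂ : ∀ j ≤ b + 1, μ₂ j = ν₂ j)
    (hy : ∀ j < b, y j = y' j) : (S.replay c μ₁ μ₂ y b).2 = (S.replay c ν₁ ν₂ y' b).2 := by
  cases b with
  | zero => rfl
  | succ b =>
    have h := S.replayState_congr c (b := b) (fun j hj => h₁ j (by omega))
      (fun j hj => h₂ j (by omega)) (fun j hj => hy j (by omega))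
    change S.upd₂ _ (S.replayState c μ₁ μ₂ y b) = S.upd₂ _ (S.replayState c ν₁ ν₂ y' b)
    rw [h, h₂ (b + 2) (by omega)]

/-! #### The tests -/

variable (𝒯 : Tests 𝒰 𝒜 ℬ 𝒴 T₁ T₂) (θ : Thresholds) (μ₁ μ₂ y)

/-- The test of encoder one for the message `j` of user two in block `k`. -/
def statE₁ (k : ℕ) (j : Fin m₂) : ℝ :=
  𝒯.e₁ (c.t₂ k j) (S.replayState c μ₁ μ₂ y k) (c.t₁ k (μ₁ (k + 2))) (c.t₁ (k + 1) (μ₁ (k + 3)))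
    (c.u (k + 1) (μ₁ (k + 1)) (μ₂ (k + 1))) (y (k + 1))

/-- The test of encoder two for the message `i` of user one in block `k`. -/
def statE₂ (k : ℕ) (i : Fin m₁) : ℝ :=
  𝒯.e₂ (c.t₁ k i) (S.replayState c μ₁ μ₂ y k) (c.t₂ k (μ₂ (k + 2))) (c.t₂ (k + 1) (μ₂ (k + 3)))
    (c.u (k + 1) (μ₁ (k + 1)) (μ₂ (k + 1))) (y (k + 1))

/-- The test of the decoder for the common letter in block `k + 2`. -/
def statU (k : ℕ) (i : Fin m₁) (j : Fin m₂) : ℝ :=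
  𝒯.h (c.u (k + 2) i j) (c.u (k + 1) (μ₁ (k + 1)) (μ₂ (k + 1))) (y (k + 1)) (y (k + 2))

/-- The test of the decoder for the message of user one in block `k`. -/
def statD₁ (k : ℕ) (i : Fin m₁) (j : Fin m₂) : ℝ :=
  𝒯.d₁ (c.t₁ k i) (S.replayState c μ₁ μ₂ y k) (c.t₂ k j)
    (c.u (k + 1) (μ₁ (k + 1)) (μ₂ (k + 1))) (y (k + 1)) * statU c μ₁ μ₂ y 𝒯 k i j

/-- The test of the decoder for the message of user two in block `k`. -/
def statD₂ (k : ℕ) (i : Fin m₁) (j : Fin m₂) : ℝ :=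
  𝒯.d₂ (c.t₂ k j) (S.replayState c μ₁ μ₂ y k) (c.t₁ k i)
    (c.u (k + 1) (μ₁ (k + 1)) (μ₂ (k + 1))) (y (k + 1)) * statU c μ₁ μ₂ y 𝒯 k i j

/-- The test of the decoder for the messages of both users in block `k`. -/
def statD₀ (k : ℕ) (i : Fin m₁) (j : Fin m₂) : ℝ :=
  𝒯.d₀ (c.t₁ k i) (c.t₂ k j) (S.replayState c μ₁ μ₂ y k)
    (c.u (k + 1) (μ₁ (k + 1)) (μ₂ (k + 1))) (y (k + 1)) * statU c μ₁ μ₂ y 𝒯 k i j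

end Strategies

/-! #### Codes of length `n` in each block -/

variable {n : ℕ} (S : Strategies 𝒰 𝒜 ℬ 𝒳₁ 𝒳₂ 𝒴 T₁ T₂ Z) (𝒯 : Tests 𝒰 𝒜 ℬ 𝒴 T₁ T₂)
  (θ : Thresholds) (c : Fin n → CodeLetter 𝒰 𝒜 ℬ T₁ T₂ l m₁ m₂)
  (μ₁ : ℕ → Fin m₁) (μ₂ : ℕ → Fin m₂) (y : ℕ → Fin n → 𝒴)

/-- Encoder one accepts the message `j` of user two in block `k`. -/
def PassE₁ (k : ℕ) (j : Fin m₂) : Prop :=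
  θ.e₁ < ∏ i, S.statE₁ (c i) μ₁ μ₂ (fun b => y b i) 𝒯 k j

/-- Encoder two accepts the message `j` of user one in block `k`. -/
def PassE₂ (k : ℕ) (j : Fin m₁) : Prop :=
  θ.e₂ < ∏ i, S.statE₂ (c i) μ₁ μ₂ (fun b => y b i) 𝒯 k j

/-- The decoder accepts the messages in block `k`. -/
def PassD (k : ℕ) (j₁ : Fin m₁) (j₂ : Fin m₂) : Prop :=
  θ.d₁ < ∏ i, S.statD₁ (c i) μ₁ μ₂ (fun b => y b i) 𝒯 k j₁ j₂ ∧
  θ.d₂ < ∏ i, S.statD₂ (c i) μ₁ μ₂ (fun b => y b i) 𝒯 k j₁ j₂ ∧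
  θ.d₀ < ∏ i, S.statD₀ (c i) μ₁ μ₂ (fun b => y b i) 𝒯 k j₁ j₂

variable {μ₁ μ₂ y} {ν₁ : ℕ → Fin m₁} {ν₂ : ℕ → Fin m₂} {y' : ℕ → Fin n → 𝒴}

/-- The candidate has index `k + 2`, while the test involves other messages of user two only up to
index `k + 1`: messages can be identified one after the other. -/
theorem passE₁_congr {k : ℕ} (h₂ : ∀ j ≤ k + 1, μ₂ j = ν₂ j) (hy : ∀ j ≤ k + 1, y j = y' j)
    (j : Fin m₂) : PassE₁ S 𝒯 θ c μ₁ μ₂ y k j ↔ PassE₁ S 𝒯 θ c μ₁ ν₂ y' k j := by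
  simp only [PassE₁, Strategies.statE₁]
  simp only [fun i => S.replayState_congr (c i) (b := k) (μ₁ := μ₁) (ν₁ := μ₁) (fun j _ => rfl) h₂
    (y := fun b => y b i) (y' := fun b => y' b i) (fun j hj => by rw [hy j (by omega)]),
    h₂ (k + 1) le_rfl, hy (k + 1) le_rfl]

theorem passE₂_congr {k : ℕ} (h₁ : ∀ j ≤ k + 1, μ₁ j = ν₁ j) (hy : ∀ j ≤ k + 1, y j = y' j)
    (j : Fin m₁) : PassE₂ S 𝒯 θ c μ₁ μ₂ y k j ↔ PassE₂ S 𝒯 θ c ν₁ μ₂ y' k j := by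
  simp only [PassE₂, Strategies.statE₂]
  simp only [fun i => S.replayState_congr (c i) (b := k) (μ₂ := μ₂) (ν₂ := μ₂) h₁ (fun j _ => rfl)
    (y := fun b => y b i) (y' := fun b => y' b i) (fun j hj => by rw [hy j (by omega)]),
    h₁ (k + 1) le_rfl, hy (k + 1) le_rfl]

theorem passD_congr {k : ℕ} (h₁ : ∀ j ≤ k + 1, μ₁ j = ν₁ j) (h₂ : ∀ j ≤ k + 1, μ₂ j = ν₂ j)
    (hy : ∀ j ≤ k + 2, y j = y' j) (j₁ : Fin m₁) (j₂ : Fin m₂) :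
    PassD S 𝒯 θ c μ₁ μ₂ y k j₁ j₂ ↔ PassD S 𝒯 θ c ν₁ ν₂ y' k j₁ j₂ := by
  simp only [PassD, Strategies.statD₁, Strategies.statD₂, Strategies.statD₀, Strategies.statU]
  simp only [fun i => S.replayState_congr (c i) (b := k) h₁ h₂
    (y := fun b => y b i) (y' := fun b => y' b i) (fun j hj => by rw [hy j (by omega)]),
    h₁ (k + 1) le_rfl, h₂ (k + 1) le_rfl, hy (k + 1) (by omega), hy (k + 2) le_rfl]

/-- The messages of all blocks: dummies at `0`, `1` and from `l + 2` on. -/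
def extend {m : ℕ} [NeZero m] (w : Fin l → Fin m) (k : ℕ) : Fin m :=
  if h : 2 ≤ k ∧ k < l + 2 then w ⟨k - 2, by omega⟩ else 0

/-- Strong induction on the index: dummy positions agree by definition, and at a real position the
hypothesis may use agreement at all smaller ones. -/
theorem extend_congr {m : ℕ} [NeZero m] {w w' : Fin l → Fin m} {b : ℕ}
    (h : ∀ k, k + 2 ≤ b → k < l → (∀ j ≤ k + 1, extend w' j = extend w j) →
      extend w' (k + 2) = extend w (k + 2)) :
    ∀ j ≤ b, extend w' j = extend w j := by
  intro j
  induction j using Nat.strong_induction_on with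
  | _ j ih =>
    intro hj
    by_cases hj2 : 2 ≤ j ∧ j < l + 2
    · obtain ⟨k, rfl⟩ := Nat.exists_eq_add_of_le' hj2.1
      exact h k hj (by omega) fun j' hj' => ih j' (by omega) (by omega)
    · simp only [extend, dif_neg hj2]

theorem extend_injective {m : ℕ} [NeZero m] {w w' : Fin l → Fin m}
    (h : ∀ j ≤ l + 1, extend w' j = extend w j) : w' = w := by
  funext k
  have h1 := h (k + 2) (by omega)
  simpa [extend] using h1

variable [NeZero m₁] [NeZero m₂]

/-- Messages of user two compatible with all tests of encoder one before block `b`. -/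
noncomputable def guess₂ (w₁ : Fin l → Fin m₁) (y : ℕ → Fin n → 𝒴) (b : ℕ) : Fin l → Fin m₂ :=
  Classical.epsilon fun w₂ => ∀ k, k + 2 ≤ b → k < l →
    PassE₁ S 𝒯 θ c (extend w₁) (extend w₂) y k (extend w₂ (k + 2))

/-- Messages of user one compatible with all tests of encoder two before block `b`. -/
noncomputable def guess₁ (w₂ : Fin l → Fin m₂) (y : ℕ → Fin n → 𝒴) (b : ℕ) : Fin l → Fin m₁ :=
  Classical.epsilon fun w₁ => ∀ k, k + 2 ≤ b → k < l →
    PassE₂ S 𝒯 θ c (extend w₁) (extend w₂) y k (extend w₁ (k + 2))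

/-- The decoder: messages compatible with all its tests. -/
noncomputable def guess (y : ℕ → Fin n → 𝒴) : (Fin l → Fin m₁) × (Fin l → Fin m₂) :=
  Classical.epsilon fun w => ∀ k < l,
    PassD S 𝒯 θ c (extend w.1) (extend w.2) y k (extend w.1 (k + 2)) (extend w.2 (k + 2))

/-- Encoder one. -/
noncomputable def encode₁ (w₁ : Fin l → Fin m₁) (y : ℕ → Fin n → 𝒴) (b : ℕ) (i : Fin n) : 𝒳₁ :=
  S.inp₁ ((c i).t₁ b (extend w₁ (b + 2)))
    ((c i).u b (extend w₁ b) (extend (guess₂ S 𝒯 θ c w₁ y b) b))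
    (S.replay (c i) (extend w₁) (extend (guess₂ S 𝒯 θ c w₁ y b)) (fun b => y b i) b).1

/-- Encoder two. -/
noncomputable def encode₂ (w₂ : Fin l → Fin m₂) (y : ℕ → Fin n → 𝒴) (b : ℕ) (i : Fin n) : 𝒳₂ :=
  S.inp₂ ((c i).t₂ b (extend w₂ (b + 2)))
    ((c i).u b (extend (guess₁ S 𝒯 θ c w₂ y b) b) (extend w₂ b))
    (S.replay (c i) (extend (guess₁ S 𝒯 θ c w₂ y b)) (extend w₂) (fun b => y b i) b).2

theorem guess₂_congr (w₁ : Fin l → Fin m₁) {y y' : ℕ → Fin n → 𝒴} {b : ℕ}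
    (h : ∀ b' < b, y b' = y' b') : guess₂ S 𝒯 θ c w₁ y b = guess₂ S 𝒯 θ c w₁ y' b := by
  unfold guess₂
  congr 1
  funext w₂
  exact propext (forall_congr' fun k => forall_congr' fun hk => forall_congr' fun _ =>
    passE₁_congr S 𝒯 θ c (fun _ _ => rfl) (fun j hj => h j (by omega)) _)

theorem guess₁_congr (w₂ : Fin l → Fin m₂) {y y' : ℕ → Fin n → 𝒴} {b : ℕ}
    (h : ∀ b' < b, y b' = y' b') : guess₁ S 𝒯 θ c w₂ y b = guess₁ S 𝒯 θ c w₂ y' b := by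
  unfold guess₁
  congr 1
  funext w₁
  exact propext (forall_congr' fun k => forall_congr' fun hk => forall_congr' fun _ =>
    passE₂_congr S 𝒯 θ c (fun _ _ => rfl) (fun j hj => h j (by omega)) _)

theorem guess_congr {y y' : ℕ → Fin n → 𝒴} (h : ∀ b < l + 2, y b = y' b) :
    guess S 𝒯 θ c y = guess S 𝒯 θ c y' := by
  unfold guess
  congr 1
  funext w
  exact propext (forall_congr' fun k => forall_congr' fun hk =>
    passD_congr S 𝒯 θ c (fun _ _ => rfl) (fun _ _ => rfl) (fun j hj => h j (by omega)) _ _)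

theorem encode₁_causal (w₁ : Fin l → Fin m₁) : BlockCausal (encode₁ S 𝒯 θ c w₁) := by
  intro y y' b h
  funext i
  rw [encode₁, encode₁, guess₂_congr S 𝒯 θ c w₁ h,
    S.replay_congr (c i) (fun _ _ => rfl) (fun _ _ => rfl) (y := fun b => y b i)
      (y' := fun b => y' b i) fun j hj => by rw [h j hj]]

theorem encode₂_causal (w₂ : Fin l → Fin m₂) : BlockCausal (encode₂ S 𝒯 θ c w₂) := by
  intro y y' b h
  funext i
  rw [encode₂, encode₂, guess₁_congr S 𝒯 θ c w₂ h,
    S.replay_congr (c i) (fun _ _ => rfl) (fun _ _ => rfl) (y := fun b => y b i)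
      (y' := fun b => y' b i) fun j hj => by rw [h j hj]]

/-- All tests identify the messages correctly. -/
structure Identifies (w₁ : Fin l → Fin m₁) (w₂ : Fin l → Fin m₂) (y : ℕ → Fin n → 𝒴) : Prop where
  e₁ : ∀ k < l, ∀ j,
    PassE₁ S 𝒯 θ c (extend w₁) (extend w₂) y k j ↔ j = extend w₂ (k + 2)
  e₂ : ∀ k < l, ∀ j,
    PassE₂ S 𝒯 θ c (extend w₁) (extend w₂) y k j ↔ j = extend w₁ (k + 2)
  d : ∀ k < l, ∀ j₁ j₂, PassD S 𝒯 θ c (extend w₁) (extend w₂) y k j₁ j₂ ↔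
    j₁ = extend w₁ (k + 2) ∧ j₂ = extend w₂ (k + 2)

variable {S 𝒯 θ c} {w₁ : Fin l → Fin m₁} {w₂ : Fin l → Fin m₂} {y : ℕ → Fin n → 𝒴}

/-- The true messages pass all tests, so the choice made by `guess₂` passes them too. Along
agreement so far, its next test coincides with the true one, which accepts only the true message. -/
theorem Identifies.guess₂_eq (h : Identifies S 𝒯 θ c w₁ w₂ y) {b : ℕ} :
    ∀ j ≤ b, extend (guess₂ S 𝒯 θ c w₁ y b) j = extend w₂ j := by
  have hs := Classical.epsilon_spec (p := fun w₂ => ∀ k, k + 2 ≤ b → k < l →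
    PassE₁ S 𝒯 θ c (extend w₁) (extend w₂) y k (extend w₂ (k + 2)))
    ⟨w₂, fun k _ hk => (h.e₁ k hk _).2 rfl⟩
  refine extend_congr fun k hk hkl hag => ?_
  exact (h.e₁ k hkl _).1 ((passE₁_congr S 𝒯 θ c hag (fun _ _ => rfl) _).1 (hs k hk hkl))

theorem Identifies.guess₁_eq (h : Identifies S 𝒯 θ c w₁ w₂ y) {b : ℕ} :
    ∀ j ≤ b, extend (guess₁ S 𝒯 θ c w₂ y b) j = extend w₁ j := by
  have hs := Classical.epsilon_spec (p := fun w₁ => ∀ k, k + 2 ≤ b → k < l →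
    PassE₂ S 𝒯 θ c (extend w₁) (extend w₂) y k (extend w₁ (k + 2)))
    ⟨w₁, fun k _ hk => (h.e₂ k hk _).2 rfl⟩
  refine extend_congr fun k hk hkl hag => ?_
  exact (h.e₂ k hkl _).1 ((passE₂_congr S 𝒯 θ c hag (fun _ _ => rfl) _).1 (hs k hk hkl))

theorem Identifies.guess_eq (h : Identifies S 𝒯 θ c w₁ w₂ y) : guess S 𝒯 θ c y = (w₁, w₂) := by
  have hs := Classical.epsilon_spec (p := fun w : (Fin l → Fin m₁) × (Fin l → Fin m₂) => ∀ k < l,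
    PassD S 𝒯 θ c (extend w.1) (extend w.2) y k (extend w.1 (k + 2)) (extend w.2 (k + 2)))
    ⟨(w₁, w₂), fun k hk => (h.d k hk _ _).2 ⟨rfl, rfl⟩⟩
  change ∀ k < l, PassD S 𝒯 θ c (extend (guess S 𝒯 θ c y).1) (extend (guess S 𝒯 θ c y).2) y k
    (extend (guess S 𝒯 θ c y).1 (k + 2)) (extend (guess S 𝒯 θ c y).2 (k + 2)) at hs
  have key : ∀ b ≤ l + 1, extend (guess S 𝒯 θ c y).1 b = extend w₁ b ∧
      extend (guess S 𝒯 θ c y).2 b = extend w₂ b := by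
    intro b
    induction b using Nat.strong_induction_on with
    | _ b ih =>
      intro hb
      by_cases hb2 : 2 ≤ b
      · obtain ⟨k, rfl⟩ := Nat.exists_eq_add_of_le' hb2
        have hkl : k < l := by omega
        exact (h.d k hkl _ _).1 ((passD_congr S 𝒯 θ c
          (fun j hj => (ih j (by omega) (by omega)).1) (fun j hj => (ih j (by omega) (by omega)).2)
          (fun _ _ => rfl) _ _).1 (hs k hkl))
      · constructor <;> simp [extend, hb2]
  exact Prod.ext (extend_injective fun j hj => (key j hj).1)
    (extend_injective fun j hj => (key j hj).2)

/-- When all tests identify the messages along the genie-aided outputs, these are the outputs of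
the code, and the decoder is right. -/
theorem exists_output_of_identifies {ζ : Fin n → ℕ → Z}
    (h : Identifies S 𝒯 θ c w₁ w₂ fun b i => S.genie (c i) (extend w₁) (extend w₂) (ζ i) b) :
    ∃ y : ℕ → Fin n → 𝒴,
      (∀ b i, y b i = S.chan (ζ i b) (encode₁ S 𝒯 θ c w₁ y b i) (encode₂ S 𝒯 θ c w₂ y b i)) ∧
      guess S 𝒯 θ c y = (w₁, w₂) := by
  refine ⟨_, fun b i => ?_, h.guess_eq⟩
  -- The guesses are known to be right only up to index `b`, which is all that the inputs of block
  -- `b` depend on.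
  have h2 := h.guess₂_eq (b := b)
  have h1 := h.guess₁_eq (b := b)
  rw [encode₁, encode₂, h2 b le_rfl, h1 b le_rfl,
    S.replay_fst_congr (c i) (fun _ _ => rfl) h2 (fun _ _ => rfl),
    S.replay_snd_congr (c i) h1 (fun _ _ => rfl) (fun _ _ => rfl), S.replay_genie]
  rfl

end Scheme

/-! ### Windows of three consecutive blocks -/

section Windows

variable {𝒰 𝒜 ℬ 𝒳₁ 𝒳₂ 𝒴 T₁ T₂ Z : Type*} (S : Strategies 𝒰 𝒜 ℬ 𝒳₁ 𝒳₂ 𝒴 T₁ T₂ Z) {l m₁ m₂ : ℕ}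

theorem ofNat_eq_iff {b k : ℕ} (hb : b < l + 2) (hk : k < l + 2) :
    Fin.ofNat (l + 2) b = Fin.ofNat (l + 2) k ↔ b = k := by
  rw [Fin.ext_iff]
  simp only [Fin.ofNat]
  rw [Nat.mod_eq_of_lt hb, Nat.mod_eq_of_lt hk]

theorem ofNat_val (b : Fin (l + 2)) : Fin.ofNat (l + 2) b = b := by
  ext; simp only [Fin.ofNat]; exact Nat.mod_eq_of_lt b.isLt

theorem update_ofNat_of_ne {α : Type*} (σ : Fin (l + 2) → α) (a : α) {b k : ℕ} (hb : b < l + 2)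
    (hk : k < l + 2) (h : b ≠ k) :
    Function.update σ (Fin.ofNat _ k) a (Fin.ofNat _ b) = σ (Fin.ofNat _ b) :=
  Function.update_of_ne (fun h' => h ((ofNat_eq_iff hb hk).1 h')) _ _

theorem orbit_update (d : 𝒜 × ℬ) (σ : Fin (l + 2) → Seed 𝒰 T₁ T₂ Z) (a : Seed 𝒰 T₁ T₂ Z)
    {k j : ℕ} (hkj : k ≤ j) (hj : j < l + 2) :
    S.orbit d (fun b => Function.update σ (Fin.ofNat _ j) a (Fin.ofNat _ b)) k =
      S.orbit d (fun b => σ (Fin.ofNat _ b)) k :=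
  S.orbit_congr d k fun _ hb =>
    update_ofNat_of_ne σ a (hb.trans (hkj.trans_lt hj)) hj (hb.trans_le hkj).ne

/-- The private letters and the seeds of three consecutive blocks. -/
def Strategies.window (c : CodeLetter 𝒰 𝒜 ℬ T₁ T₂ l m₁ m₂) (μ₁ : ℕ → Fin m₁) (μ₂ : ℕ → Fin m₂)
    (ζ : ℕ → Z) (k : ℕ) : (𝒜 × ℬ) × Seed 𝒰 T₁ T₂ Z × Seed 𝒰 T₁ T₂ Z × Seed 𝒰 T₁ T₂ Z :=
  (S.orbit c.1 (seeds c μ₁ μ₂ ζ) k, seeds c μ₁ μ₂ ζ k, seeds c μ₁ μ₂ ζ (k + 1),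
    seeds c μ₁ μ₂ ζ (k + 2))

namespace CodeLetter

/-- Replace one common letter. -/
def setU (c : CodeLetter 𝒰 𝒜 ℬ T₁ T₂ l m₁ m₂) (b : ℕ) (i : Fin m₁) (j : Fin m₂) (u : 𝒰) :
    CodeLetter 𝒰 𝒜 ℬ T₁ T₂ l m₁ m₂ :=
  (c.1, Function.update c.2.1 (Fin.ofNat _ b, i, j) u, c.2.2)

/-- Replace one strategy of user one. -/
def set₁ (c : CodeLetter 𝒰 𝒜 ℬ T₁ T₂ l m₁ m₂) (b : ℕ) (i : Fin m₁) (t : T₁) :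
    CodeLetter 𝒰 𝒜 ℬ T₁ T₂ l m₁ m₂ :=
  (c.1, c.2.1, Function.update c.2.2.1 (Fin.ofNat _ b, i) t, c.2.2.2)

/-- Replace one strategy of user two. -/
def set₂ (c : CodeLetter 𝒰 𝒜 ℬ T₁ T₂ l m₁ m₂) (b : ℕ) (j : Fin m₂) (t : T₂) :
    CodeLetter 𝒰 𝒜 ℬ T₁ T₂ l m₁ m₂ :=
  (c.1, c.2.1, c.2.2.1, Function.update c.2.2.2 (Fin.ofNat _ b, j) t)

end CodeLetter

variable (c : CodeLetter 𝒰 𝒜 ℬ T₁ T₂ l m₁ m₂) {μ₁ : ℕ → Fin m₁} {μ₂ : ℕ → Fin m₂} (ζ : ℕ → Z)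
  {k : ℕ}

theorem window_congr {c c' : CodeLetter 𝒰 𝒜 ℬ T₁ T₂ l m₁ m₂} (hd : c.1 = c'.1)
    (h : ∀ b ≤ k + 2, Strategies.seeds c μ₁ μ₂ ζ b = Strategies.seeds c' μ₁ μ₂ ζ b) :
    S.window c μ₁ μ₂ ζ k = S.window c' μ₁ μ₂ ζ k := by
  simp only [Strategies.window, hd, h k (by omega), h (k + 1) (by omega), h (k + 2) le_rfl,
    S.orbit_congr c'.1 k fun b hb => h b (by omega)]

/-- Only codewords of the true messages generate a window, so entries belonging to wrong candidates
are independent of it. Since `k < l`, the indices involved stay below `l + 2`, where `Fin.ofNat`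
does not wrap. -/
theorem window_setU (hk : k < l) {i : Fin m₁} {j : Fin m₂} (h : i ≠ μ₁ (k + 2) ∨ j ≠ μ₂ (k + 2))
    (u : 𝒰) : S.window (c.setU (k + 2) i j u) μ₁ μ₂ ζ k = S.window c μ₁ μ₂ ζ k := by
  refine window_congr S ζ rfl fun b hb => ?_
  simp only [Strategies.seeds, CodeLetter.setU, CodeLetter.u, CodeLetter.t₁, CodeLetter.t₂]
  rw [Function.update_of_ne]
  intro he
  simp only [Prod.mk.injEq, ofNat_eq_iff (show b < l + 2 by omega) (show k + 2 < l + 2 by omega)]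
    at he
  obtain ⟨rfl, h1, h2⟩ := he
  rcases h with h | h
  exacts [h h1.symm, h h2.symm]

theorem window_set₁ (hk : k < l) {i : Fin m₁} (h : i ≠ μ₁ (k + 2)) (t : T₁) :
    S.window (c.set₁ k i t) μ₁ μ₂ ζ k = S.window c μ₁ μ₂ ζ k := by
  refine window_congr S ζ rfl fun b hb => ?_
  simp only [Strategies.seeds, CodeLetter.set₁, CodeLetter.u, CodeLetter.t₁, CodeLetter.t₂]
  rw [Function.update_of_ne]
  intro he
  simp only [Prod.mk.injEq, ofNat_eq_iff (show b < l + 2 by omega) (show k < l + 2 by omega)] at he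
  obtain ⟨rfl, h1⟩ := he
  exact h h1.symm

theorem window_set₂ (hk : k < l) {i : Fin m₂} (h : i ≠ μ₂ (k + 2)) (t : T₂) :
    S.window (c.set₂ k i t) μ₁ μ₂ ζ k = S.window c μ₁ μ₂ ζ k := by
  refine window_congr S ζ rfl fun b hb => ?_
  simp only [Strategies.seeds, CodeLetter.set₂, CodeLetter.u, CodeLetter.t₁, CodeLetter.t₂]
  rw [Function.update_of_ne]
  intro he
  simp only [Prod.mk.injEq, ofNat_eq_iff (show b < l + 2 by omega) (show k < l + 2 by omega)] at he
  obtain ⟨rfl, h1⟩ := he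
  exact h h1.symm

end Windows

/-! ### Random codebooks -/

section RandomCoding

/-- The letterwise laws for random coding. -/
structure Laws (𝒰 𝒜 ℬ T₁ T₂ Z : Type*) [Fintype 𝒰] [Fintype 𝒜] [Fintype ℬ] [Fintype T₁]
    [Fintype T₂] [Fintype Z] where
  d : stdSimplex ℝ (𝒜 × ℬ)
  u : stdSimplex ℝ 𝒰
  t₁ : stdSimplex ℝ T₁
  t₂ : stdSimplex ℝ T₂
  z : stdSimplex ℝ Z

variable {𝒰 𝒜 ℬ 𝒳₁ 𝒳₂ 𝒴 T₁ T₂ Z : Type*} [Fintype 𝒰] [Fintype 𝒜] [Fintype ℬ] [Fintype T₁]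
    [Fintype T₂] [Fintype Z]

namespace Laws

variable (Λ : Laws 𝒰 𝒜 ℬ T₁ T₂ Z)

/-- The law of a seed. -/
noncomputable def seed : Seed 𝒰 T₁ T₂ Z → ℝ :=
  prodLaw Λ.u.1 (prodLaw Λ.t₁.1 (prodLaw Λ.t₂.1 Λ.z.1))

/-- The law of a codebook letter. -/
noncomputable def code (l m₁ m₂ : ℕ) : CodeLetter 𝒰 𝒜 ℬ T₁ T₂ l m₁ m₂ → ℝ :=
  prodLaw Λ.d.1 (prodLaw (piLaw fun _ => Λ.u.1) (prodLaw (piLaw fun _ => Λ.t₁.1)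
    (piLaw fun _ => Λ.t₂.1)))

/-- The law of the noise of one letter in all blocks. -/
noncomputable def noise (l : ℕ) : (Fin (l + 2) → Z) → ℝ := piLaw fun _ => Λ.z.1

theorem seed_mem : Λ.seed ∈ stdSimplex ℝ (Seed 𝒰 T₁ T₂ Z) :=
  prodLaw_mem Λ.u.2 (prodLaw_mem Λ.t₁.2 (prodLaw_mem Λ.t₂.2 Λ.z.2))

theorem code_mem (l m₁ m₂ : ℕ) :
    Λ.code l m₁ m₂ ∈ stdSimplex ℝ (CodeLetter 𝒰 𝒜 ℬ T₁ T₂ l m₁ m₂) :=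
  prodLaw_mem Λ.d.2 (prodLaw_mem (piLaw_mem fun _ => Λ.u.2) (prodLaw_mem
    (piLaw_mem fun _ => Λ.t₁.2) (piLaw_mem fun _ => Λ.t₂.2)))

theorem noise_mem (l : ℕ) : Λ.noise l ∈ stdSimplex ℝ (Fin (l + 2) → Z) :=
  piLaw_mem fun _ => Λ.z.2

/-- The private letters and the seeds of three consecutive blocks. -/
noncomputable def window :
    (𝒜 × ℬ) × Seed 𝒰 T₁ T₂ Z × Seed 𝒰 T₁ T₂ Z × Seed 𝒰 T₁ T₂ Z → ℝ :=
  prodLaw Λ.d.1 (prodLaw Λ.seed (prodLaw Λ.seed Λ.seed))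

theorem window_mem : Λ.window ∈ stdSimplex ℝ _ :=
  prodLaw_mem Λ.d.2 (prodLaw_mem Λ.seed_mem (prodLaw_mem Λ.seed_mem Λ.seed_mem))

/-- The private letters have the same law in all blocks. -/
def Stationary (S : Strategies 𝒰 𝒜 ℬ 𝒳₁ 𝒳₂ 𝒴 T₁ T₂ Z) : Prop :=
  ∀ φ : 𝒜 × ℬ → ℝ, expect Λ.d.1 (fun d => expect Λ.seed fun σ => φ (S.next d σ)) = expect Λ.d.1 φ

end Laws

variable (Λ : Laws 𝒰 𝒜 ℬ T₁ T₂ Z) (S : Strategies 𝒰 𝒜 ℬ 𝒳₁ 𝒳₂ 𝒴 T₁ T₂ Z) {l m₁ m₂ : ℕ}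

/-- The seeds in all blocks are independent. -/
theorem expect_seeds (μ₁ : ℕ → Fin m₁) (μ₂ : ℕ → Fin m₂)
    (H : 𝒜 × ℬ → (Fin (l + 2) → Seed 𝒰 T₁ T₂ Z) → ℝ) :
    expect (Λ.code l m₁ m₂) (fun c => expect (Λ.noise l) fun ζ =>
      H c.1 fun b => Strategies.seeds c μ₁ μ₂ (fun b => ζ (Fin.ofNat _ b)) b) =
    expect Λ.d.1 fun d => expect (piLaw fun _ => Λ.seed) (H d) := by
  simp only [Laws.code, Laws.noise, expect_prodLaw, Strategies.seeds, CodeLetter.u, CodeLetter.t₁,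
    CodeLetter.t₂, ofNat_val]
  congr 1; ext d
  simp only [Laws.seed]
  rw [expect_piLaw_prodLaw]
  -- Different blocks read different codebook entries, whatever the messages, so the selected
  -- entries are again independent.
  rw [expect_piLaw_comp Λ.u.2
    (e := fun b : Fin (l + 2) => (b, μ₁ (b : ℕ), μ₂ (b : ℕ))) (fun b b' h => (Prod.ext_iff.1 h).1)
    (f := fun u => expect (piLaw fun _ => Λ.t₁.1) fun t₁ => expect (piLaw fun _ => Λ.t₂.1) fun t₂ =>
      expect (piLaw fun _ => Λ.z.1) fun ζ => H d fun b =>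
        (u b, t₁ (b, μ₁ (b + 2)), t₂ (b, μ₂ (b + 2)), ζ b))]
  congr 1; ext u
  rw [expect_piLaw_prodLaw]
  rw [expect_piLaw_comp Λ.t₁.2
    (e := fun b : Fin (l + 2) => (b, μ₁ (b + 2 : ℕ))) (fun b b' h => (Prod.ext_iff.1 h).1)
    (f := fun t₁ => expect (piLaw fun _ => Λ.t₂.1) fun t₂ =>
      expect (piLaw fun _ => Λ.z.1) fun ζ => H d fun b => (u b, t₁ b, t₂ (b, μ₂ (b + 2)), ζ b))]
  congr 1; ext t₁
  rw [expect_piLaw_prodLaw]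
  rw [expect_piLaw_comp Λ.t₂.2
    (e := fun b : Fin (l + 2) => (b, μ₂ (b + 2 : ℕ))) (fun b b' h => (Prod.ext_iff.1 h).1)
    (f := fun t₂ => expect (piLaw fun _ => Λ.z.1) fun ζ => H d fun b => (u b, t₁ b, t₂ b, ζ b))]

/-- By `hG` the first argument of `G` does not involve coordinate `i`, which is therefore
independent of it. -/
theorem expect_piLaw_fresh {α ι : Type*} [Fintype α] [Fintype ι] [DecidableEq ι] {p : α → ℝ}
    (hp : p ∈ stdSimplex ℝ α) (i : ι) (G : (ι → α) → α → ℝ)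
    (hG : ∀ x a a', G (Function.update x i a) a' = G x a') :
    expect (piLaw fun _ => p) (fun x => G x (x i)) =
      expect (piLaw fun _ => p) fun x => expect p (G x) := by
  rw [expect_piLaw_update (fun _ => hp) i]
  simp only [Function.update_self, hG]

-- The seed of block `k` is independent of the private letters of that block, so `Stationary` can be
-- applied once per block.
variable {Λ S} in
theorem Laws.Stationary.expect_orbit (hS : Λ.Stationary S) {k : ℕ} (hk : k ≤ l + 2)
    (φ : 𝒜 × ℬ → ℝ) :
    expect Λ.d.1 (fun d => expect (piLaw fun _ : Fin (l + 2) => Λ.seed) fun σ =>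
      φ (S.orbit d (fun b => σ (Fin.ofNat _ b)) k)) = expect Λ.d.1 φ := by
  induction k generalizing φ with
  | zero => simp only [Strategies.orbit, expect_const (piLaw_mem fun _ => Λ.seed_mem)]
  | succ k ih =>
    rw [← hS φ, ← ih (by omega) fun d => expect Λ.seed fun σ => φ (S.next d σ)]
    congr 1; ext d
    exact expect_piLaw_fresh Λ.seed_mem (Fin.ofNat (l + 2) k)
      (fun σ a => φ (S.next (S.orbit d (fun b => σ (Fin.ofNat _ b)) k) a))
      fun σ a a' => by simp only [orbit_update S d σ a le_rfl (by omega : k < l + 2)]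

-- The law of a window depends neither on its position nor on the messages: the three seeds are
-- fresh given the private letters at its start, which have the stationary law. The seeds are
-- integrated out from the last block backwards.
variable {Λ S} in
theorem Laws.Stationary.expect_window (hS : Λ.Stationary S) (μ₁ : ℕ → Fin m₁) (μ₂ : ℕ → Fin m₂)
    {k : ℕ} (hk : k < l)
    (R : (𝒜 × ℬ) × Seed 𝒰 T₁ T₂ Z × Seed 𝒰 T₁ T₂ Z × Seed 𝒰 T₁ T₂ Z → ℝ) :
    expect (Λ.code l m₁ m₂) (fun c => expect (Λ.noise l) fun ζ =>
      R (S.window c μ₁ μ₂ (fun b => ζ (Fin.ofNat _ b)) k)) = expect Λ.window R := by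
  have h1 := expect_seeds Λ (l := l) μ₁ μ₂ fun d σ =>
    R (S.orbit d (fun b => σ (Fin.ofNat _ b)) k, σ (Fin.ofNat _ k), σ (Fin.ofNat _ (k + 1)),
      σ (Fin.ofNat _ (k + 2)))
  have h2 : ∀ b, b < l + 2 → ((Fin.ofNat (l + 2) b : Fin (l + 2)) : ℕ) = b := fun b hb => by
    simp only [Fin.ofNat]; exact Nat.mod_eq_of_lt hb
  have h3 : ∀ (c : CodeLetter 𝒰 𝒜 ℬ T₁ T₂ l m₁ m₂) (ζ : ℕ → Z),
      S.orbit c.1 (fun b => Strategies.seeds c μ₁ μ₂ ζ (Fin.ofNat (l + 2) b : Fin (l + 2))) k =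
        S.orbit c.1 (Strategies.seeds c μ₁ μ₂ ζ) k := fun c ζ =>
    S.orbit_congr _ k fun b hb => by rw [h2 b (by omega)]
  simp only [h3, h2 k (by omega), h2 (k + 1) (by omega), h2 (k + 2) (by omega)] at h1
  simp only [Strategies.window]
  rw [h1, Laws.window, expect_prodLaw]
  refine Eq.trans ?_ (hS.expect_orbit (l := l) (k := k) (by omega) _)
  refine expect_congr fun d => ?_
  simp only [expect_prodLaw]
  rw [expect_piLaw_fresh Λ.seed_mem (Fin.ofNat (l + 2) (k + 2))
    (fun σ a => R (S.orbit d (fun b => σ (Fin.ofNat _ b)) k, σ (Fin.ofNat _ k),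
      σ (Fin.ofNat _ (k + 1)), a)),
    expect_piLaw_fresh Λ.seed_mem (Fin.ofNat (l + 2) (k + 1))
    (fun σ a => expect Λ.seed fun a' => R (S.orbit d (fun b => σ (Fin.ofNat _ b)) k,
      σ (Fin.ofNat _ k), a, a')),
    expect_piLaw_fresh Λ.seed_mem (Fin.ofNat (l + 2) k)
    (fun σ a => expect Λ.seed fun a' => expect Λ.seed fun a'' =>
      R (S.orbit d (fun b => σ (Fin.ofNat _ b)) k, a, a', a''))]
  · intro σ a a'
    simp only [orbit_update S d σ a le_rfl (by omega : k < l + 2)]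
  · intro σ a a'
    simp only [orbit_update S d σ a (by omega : k ≤ k + 1) (by omega : k + 1 < l + 2),
      update_ofNat_of_ne σ a (by omega : k < l + 2) (by omega : k + 1 < l + 2) (by omega)]
  · intro σ a a'
    simp only [orbit_update S d σ a (by omega : k ≤ k + 2) (by omega : k + 2 < l + 2),
      update_ofNat_of_ne σ a (by omega : k < l + 2) (by omega : k + 2 < l + 2) (by omega),
      update_ofNat_of_ne σ a (by omega : k + 1 < l + 2) (by omega : k + 2 < l + 2) (by omega)]

/-! #### Wrong candidates -/

theorem expect_code_setU (b : ℕ) (i : Fin m₁) (j : Fin m₂)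
    (f : CodeLetter 𝒰 𝒜 ℬ T₁ T₂ l m₁ m₂ → ℝ) :
    expect (Λ.code l m₁ m₂) f =
      expect (Λ.code l m₁ m₂) fun c => expect Λ.u.1 fun u => f (c.setU b i j u) := by
  simp only [Laws.code, expect_prodLaw, CodeLetter.setU]
  refine expect_congr fun d => ?_
  rw [expect_piLaw_update (fun _ => Λ.u.2) (Fin.ofNat (l + 2) b, i, j)]
  refine expect_congr fun u => ?_
  rw [expect_comm]
  refine expect_congr fun t => ?_
  rw [expect_comm]

theorem expect_code_set₁ (b : ℕ) (i : Fin m₁) (f : CodeLetter 𝒰 𝒜 ℬ T₁ T₂ l m₁ m₂ → ℝ) :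
    expect (Λ.code l m₁ m₂) f =
      expect (Λ.code l m₁ m₂) fun c => expect Λ.t₁.1 fun t => f (c.set₁ b i t) := by
  simp only [Laws.code, expect_prodLaw, CodeLetter.set₁]
  refine expect_congr fun d => ?_
  refine expect_congr fun u => ?_
  rw [expect_piLaw_update (fun _ => Λ.t₁.2) (Fin.ofNat (l + 2) b, i)]
  refine expect_congr fun t => ?_
  rw [expect_comm]

theorem expect_code_set₂ (b : ℕ) (i : Fin m₂) (f : CodeLetter 𝒰 𝒜 ℬ T₁ T₂ l m₁ m₂ → ℝ) :
    expect (Λ.code l m₁ m₂) f =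
      expect (Λ.code l m₁ m₂) fun c => expect Λ.t₂.1 fun t => f (c.set₂ b i t) := by
  simp only [Laws.code, expect_prodLaw, CodeLetter.set₂]
  refine expect_congr fun d => ?_
  refine expect_congr fun u => ?_
  refine expect_congr fun t => ?_
  rw [expect_piLaw_update (fun _ => Λ.t₂.2) (Fin.ofNat (l + 2) b, i)]

end RandomCoding

/-! ### The error probability of a random code -/

section ErrorBound

variable {𝒰 𝒜 ℬ 𝒳₁ 𝒳₂ 𝒴 T₁ T₂ Z : Type*}

/-- The private letters and the seeds of three consecutive blocks. -/
abbrev Window (𝒰 𝒜 ℬ T₁ T₂ Z : Type*) :=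
  (𝒜 × ℬ) × Seed 𝒰 T₁ T₂ Z × Seed 𝒰 T₁ T₂ Z × Seed 𝒰 T₁ T₂ Z

namespace Strategies

variable (S : Strategies 𝒰 𝒜 ℬ 𝒳₁ 𝒳₂ 𝒴 T₁ T₂ Z) (𝒯 : Tests 𝒰 𝒜 ℬ 𝒴 T₁ T₂)

/-- The channel output in the second block of a window. -/
def out₁ (w : Window 𝒰 𝒜 ℬ T₁ T₂ Z) : 𝒴 := S.out (S.next w.1 w.2.1) w.2.2.1

/-- The channel output in the third block of a window. -/
def out₂ (w : Window 𝒰 𝒜 ℬ T₁ T₂ Z) : 𝒴 := S.out (S.next (S.next w.1 w.2.1) w.2.2.1) w.2.2.2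

/-- The test of encoder one, for the candidate `t`. -/
def valE₁ (t : T₂) (w : Window 𝒰 𝒜 ℬ T₁ T₂ Z) : ℝ :=
  𝒯.e₁ t (S.state w.1 w.2.1) w.2.1.2.1 w.2.2.1.2.1 w.2.2.1.1 (S.out₁ w)

/-- The test of encoder two, for the candidate `t`. -/
def valE₂ (t : T₁) (w : Window 𝒰 𝒜 ℬ T₁ T₂ Z) : ℝ :=
  𝒯.e₂ t (S.state w.1 w.2.1) w.2.1.2.2.1 w.2.2.1.2.2.1 w.2.2.1.1 (S.out₁ w)

/-- The test for the common letter, for the candidate `u`. -/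
def valU (u : 𝒰) (w : Window 𝒰 𝒜 ℬ T₁ T₂ Z) : ℝ := 𝒯.h u w.2.2.1.1 (S.out₁ w) (S.out₂ w)

/-- The test of the decoder for user one, for the candidate `t`. -/
def valD₁ (t : T₁) (w : Window 𝒰 𝒜 ℬ T₁ T₂ Z) : ℝ :=
  𝒯.d₁ t (S.state w.1 w.2.1) w.2.1.2.2.1 w.2.2.1.1 (S.out₁ w)

/-- The test of the decoder for user two, for the candidate `t`. -/
def valD₂ (t : T₂) (w : Window 𝒰 𝒜 ℬ T₁ T₂ Z) : ℝ :=
  𝒯.d₂ t (S.state w.1 w.2.1) w.2.1.2.1 w.2.2.1.1 (S.out₁ w)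

/-- The test of the decoder for both users, for the candidates `t`, `t'`. -/
def valD₀ (t : T₁) (t' : T₂) (w : Window 𝒰 𝒜 ℬ T₁ T₂ Z) : ℝ :=
  𝒯.d₀ t t' (S.state w.1 w.2.1) w.2.2.1.1 (S.out₁ w)

variable {l m₁ m₂ : ℕ} (c : CodeLetter 𝒰 𝒜 ℬ T₁ T₂ l m₁ m₂) (μ₁ : ℕ → Fin m₁) (μ₂ : ℕ → Fin m₂)
  (ζ : ℕ → Z) (k : ℕ)

theorem statE₁_genie (j : Fin m₂) : S.statE₁ c μ₁ μ₂ (S.genie c μ₁ μ₂ ζ) 𝒯 k j =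
    S.valE₁ 𝒯 (c.t₂ k j) (S.window c μ₁ μ₂ ζ k) := by
  simp only [statE₁, replayState_genie]; rfl

theorem statE₂_genie (i : Fin m₁) : S.statE₂ c μ₁ μ₂ (S.genie c μ₁ μ₂ ζ) 𝒯 k i =
    S.valE₂ 𝒯 (c.t₁ k i) (S.window c μ₁ μ₂ ζ k) := by
  simp only [statE₂, replayState_genie]; rfl

theorem statD₁_genie (i : Fin m₁) :
    S.statD₁ c μ₁ μ₂ (S.genie c μ₁ μ₂ ζ) 𝒯 k i (μ₂ (k + 2)) =
      S.valD₁ 𝒯 (c.t₁ k i) (S.window c μ₁ μ₂ ζ k) *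
        S.valU 𝒯 (c.u (k + 2) i (μ₂ (k + 2))) (S.window c μ₁ μ₂ ζ k) := by
  simp only [statD₁, replayState_genie]; rfl

theorem statD₂_genie (j : Fin m₂) :
    S.statD₂ c μ₁ μ₂ (S.genie c μ₁ μ₂ ζ) 𝒯 k (μ₁ (k + 2)) j =
      S.valD₂ 𝒯 (c.t₂ k j) (S.window c μ₁ μ₂ ζ k) *
        S.valU 𝒯 (c.u (k + 2) (μ₁ (k + 2)) j) (S.window c μ₁ μ₂ ζ k) := by
  simp only [statD₂, replayState_genie]; rfl

theorem statD₀_genie (i : Fin m₁) (j : Fin m₂) :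
    S.statD₀ c μ₁ μ₂ (S.genie c μ₁ μ₂ ζ) 𝒯 k i j =
      S.valD₀ 𝒯 (c.t₁ k i) (c.t₂ k j) (S.window c μ₁ μ₂ ζ k) *
        S.valU 𝒯 (c.u (k + 2) i j) (S.window c μ₁ μ₂ ζ k) := by
  simp only [statD₀, replayState_genie]; rfl

end Strategies

variable [Fintype 𝒰] [Fintype 𝒜] [Fintype ℬ] [Fintype T₁] [Fintype T₂] [Fintype Z]

/-- The test functions are positive, and independent candidates have mean value at most one. -/
structure Tests.Valid (𝒯 : Tests 𝒰 𝒜 ℬ 𝒴 T₁ T₂) (Λ : Laws 𝒰 𝒜 ℬ T₁ T₂ Z) : Prop where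
  e₁_pos : ∀ t s t₁ t₁' u y, 0 < 𝒯.e₁ t s t₁ t₁' u y
  e₂_pos : ∀ t s t₁ t₁' u y, 0 < 𝒯.e₂ t s t₁ t₁' u y
  d₁_pos : ∀ t s t' u y, 0 < 𝒯.d₁ t s t' u y
  d₂_pos : ∀ t s t' u y, 0 < 𝒯.d₂ t s t' u y
  d₀_pos : ∀ t t' s u y, 0 < 𝒯.d₀ t t' s u y
  h_pos : ∀ u u' y y', 0 < 𝒯.h u u' y y'
  e₁_le : ∀ s t₁ t₁' u y, expect Λ.t₂.1 (fun t => 𝒯.e₁ t s t₁ t₁' u y) ≤ 1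
  e₂_le : ∀ s t₁ t₁' u y, expect Λ.t₁.1 (fun t => 𝒯.e₂ t s t₁ t₁' u y) ≤ 1
  d₁_le : ∀ s t' u y, expect Λ.t₁.1 (fun t => 𝒯.d₁ t s t' u y) ≤ 1
  d₂_le : ∀ s t' u y, expect Λ.t₂.1 (fun t => 𝒯.d₂ t s t' u y) ≤ 1
  d₀_le : ∀ s u y, expect Λ.t₁.1 (fun t => expect Λ.t₂.1 fun t' => 𝒯.d₀ t t' s u y) ≤ 1
  h_le : ∀ u' y y', expect Λ.u.1 (fun u => 𝒯.h u u' y y') ≤ 1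

variable {Λ : Laws 𝒰 𝒜 ℬ T₁ T₂ Z} {𝒯 : Tests 𝒰 𝒜 ℬ 𝒴 T₁ T₂}
  (S : Strategies 𝒰 𝒜 ℬ 𝒳₁ 𝒳₂ 𝒴 T₁ T₂ Z)

/-! ### Mean values of the tests for wrong candidates -/

section Wrong

variable {l m₁ m₂ : ℕ} {μ₁ : ℕ → Fin m₁} {μ₂ : ℕ → Fin m₂} {k : ℕ}

/-- The candidate's strategy can be redrawn without changing the window; for each fixed window the
mean over the redrawn strategy is at most one by validity. -/
theorem Tests.Valid.expect_statE₁_le (h𝒯 : 𝒯.Valid Λ) (hk : k < l) {j : Fin m₂}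
    (hj : j ≠ μ₂ (k + 2)) :
    expect (Λ.code l m₁ m₂) (fun c => expect (Λ.noise l) fun ζ =>
      S.statE₁ c μ₁ μ₂ (S.genie c μ₁ μ₂ fun b => ζ (Fin.ofNat _ b)) 𝒯 k j) ≤ 1 := by
  rw [expect_code_set₂ Λ k j]
  refine expect_le (Λ.code_mem _ _ _) fun c => ?_
  rw [expect_comm]
  refine expect_le (Λ.noise_mem _) fun ζ => ?_
  simp only [Strategies.statE₁_genie, window_set₂ S c _ hk hj]
  simp only [CodeLetter.set₂, CodeLetter.t₂, Function.update_self]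
  exact h𝒯.e₁_le _ _ _ _ _

theorem Tests.Valid.expect_statE₂_le (h𝒯 : 𝒯.Valid Λ) (hk : k < l) {i : Fin m₁}
    (hi : i ≠ μ₁ (k + 2)) :
    expect (Λ.code l m₁ m₂) (fun c => expect (Λ.noise l) fun ζ =>
      S.statE₂ c μ₁ μ₂ (S.genie c μ₁ μ₂ fun b => ζ (Fin.ofNat _ b)) 𝒯 k i) ≤ 1 := by
  rw [expect_code_set₁ Λ k i]
  refine expect_le (Λ.code_mem _ _ _) fun c => ?_
  rw [expect_comm]
  refine expect_le (Λ.noise_mem _) fun ζ => ?_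
  simp only [Strategies.statE₂_genie, window_set₁ S c _ hk hi]
  simp only [CodeLetter.set₁, CodeLetter.t₁, Function.update_self]
  exact h𝒯.e₂_le _ _ _ _ _

theorem expect_mul_le_one {α β : Type*} [Fintype α] [Fintype β] {p : α → ℝ} {q : β → ℝ}
    (hp : p ∈ stdSimplex ℝ α) {f : α → ℝ} {g : β → ℝ} (hf0 : ∀ a, 0 ≤ f a) (hf : expect p f ≤ 1)
    (hg : expect q g ≤ 1) :
    expect p (fun a => expect q fun b => g b * f a) ≤ 1 := by
  simp only [expect_mul_right]
  rw [expect_mul_left]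
  exact mul_le_one₀ hg (expect_nonneg hp hf0) hf

/-- A wrong message makes both the strategy of block `k` and the common letter of block `k + 2`
fresh. They are independent, so the mean of the product of the two tests factors. -/
theorem Tests.Valid.expect_statD₁_le (h𝒯 : 𝒯.Valid Λ) (hk : k < l) {i : Fin m₁}
    (hi : i ≠ μ₁ (k + 2)) :
    expect (Λ.code l m₁ m₂) (fun c => expect (Λ.noise l) fun ζ =>
      S.statD₁ c μ₁ μ₂ (S.genie c μ₁ μ₂ fun b => ζ (Fin.ofNat _ b)) 𝒯 k i (μ₂ (k + 2))) ≤ 1 := by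
  rw [expect_code_set₁ Λ k i, expect_code_setU Λ (k + 2) i (μ₂ (k + 2))]
  refine expect_le (Λ.code_mem _ _ _) fun c => ?_
  rw [expect_congr fun u => expect_comm _ _ _, expect_comm]
  refine expect_le (Λ.noise_mem _) fun ζ => ?_
  simp only [Strategies.statD₁_genie, window_set₁ S _ _ hk hi, window_setU S c _ hk (Or.inl hi)]
  simp only [CodeLetter.set₁, CodeLetter.setU, CodeLetter.t₁, CodeLetter.u, Function.update_self]
  exact expect_mul_le_one Λ.u.2 (fun u => (h𝒯.h_pos _ _ _ _).le) (h𝒯.h_le _ _ _)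
    (h𝒯.d₁_le _ _ _ _)

theorem Tests.Valid.expect_statD₂_le (h𝒯 : 𝒯.Valid Λ) (hk : k < l) {j : Fin m₂}
    (hj : j ≠ μ₂ (k + 2)) :
    expect (Λ.code l m₁ m₂) (fun c => expect (Λ.noise l) fun ζ =>
      S.statD₂ c μ₁ μ₂ (S.genie c μ₁ μ₂ fun b => ζ (Fin.ofNat _ b)) 𝒯 k (μ₁ (k + 2)) j) ≤ 1 := by
  rw [expect_code_set₂ Λ k j, expect_code_setU Λ (k + 2) (μ₁ (k + 2)) j]
  refine expect_le (Λ.code_mem _ _ _) fun c => ?_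
  rw [expect_congr fun u => expect_comm _ _ _, expect_comm]
  refine expect_le (Λ.noise_mem _) fun ζ => ?_
  simp only [Strategies.statD₂_genie, window_set₂ S _ _ hk hj, window_setU S c _ hk (Or.inr hj)]
  simp only [CodeLetter.set₂, CodeLetter.setU, CodeLetter.t₂, CodeLetter.u, Function.update_self]
  exact expect_mul_le_one Λ.u.2 (fun u => (h𝒯.h_pos _ _ _ _).le) (h𝒯.h_le _ _ _)
    (h𝒯.d₂_le _ _ _ _)

theorem Tests.Valid.expect_statD₀_le (h𝒯 : 𝒯.Valid Λ) (hk : k < l) {i : Fin m₁} {j : Fin m₂}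
    (hi : i ≠ μ₁ (k + 2)) (hj : j ≠ μ₂ (k + 2)) :
    expect (Λ.code l m₁ m₂) (fun c => expect (Λ.noise l) fun ζ =>
      S.statD₀ c μ₁ μ₂ (S.genie c μ₁ μ₂ fun b => ζ (Fin.ofNat _ b)) 𝒯 k i j) ≤ 1 := by
  rw [expect_code_set₂ Λ k j, expect_code_set₁ Λ k i, expect_code_setU Λ (k + 2) i j]
  refine expect_le (Λ.code_mem _ _ _) fun c => ?_
  rw [expect_congr fun u => expect_congr fun t => expect_comm _ _ _,
    expect_congr fun u => expect_comm _ _ _, expect_comm]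
  refine expect_le (Λ.noise_mem _) fun ζ => ?_
  simp only [Strategies.statD₀_genie, window_set₂ S _ _ hk hj, window_set₁ S _ _ hk hi,
    window_setU S c _ hk (Or.inl hi)]
  simp only [CodeLetter.set₂, CodeLetter.set₁, CodeLetter.setU, CodeLetter.t₂, CodeLetter.t₁,
    CodeLetter.u, Function.update_self, expect_mul_right]
  rw [expect_mul_left]
  exact mul_le_one₀ (h𝒯.d₀_le _ _ _) (expect_nonneg Λ.u.2 fun u => (h𝒯.h_pos _ _ _ _).le)
    (h𝒯.h_le _ _ _)

end Wrong

/-! #### Products over the letters -/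

section Letters

variable {α β : Type*} [Fintype α] [Fintype β] {p : α → ℝ} {q : β → ℝ} {n : ℕ}

theorem expect_letters (p : α → ℝ) (q : β → ℝ) (g : α → β → ℝ) :
    expect (piLaw fun _ : Fin n => p) (fun c => expect (piLaw fun _ : Fin n => q) fun ζ =>
      ∏ i, g (c i) (ζ i)) = (expect p fun a => expect q (g a)) ^ n := by
  simp only [fun c : Fin n → α => expect_piLaw_prod (fun _ => q) fun i => g (c i)]
  rw [expect_piLaw_prod (fun _ => p) fun _ a => expect q (g a)]
  simp

/-- Markov's inequality for a product of independent letterwise factors, each of mean at most one.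
-/
theorem expect_pass_le (hp : p ∈ stdSimplex ℝ α) (hq : q ∈ stdSimplex ℝ β) {g : α → β → ℝ}
    (hg : ∀ a b, 0 < g a b) (h : expect p (fun a => expect q (g a)) ≤ 1) {θ : ℝ} (hθ : 0 < θ) :
    expect (piLaw fun _ : Fin n => p) (fun c => expect (piLaw fun _ : Fin n => q) fun ζ =>
      ind (θ < ∏ i, g (c i) (ζ i))) ≤ θ⁻¹ := by
  have h1 : ∀ (c : Fin n → α) (ζ : Fin n → β), ind (θ < ∏ i, g (c i) (ζ i)) ≤
      θ⁻¹ * ∏ i, g (c i) (ζ i) := fun c ζ => by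
    by_cases hlt : θ < ∏ i, g (c i) (ζ i)
    · rw [ind_of hlt, ← div_eq_inv_mul, one_le_div hθ]; exact hlt.le
    · rw [ind_of_not hlt]
      exact mul_nonneg (inv_nonneg.2 hθ.le) (Finset.prod_nonneg fun i _ => (hg _ _).le)
  refine (expect_mono (piLaw_mem fun _ => hp) fun c =>
    expect_mono (piLaw_mem fun _ => hq) (h1 c)).trans ?_
  simp only [expect_mul_left]
  rw [expect_letters]
  exact mul_le_of_le_one_right (inv_nonneg.2 hθ.le)
    (pow_le_one₀ (expect_nonneg hp fun a => expect_nonneg hq fun b => (hg a b).le) h)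

/-- Chernoff's bound: failure means that the normalized product is at most one, so its power `-s` is
at least one, and the mean of that power factors over the letters. -/
theorem expect_fail_le (hp : p ∈ stdSimplex ℝ α) (hq : q ∈ stdSimplex ℝ β) {g : α → β → ℝ}
    (hg : ∀ a b, 0 < g a b) {γ s ρ : ℝ} (hs : 0 < s)
    (h : expect p (fun a => expect q fun b => (g a b / 2 ^ γ) ^ (-s)) ≤ ρ) :
    expect (piLaw fun _ : Fin n => p) (fun c => expect (piLaw fun _ : Fin n => q) fun ζ =>
      ind ¬((2 : ℝ) ^ γ) ^ n < ∏ i, g (c i) (ζ i)) ≤ ρ ^ n := by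
  have h2 : (0 : ℝ) < 2 ^ γ := Real.rpow_pos_of_pos two_pos _
  have h1 : ∀ (c : Fin n → α) (ζ : Fin n → β), ind (¬((2 : ℝ) ^ γ) ^ n < ∏ i, g (c i) (ζ i)) ≤
      ∏ i, (g (c i) (ζ i) / 2 ^ γ) ^ (-s) := fun c ζ => by
    by_cases hlt : ((2 : ℝ) ^ γ) ^ n < ∏ i, g (c i) (ζ i)
    · rw [ind_of_not (not_not_intro hlt)]
      exact Finset.prod_nonneg fun i _ => (Real.rpow_pos_of_pos (div_pos (hg _ _) h2) _).le
    · rw [ind_of hlt, Real.finsetProd_rpow _ _ fun i _ => (div_pos (hg _ _) h2).le,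
        Finset.prod_div_distrib, Finset.prod_const, Finset.card_univ, Fintype.card_fin]
      refine Real.one_le_rpow_of_pos_of_le_one_of_nonpos
        (div_pos (Finset.prod_pos fun i _ => hg _ _) (pow_pos h2 n)) ?_ (by linarith)
      rw [div_le_one (pow_pos h2 n)]
      exact not_lt.1 hlt
  refine (expect_mono (piLaw_mem fun _ => hp) fun c =>
    expect_mono (piLaw_mem fun _ => hq) (h1 c)).trans ?_
  rw [expect_letters p q fun a b => (g a b / 2 ^ γ) ^ (-s)]
  exact pow_le_pow_left₀ (expect_nonneg hp fun a => expect_nonneg hq fun b =>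
    (Real.rpow_pos_of_pos (div_pos (hg _ _) h2) _).le) h n

end Letters

end ErrorBound

/-! ### The coding theorem for strategies with good tests -/

section CodingTheorem

variable {𝒰 𝒜 ℬ 𝒳₁ 𝒳₂ 𝒴 T₁ T₂ Z : Type*}

/-- The thresholds for codes of length `n`, with exponents `γ`. -/
noncomputable def Thresholds.pow (γ : Thresholds) (n : ℕ) : Thresholds where
  e₁ := ((2 : ℝ) ^ γ.e₁) ^ n
  e₂ := ((2 : ℝ) ^ γ.e₂) ^ n
  d₁ := ((2 : ℝ) ^ γ.d₁) ^ n
  d₂ := ((2 : ℝ) ^ γ.d₂) ^ n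
  d₀ := ((2 : ℝ) ^ γ.d₀) ^ n

/-- Union bound over the blocks: five ways to reject the truth, and five families of wrong
candidates to accept. -/
theorem ind_not_identifies_le {S : Strategies 𝒰 𝒜 ℬ 𝒳₁ 𝒳₂ 𝒴 T₁ T₂ Z} {𝒯 : Tests 𝒰 𝒜 ℬ 𝒴 T₁ T₂} {l m₁ m₂ n : ℕ} [NeZero m₁] [NeZero m₂] {θ : Thresholds}
    {c : Fin n → CodeLetter 𝒰 𝒜 ℬ T₁ T₂ l m₁ m₂} {w₁ : Fin l → Fin m₁} {w₂ : Fin l → Fin m₂}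
    {y : ℕ → Fin n → 𝒴} :
    ind (¬Identifies S 𝒯 θ c w₁ w₂ y) ≤ ∑ k ∈ Finset.range l,
      (ind (¬θ.e₁ < ∏ i, S.statE₁ (c i) (extend w₁) (extend w₂) (fun b => y b i) 𝒯 k
          (extend w₂ (k + 2))) +
       ind (¬θ.e₂ < ∏ i, S.statE₂ (c i) (extend w₁) (extend w₂) (fun b => y b i) 𝒯 k
          (extend w₁ (k + 2))) +
       ind (¬θ.d₁ < ∏ i, S.statD₁ (c i) (extend w₁) (extend w₂) (fun b => y b i) 𝒯 k
          (extend w₁ (k + 2)) (extend w₂ (k + 2))) +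
       ind (¬θ.d₂ < ∏ i, S.statD₂ (c i) (extend w₁) (extend w₂) (fun b => y b i) 𝒯 k
          (extend w₁ (k + 2)) (extend w₂ (k + 2))) +
       ind (¬θ.d₀ < ∏ i, S.statD₀ (c i) (extend w₁) (extend w₂) (fun b => y b i) 𝒯 k
          (extend w₁ (k + 2)) (extend w₂ (k + 2))) +
       (∑ j ∈ Finset.univ.erase (extend w₂ (k + 2)), ind (θ.e₁ <
          ∏ i, S.statE₁ (c i) (extend w₁) (extend w₂) (fun b => y b i) 𝒯 k j)) +
       (∑ j ∈ Finset.univ.erase (extend w₁ (k + 2)), ind (θ.e₂ <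
          ∏ i, S.statE₂ (c i) (extend w₁) (extend w₂) (fun b => y b i) 𝒯 k j)) +
       (∑ j ∈ Finset.univ.erase (extend w₁ (k + 2)), ind (θ.d₁ <
          ∏ i, S.statD₁ (c i) (extend w₁) (extend w₂) (fun b => y b i) 𝒯 k j
            (extend w₂ (k + 2)))) +
       (∑ j ∈ Finset.univ.erase (extend w₂ (k + 2)), ind (θ.d₂ <
          ∏ i, S.statD₂ (c i) (extend w₁) (extend w₂) (fun b => y b i) 𝒯 k
            (extend w₁ (k + 2)) j)) +
       ∑ j₁ ∈ Finset.univ.erase (extend w₁ (k + 2)), ∑ j₂ ∈ Finset.univ.erase (extend w₂ (k + 2)),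
          ind (θ.d₀ <
          ∏ i, S.statD₀ (c i) (extend w₁) (extend w₂) (fun b => y b i) 𝒯 k j₁ j₂)) := by
  have hcases : ¬Identifies S 𝒯 θ c w₁ w₂ y → ∃ k ∈ Finset.range l,
      ((((((((((¬PassE₁ S 𝒯 θ c (extend w₁) (extend w₂) y k (extend w₂ (k + 2))) ∨
      (¬PassE₂ S 𝒯 θ c (extend w₁) (extend w₂) y k (extend w₁ (k + 2)))) ∨
      (¬θ.d₁ < ∏ i, S.statD₁ (c i) (extend w₁) (extend w₂) (fun b => y b i) 𝒯 k
          (extend w₁ (k + 2)) (extend w₂ (k + 2)))) ∨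
      (¬θ.d₂ < ∏ i, S.statD₂ (c i) (extend w₁) (extend w₂) (fun b => y b i) 𝒯 k
          (extend w₁ (k + 2)) (extend w₂ (k + 2)))) ∨
      (¬θ.d₀ < ∏ i, S.statD₀ (c i) (extend w₁) (extend w₂) (fun b => y b i) 𝒯 k
          (extend w₁ (k + 2)) (extend w₂ (k + 2)))) ∨
      (∃ j ∈ Finset.univ.erase (extend w₂ (k + 2)), PassE₁ S 𝒯 θ c (extend w₁) (extend w₂) y k j)) ∨
      (∃ j ∈ Finset.univ.erase (extend w₁ (k + 2)), PassE₂ S 𝒯 θ c (extend w₁) (extend w₂) y k j)) ∨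
      (∃ j ∈ Finset.univ.erase (extend w₁ (k + 2)), θ.d₁ <
          ∏ i, S.statD₁ (c i) (extend w₁) (extend w₂) (fun b => y b i) 𝒯 k j
            (extend w₂ (k + 2)))) ∨
      (∃ j ∈ Finset.univ.erase (extend w₂ (k + 2)), θ.d₂ <
          ∏ i, S.statD₂ (c i) (extend w₁) (extend w₂) (fun b => y b i) 𝒯 k
            (extend w₁ (k + 2)) j)) ∨
      (∃ j₁ ∈ Finset.univ.erase (extend w₁ (k + 2)),
        ∃ j₂ ∈ Finset.univ.erase (extend w₂ (k + 2)), θ.d₀ <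
          ∏ i, S.statD₀ (c i) (extend w₁) (extend w₂) (fun b => y b i) 𝒯 k j₁ j₂)) := by
    intro h
    by_contra! hc
    simp only [Finset.mem_range, Finset.mem_erase, Finset.mem_univ, and_true] at hc
    refine h ⟨fun k hk j => ⟨fun hj => ?_, ?_⟩, fun k hk j => ⟨fun hj => ?_, ?_⟩,
      fun k hk j₁ j₂ => ⟨fun hj => ?_, ?_⟩⟩ <;>
      obtain ⟨⟨⟨⟨⟨⟨⟨⟨⟨a1, a2⟩, a3⟩, a4⟩, a5⟩, a6⟩, a7⟩, a8⟩, a9⟩, a10⟩ := hc k hk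
    · by_contra hne
      exact a6 j hne hj
    · rintro rfl; exact a1
    · by_contra hne
      exact a7 j hne hj
    · rintro rfl; exact a2
    -- A wrong pair is excluded by the single test matching its wrong components: `d₁`, `d₂`, or
    -- `d₀` when both are wrong.
    · obtain ⟨h1, h2, h0⟩ := hj
      by_cases e1 : j₁ = extend w₁ (k + 2)
      · by_cases e2 : j₂ = extend w₂ (k + 2)
        · exact ⟨e1, e2⟩
        · subst e1; exact absurd h2 (not_lt.2 (a9 j₂ e2))
      · by_cases e2 : j₂ = extend w₂ (k + 2)
        · subst e2; exact absurd h1 (not_lt.2 (a8 j₁ e1))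
        · exact absurd h0 (not_lt.2 (a10 j₁ e1 j₂ e2))
    · rintro ⟨rfl, rfl⟩; exact ⟨a3, a4, a5⟩
  refine (ind_mono hcases).trans (ind_exists_le.trans (Finset.sum_le_sum fun k _ => ?_))
  iterate 7 refine (ind_or_le _ _).trans (add_le_add ?_ (by
    first
    | exact le_rfl
    | exact ind_exists_le
    | exact ind_exists_le.trans (Finset.sum_le_sum fun _ _ => ind_exists_le)))
  exact (ind_or_le _ _).trans (add_le_add ((ind_or_le _ _).trans (add_le_add le_rfl le_rfl)) le_rfl)

variable [Fintype 𝒰] [Fintype 𝒜] [Fintype ℬ] [Fintype T₁] [Fintype T₂] [Fintype Z]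
  {Λ : Laws 𝒰 𝒜 ℬ T₁ T₂ Z} {𝒯 : Tests 𝒰 𝒜 ℬ 𝒴 T₁ T₂} {S : Strategies 𝒰 𝒜 ℬ 𝒳₁ 𝒳₂ 𝒴 T₁ T₂ Z}

/-- The mean logarithm, for the right candidates, of a function of the window. -/
noncomputable def Laws.gain (Λ : Laws 𝒰 𝒜 ℬ T₁ T₂ Z) (R : Window 𝒰 𝒜 ℬ T₁ T₂ Z → ℝ) : ℝ :=
  expect Λ.window fun w => Real.logb 2 (R w)

/-- The exponents are below the mean logarithms of the tests. -/
structure Thresholds.Below (γ : Thresholds) (Λ : Laws 𝒰 𝒜 ℬ T₁ T₂ Z)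
    (S : Strategies 𝒰 𝒜 ℬ 𝒳₁ 𝒳₂ 𝒴 T₁ T₂ Z) (𝒯 : Tests 𝒰 𝒜 ℬ 𝒴 T₁ T₂) : Prop where
  e₁ : γ.e₁ < Λ.gain fun w => S.valE₁ 𝒯 w.2.1.2.2.1 w
  e₂ : γ.e₂ < Λ.gain fun w => S.valE₂ 𝒯 w.2.1.2.1 w
  d₁ : γ.d₁ < Λ.gain fun w => S.valD₁ 𝒯 w.2.1.2.1 w * S.valU 𝒯 w.2.2.2.1 w
  d₂ : γ.d₂ < Λ.gain fun w => S.valD₂ 𝒯 w.2.1.2.2.1 w * S.valU 𝒯 w.2.2.2.1 w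
  d₀ : γ.d₀ < Λ.gain fun w => S.valD₀ 𝒯 w.2.1.2.1 w.2.1.2.2.1 w * S.valU 𝒯 w.2.2.2.1 w

/-- Since all windows share one law, a single `ρ` serves every block, every pair of messages and
every code size. -/
theorem Laws.Stationary.exists_fail_le (hS : Λ.Stationary S) {R : Window 𝒰 𝒜 ℬ T₁ T₂ Z → ℝ}
    (hR : ∀ w, 0 < R w) {γ : ℝ} (hγ : γ < Λ.gain R) : ∃ ρ : ℝ, 0 ≤ ρ ∧ ρ < 1 ∧
      ∀ (l m₁ m₂ n k : ℕ) (μ₁ : ℕ → Fin m₁) (μ₂ : ℕ → Fin m₂), k < l →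
        expect (piLaw fun _ : Fin n => Λ.code l m₁ m₂) (fun c =>
          expect (piLaw fun _ : Fin n => Λ.noise l) fun ζ =>
            ind ¬((2 : ℝ) ^ γ) ^ n <
              ∏ i, R (S.window (c i) μ₁ μ₂ (fun b => ζ i (Fin.ofNat _ b)) k)) ≤ ρ ^ n := by
  obtain ⟨s, hs, hρ⟩ := exists_moment_lt_one Λ.window_mem hR hγ
  refine ⟨_, expect_nonneg Λ.window_mem fun w => ?_, hρ, fun l m₁ m₂ n k μ₁ μ₂ hk => ?_⟩
  · exact (Real.rpow_pos_of_pos (div_pos (hR w) (Real.rpow_pos_of_pos two_pos _)) _).le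
  · refine expect_fail_le (Λ.code_mem l m₁ m₂) (Λ.noise_mem l)
      (g := fun c ζ => R (S.window c μ₁ μ₂ (fun b => ζ (Fin.ofNat _ b)) k)) (fun _ _ => hR _) hs ?_
    exact (hS.expect_window μ₁ μ₂ hk fun w => (R w / 2 ^ γ) ^ (-s)).le

/-- The term `5 * ρ ^ n` pays for rejecting the truth in the five tests, with the largest of their
rates. Each remaining term is a number of wrong candidates times the Markov bound; there are `m - 1`
of them per user. -/
theorem exists_error_exponent (hS : Λ.Stationary S) (h𝒯 : 𝒯.Valid Λ) {γ : Thresholds}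
    (hγ : γ.Below Λ S 𝒯) : ∃ ρ : ℝ, 0 ≤ ρ ∧ ρ < 1 ∧
      ∀ (l m₁ m₂ n : ℕ) [NeZero m₁] [NeZero m₂] (w₁ : Fin l → Fin m₁) (w₂ : Fin l → Fin m₂),
        expect (piLaw fun _ : Fin n => Λ.code l m₁ m₂) (fun c =>
          expect (piLaw fun _ : Fin n => Λ.noise l) fun ζ =>
            ind ¬Identifies S 𝒯 (γ.pow n) c w₁ w₂ fun b i =>
              S.genie (c i) (extend w₁) (extend w₂) (fun b => ζ i (Fin.ofNat _ b)) b) ≤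
        l * (5 * ρ ^ n + (m₂ - 1 : ℝ) * (γ.pow n).e₁⁻¹ + (m₁ - 1 : ℝ) * (γ.pow n).e₂⁻¹ +
          (m₁ - 1 : ℝ) * (γ.pow n).d₁⁻¹ + (m₂ - 1 : ℝ) * (γ.pow n).d₂⁻¹ +
          (m₁ - 1 : ℝ) * ((m₂ - 1 : ℝ) * (γ.pow n).d₀⁻¹)) := by
  obtain ⟨ρ₁, h10, h11, h1⟩ := hS.exists_fail_le (fun w => h𝒯.e₁_pos _ _ _ _ _ _) hγ.e₁
  obtain ⟨ρ₂, h20, h21, h2⟩ := hS.exists_fail_le (fun w => h𝒯.e₂_pos _ _ _ _ _ _) hγ.e₂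
  obtain ⟨ρ₃, h30, h31, h3⟩ := hS.exists_fail_le
    (fun w => mul_pos (h𝒯.d₁_pos _ _ _ _ _) (h𝒯.h_pos _ _ _ _)) hγ.d₁
  obtain ⟨ρ₄, h40, h41, h4⟩ := hS.exists_fail_le
    (fun w => mul_pos (h𝒯.d₂_pos _ _ _ _ _) (h𝒯.h_pos _ _ _ _)) hγ.d₂
  obtain ⟨ρ₅, h50, h51, h5⟩ := hS.exists_fail_le
    (fun w => mul_pos (h𝒯.d₀_pos _ _ _ _ _) (h𝒯.h_pos _ _ _ _)) hγ.d₀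
  refine ⟨max ρ₁ (max ρ₂ (max ρ₃ (max ρ₄ ρ₅))), le_max_of_le_left h10, by simp [*], ?_⟩
  intro l m₁ m₂ n _ _ w₁ w₂
  set ρ := max ρ₁ (max ρ₂ (max ρ₃ (max ρ₄ ρ₅)))
  have hpos : ∀ x : ℝ, (0 : ℝ) < (2 ^ x) ^ n := fun x => pow_pos (Real.rpow_pos_of_pos two_pos _) n
  have hcard : ∀ (m : ℕ) [NeZero m] (a : Fin m) (f : Fin m → ℝ) (B : ℝ), (∀ j, j ≠ a → f j ≤ B) →
      ∑ j ∈ Finset.univ.erase a, f j ≤ (m - 1 : ℝ) * B := by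
    intro m hm a f B h
    refine (Finset.sum_le_card_nsmul _ _ B fun j hj => h j (Finset.ne_of_mem_erase hj)).trans ?_
    rw [Finset.card_erase_of_mem (Finset.mem_univ a), Finset.card_univ, Fintype.card_fin,
      nsmul_eq_mul, Nat.cast_sub (NeZero.one_le), Nat.cast_one]
  refine (expect_mono (piLaw_mem fun _ => Λ.code_mem _ _ _) fun c =>
    expect_mono (piLaw_mem fun _ => Λ.noise_mem _) fun ζ => ind_not_identifies_le).trans ?_
  simp only [expect_sum, expect_add]
  refine (Finset.sum_le_card_nsmul _ _ _ fun k hk => ?_).trans_eq (by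
    rw [Finset.card_range, nsmul_eq_mul])
  have hk : k < l := Finset.mem_range.1 hk
  rw [show 5 * ρ ^ n = ρ ^ n + ρ ^ n + ρ ^ n + ρ ^ n + ρ ^ n by ring]
  refine add_le_add (add_le_add (add_le_add (add_le_add (add_le_add (add_le_add (add_le_add
    (add_le_add (add_le_add ?_ ?_) ?_) ?_) ?_) ?_) ?_) ?_) ?_) ?_
  · simp only [S.statE₁_genie]
    exact (h1 l m₁ m₂ n k _ _ hk).trans (pow_le_pow_left₀ h10 (by simp [ρ]) n)
  · simp only [S.statE₂_genie]
    exact (h2 l m₁ m₂ n k _ _ hk).trans (pow_le_pow_left₀ h20 (by simp [ρ]) n)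
  · simp only [S.statD₁_genie]
    exact (h3 l m₁ m₂ n k _ _ hk).trans (pow_le_pow_left₀ h30 (by simp [ρ]) n)
  · simp only [S.statD₂_genie]
    exact (h4 l m₁ m₂ n k _ _ hk).trans (pow_le_pow_left₀ h40 (by simp [ρ]) n)
  · simp only [S.statD₀_genie]
    exact (h5 l m₁ m₂ n k _ _ hk).trans (pow_le_pow_left₀ h50 (by simp [ρ]) n)
  · refine hcard _ _ _ _ fun j hj => expect_pass_le (Λ.code_mem l m₁ m₂) (Λ.noise_mem l)
      (g := fun c ζ => S.statE₁ c (extend w₁) (extend w₂)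
        (S.genie c (extend w₁) (extend w₂) fun b => ζ (Fin.ofNat _ b)) 𝒯 k j)
      (fun _ _ => h𝒯.e₁_pos _ _ _ _ _ _) (h𝒯.expect_statE₁_le S hk hj) (hpos _)
  · refine hcard _ _ _ _ fun j hj => expect_pass_le (Λ.code_mem l m₁ m₂) (Λ.noise_mem l)
      (g := fun c ζ => S.statE₂ c (extend w₁) (extend w₂)
        (S.genie c (extend w₁) (extend w₂) fun b => ζ (Fin.ofNat _ b)) 𝒯 k j)
      (fun _ _ => h𝒯.e₂_pos _ _ _ _ _ _) (h𝒯.expect_statE₂_le S hk hj) (hpos _)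
  · refine hcard _ _ _ _ fun j hj => expect_pass_le (Λ.code_mem l m₁ m₂) (Λ.noise_mem l)
      (g := fun c ζ => S.statD₁ c (extend w₁) (extend w₂)
        (S.genie c (extend w₁) (extend w₂) fun b => ζ (Fin.ofNat _ b)) 𝒯 k j (extend w₂ (k + 2)))
      (fun _ _ => mul_pos (h𝒯.d₁_pos _ _ _ _ _) (h𝒯.h_pos _ _ _ _))
      (h𝒯.expect_statD₁_le S hk hj) (hpos _)
  · refine hcard _ _ _ _ fun j hj => expect_pass_le (Λ.code_mem l m₁ m₂) (Λ.noise_mem l)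
      (g := fun c ζ => S.statD₂ c (extend w₁) (extend w₂)
        (S.genie c (extend w₁) (extend w₂) fun b => ζ (Fin.ofNat _ b)) 𝒯 k (extend w₁ (k + 2)) j)
      (fun _ _ => mul_pos (h𝒯.d₂_pos _ _ _ _ _) (h𝒯.h_pos _ _ _ _))
      (h𝒯.expect_statD₂_le S hk hj) (hpos _)
  · refine hcard _ _ _ _ fun i hi => hcard _ _ _ _ fun j hj =>
      expect_pass_le (Λ.code_mem l m₁ m₂) (Λ.noise_mem l)
      (g := fun c ζ => S.statD₀ c (extend w₁) (extend w₂)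
        (S.genie c (extend w₁) (extend w₂) fun b => ζ (Fin.ofNat _ b)) 𝒯 k i j)
      (fun _ _ => mul_pos (h𝒯.d₀_pos _ _ _ _ _) (h𝒯.h_pos _ _ _ _))
      (h𝒯.expect_statD₀_le S hk hi hj) (hpos _)

end CodingTheorem

/-! ### Choice of the code parameters and the limit of long transmissions -/

section Asymptotics

/-- The product `(n + 1) * (l + 2)` exceeds `l * n` by `2 * n + (l + 2)`. By `hl` and `hn` these two
parts, the dummy blocks and the rounding of `N`, cost at most `ε / 4` each, on top of the `ε / 2`
given up in `m`. -/
theorem rate_le_logb_card {R ε K : ℝ} {l n N m : ℕ} (hR : |R| ≤ K)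
    (hl : 8 * K ≤ ε * (l + 2)) (hn : 4 * K ≤ ε * (n + 1)) (hN : 0 < N) (hε : 0 < ε)
    (hNn : N ≤ (n + 1) * (l + 2)) (hm : ((2 : ℝ) ^ (R - ε / 2)) ^ n ≤ m) (hm1 : 1 ≤ m) :
    R - ε ≤ 1 / (N : ℝ) * Real.logb 2 ((m ^ l : ℕ) : ℝ) := by
  have hN' : (0 : ℝ) < N := Nat.cast_pos.2 hN
  have hlog0 : 0 ≤ Real.logb 2 m := Real.logb_nonneg one_lt_two (by exact_mod_cast hm1)
  rw [Nat.cast_pow, Real.logb_pow, one_div, ← div_eq_inv_mul, le_div_iff₀ hN']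
  by_cases hr : R - ε ≤ 0
  · exact (mul_nonpos_of_nonpos_of_nonneg hr hN'.le).trans (by positivity)
  push Not at hr
  have hlog : n * (R - ε / 2) ≤ Real.logb 2 m := by
    rw [Real.le_logb_iff_rpow_le one_lt_two (by exact_mod_cast hm1), mul_comm,
      Real.rpow_mul two_pos.le, Real.rpow_natCast]
    exact hm
  have hNr : (N : ℝ) ≤ (n + 1) * (l + 2) := by exact_mod_cast hNn
  have hRK : R ≤ K := (le_abs_self R).trans hR
  have h1 : (l : ℝ) * (n * (R - ε / 2)) ≤ l * Real.logb 2 m :=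
    mul_le_mul_of_nonneg_left hlog (Nat.cast_nonneg l)
  have h2 : (R - ε) * N ≤ (R - ε) * ((n + 1) * (l + 2)) := mul_le_mul_of_nonneg_left hNr hr.le
  have hn0 : (0 : ℝ) ≤ n := Nat.cast_nonneg n
  have hl0 : (0 : ℝ) ≤ l := Nat.cast_nonneg l
  have h3 : 8 * K * (n + 1) ≤ ε * (l + 2) * (n + 1) := mul_le_mul_of_nonneg_right hl (by positivity)
  have h4 : 4 * K * (l + 2) ≤ ε * (n + 1) * (l + 2) := mul_le_mul_of_nonneg_right hn (by positivity)
  have h5 : R * (2 * (n + 1) + (l + 2)) ≤ K * (2 * (n + 1) + (l + 2)) :=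
    mul_le_mul_of_nonneg_right hRK (by positivity)
  nlinarith [mul_nonneg hn0 hl0]

theorem rpow_pow_mul_inv (a c : ℝ) (n : ℕ) :
    ((2 : ℝ) ^ a) ^ n * (((2 : ℝ) ^ c) ^ n)⁻¹ = ((2 : ℝ) ^ (a - c)) ^ n := by
  rw [Real.rpow_sub two_pos, div_pow, div_eq_mul_inv]

variable {𝒰 𝒜 ℬ 𝒳₁ 𝒳₂ 𝒴 T₁ T₂ Z : Type*}
  [Fintype 𝒰] [Fintype 𝒜] [Fintype ℬ] [Fintype T₁] [Fintype T₂] [Fintype Z] [Fintype 𝒴]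
  {Λ : Laws 𝒰 𝒜 ℬ T₁ T₂ Z} {S : Strategies 𝒰 𝒜 ℬ 𝒳₁ 𝒳₂ 𝒴 T₁ T₂ Z}
  {W : 𝒳₁ → 𝒳₂ → stdSimplex ℝ 𝒴}

/-- A random code of block length `n`, used in a transmission of length `N`. -/
theorem exists_system_of_expect_le
    (hW : ∀ x₁ x₂ y, expect Λ.z.1 (fun z => ind (S.chan z x₁ x₂ = y)) = W x₁ x₂ y)
    {𝒯 : Tests 𝒰 𝒜 ℬ 𝒴 T₁ T₂} {θ : Thresholds} {l m₁ m₂ n N : ℕ} [NeZero m₁] [NeZero m₂]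
    (hn : 0 < n) (hN : (l + 2) * n ≤ N) {τ : ℝ}
    (h : ∀ (w₁ : Fin l → Fin m₁) (w₂ : Fin l → Fin m₂),
      expect (piLaw fun _ : Fin n => Λ.code l m₁ m₂) (fun c =>
        expect (piLaw fun _ : Fin n => Λ.noise l) fun ζ =>
          ind ¬Identifies S 𝒯 θ c w₁ w₂ fun b i =>
            S.genie (c i) (extend w₁) (extend w₂) (fun b => ζ i (Fin.ofNat _ b)) b) ≤ τ) :
    ∃ T : TransmissionSystem 𝒳₁ 𝒳₂ 𝒴 N (m₁ ^ l) (m₂ ^ l), avgErrorProb W T ≤ τ := by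
  have hc₁ : Fintype.card (Fin l → Fin m₁) = m₁ ^ l := by simp
  have hc₂ : Fintype.card (Fin l → Fin m₂) = m₂ ^ l := by simp
  rw [← hc₁, ← hc₂]
  have hM₁ : (0 : ℝ) < Fintype.card (Fin l → Fin m₁) := Nat.cast_pos.2 Fintype.card_pos
  have hM₂ : (0 : ℝ) < Fintype.card (Fin l → Fin m₂) := Nat.cast_pos.2 Fintype.card_pos
  -- A law has a point in its space; `d` and `σ` serve only to produce some output letter for
  -- padding.
  obtain ⟨d, -⟩ := exists_le_of_expect_le Λ.d.2 (f := fun _ => 0) (expect_const Λ.d.2 0).le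
  obtain ⟨σ, -⟩ := exists_le_of_expect_le Λ.seed_mem (f := fun _ => 0)
    (expect_const Λ.seed_mem 0).le
  -- Some fixed codebook has an error, averaged over messages, no larger than the mean over random
  -- codebooks.
  obtain ⟨c, hc⟩ := exists_le_of_expect_le (piLaw_mem fun _ : Fin n => Λ.code_mem l m₁ m₂)
    (c := τ) (f := fun c => (1 / ((Fintype.card (Fin l → Fin m₁) : ℝ) *
      Fintype.card (Fin l → Fin m₂))) * ∑ w₁ : Fin l → Fin m₁, ∑ w₂ : Fin l → Fin m₂,
        expect (piLaw fun _ : Fin n => Λ.noise l) fun ζ =>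
          ind ¬Identifies S 𝒯 θ c w₁ w₂ fun b i =>
            S.genie (c i) (extend w₁) (extend w₂) (fun b => ζ i (Fin.ofNat _ b)) b) (by
    rw [expect_mul_left, expect_sum]
    simp only [expect_sum]
    refine (mul_le_mul_of_nonneg_left (Finset.sum_le_sum fun w₁ _ => Finset.sum_le_sum fun w₂ _ =>
      h w₁ w₂) (by positivity)).trans_eq ?_
    simp only [Finset.sum_const, Finset.card_univ, nsmul_eq_mul]
    field_simp)
  obtain ⟨T, hT⟩ := exists_system Λ.z.2 hW hn hN (S.out d σ) (encode₁ S 𝒯 θ c) (encode₂ S 𝒯 θ c)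
    (encode₁_causal S 𝒯 θ c) (encode₂_causal S 𝒯 θ c) (guess S 𝒯 θ c)
    (fun y y' h => guess_congr S 𝒯 θ c h)
    (fun w₁ w₂ ζ => Identifies S 𝒯 θ c w₁ w₂ fun b i =>
      S.genie (c i) (extend w₁) (extend w₂) (fun b => ζ i (Fin.ofNat _ b)) b)
    (fun w₁ w₂ ζ h => by
      obtain ⟨y, hy, hg⟩ := exists_output_of_identifies
        (ζ := fun i b => ζ i (Fin.ofNat _ b)) h
      refine ⟨y, fun b i => ?_, hg⟩
      rw [hy, ofNat_val])
  exact ⟨T, hT.trans hc⟩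

/-- Rates below the mean logarithms of test functions are achievable. -/
theorem achievable_of_tests
    (hW : ∀ x₁ x₂ y, expect Λ.z.1 (fun z => ind (S.chan z x₁ x₂ = y)) = W x₁ x₂ y)
    (hS : Λ.Stationary S) {R₁ R₂ : ℝ}
    (h : ∀ δ > 0, ∃ 𝒯 : Tests 𝒰 𝒜 ℬ 𝒴 T₁ T₂, 𝒯.Valid Λ ∧
      Thresholds.Below ⟨R₂ - δ, R₁ - δ, R₁ - δ, R₂ - δ, R₁ + R₂ - δ⟩ Λ S 𝒯) :
    Achievable W R₁ R₂ := by
  intro ε hε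
  obtain ⟨𝒯, h𝒯, hγ⟩ := h (ε / 4) (by positivity)
  obtain ⟨ρ, hρ0, hρ1, hρ⟩ := exists_error_exponent hS h𝒯 hγ
  set γ : Thresholds := ⟨R₂ - ε / 4, R₁ - ε / 4, R₁ - ε / 4, R₂ - ε / 4, R₁ + R₂ - ε / 4⟩
  let K := |R₁| + |R₂| + 1
  have hK1 : |R₁| ≤ K := by have := abs_nonneg R₂; simp only [K]; linarith
  have hK2 : |R₂| ≤ K := by have := abs_nonneg R₁; simp only [K]; linarith
  obtain ⟨l, hl⟩ := exists_nat_ge (8 * K / ε)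
  obtain ⟨n₂, hn₂⟩ := exists_nat_ge (4 * K / ε)
  rw [div_le_iff₀ hε] at hl hn₂
  let κ : ℝ := 2 ^ (-(ε / 4))
  have hκ0 : 0 ≤ κ := (Real.rpow_pos_of_pos two_pos _).le
  have hκ1 : κ < 1 := Real.rpow_lt_one_of_one_lt_of_neg one_lt_two (by linarith)
  have hlim : Filter.Tendsto (fun n : ℕ => (l : ℝ) * (5 * ρ ^ n + 5 * κ ^ n)) Filter.atTop
      (nhds 0) := by
    have := (((tendsto_pow_atTop_nhds_zero_of_lt_one hρ0 hρ1).const_mul 5).add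
      ((tendsto_pow_atTop_nhds_zero_of_lt_one hκ0 hκ1).const_mul 5)).const_mul (l : ℝ)
    simpa using this
  obtain ⟨n₁, hn₁⟩ := Filter.eventually_atTop.1 (hlim.eventually (gt_mem_nhds hε))
  -- The number of blocks is fixed by now; this bound makes the block length `N / (l + 2)` exceed
  -- both `n₁` (error) and `n₂` (rate loss).
  refine ⟨(l + 2) * (max n₁ n₂ + 1), fun N hN => ?_⟩
  obtain ⟨n, hnN, hNn⟩ : ∃ n, (l + 2) * n ≤ N ∧ N < (n + 1) * (l + 2) := by
    refine ⟨N / (l + 2), Nat.mul_div_le _ _, ?_⟩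
    rw [← Nat.div_lt_iff_lt_mul (by omega)]
    exact Nat.lt_succ_self _
  have hn : max n₁ n₂ + 1 ≤ n := by
    by_contra! hlt
    have h1 : (n + 1) * (l + 2) ≤ (max n₁ n₂ + 1) * (l + 2) := Nat.mul_le_mul_right _ hlt
    rw [Nat.mul_comm (max n₁ n₂ + 1)] at h1
    omega
  have hn1 : n₁ ≤ n := by have := le_max_left n₁ n₂; omega
  have hn2 : n₂ ≤ n := by have := le_max_right n₁ n₂; omega
  have hpos : ∀ R : ℝ, (0 : ℝ) < (2 ^ R) ^ n := fun R => pow_pos (Real.rpow_pos_of_pos two_pos _) n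
  -- Rates `R - ε / 2` against thresholds `R - ε / 4` leave the exponent `-(ε / 4)` of `κ`. The
  -- ceiling provides a message even at negative rates, and its rounding is harmless since only `m R
  -- - 1` candidates are wrong.
  let m : ℝ → ℕ := fun R => ⌈((2 : ℝ) ^ (R - ε / 2)) ^ n⌉₊
  have hm1 : ∀ R, 1 ≤ m R := fun R => Nat.one_le_ceil_iff.2 (hpos _)
  have hm : ∀ R, (m R - 1 : ℝ) ≤ ((2 : ℝ) ^ (R - ε / 2)) ^ n := fun R => by
    have := (Nat.ceil_lt_add_one (hpos (R - ε / 2)).le).le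
    simp only [m]; linarith
  have hm0 : ∀ R, (0 : ℝ) ≤ m R - 1 := fun R => sub_nonneg.2 (by exact_mod_cast hm1 R)
  have : NeZero (m R₁) := ⟨Nat.one_le_iff_ne_zero.1 (hm1 R₁)⟩
  have : NeZero (m R₂) := ⟨Nat.one_le_iff_ne_zero.1 (hm1 R₂)⟩
  have hsum : ∀ R, (m R - 1 : ℝ) * (((2 : ℝ) ^ (R - ε / 4)) ^ n)⁻¹ ≤ κ ^ n := fun R => by
    refine (mul_le_mul_of_nonneg_right (hm R) (inv_nonneg.2 (hpos _).le)).trans_eq ?_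
    rw [rpow_pow_mul_inv]
    congr 2; ring
  have hsum0 : (m R₁ - 1 : ℝ) * ((m R₂ - 1 : ℝ) * (((2 : ℝ) ^ (R₁ + R₂ - ε / 4)) ^ n)⁻¹) ≤
      κ ^ n := by
    calc _ ≤ ((2 : ℝ) ^ (R₁ - ε / 2)) ^ n * (((2 : ℝ) ^ (R₂ - ε / 2)) ^ n *
          (((2 : ℝ) ^ (R₁ + R₂ - ε / 4)) ^ n)⁻¹) :=
          mul_le_mul (hm R₁) (mul_le_mul_of_nonneg_right (hm R₂) (inv_nonneg.2 (hpos _).le))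
            (mul_nonneg (hm0 _) (inv_nonneg.2 (hpos _).le)) (hpos _).le
      _ = ((2 : ℝ) ^ (R₁ - ε / 2 + (R₂ - ε / 2 - (R₁ + R₂ - ε / 4)))) ^ n := by
          rw [rpow_pow_mul_inv, ← mul_pow, ← Real.rpow_add two_pos]
      _ ≤ κ ^ n := pow_le_pow_left₀ (Real.rpow_pos_of_pos two_pos _).le
          (Real.rpow_le_rpow_of_exponent_le one_le_two (by linarith)) n
  obtain ⟨T, hT⟩ := exists_system_of_expect_le (N := N) (𝒯 := 𝒯) (θ := γ.pow n) hW (by omega) hnN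
    (τ := ε) fun w₁ w₂ => by
      refine (hρ l (m R₁) (m R₂) n w₁ w₂).trans (le_trans ?_ (hn₁ n hn1).le)
      refine mul_le_mul_of_nonneg_left ?_ (Nat.cast_nonneg l)
      simp only [γ, Thresholds.pow]
      linarith [hsum R₁, hsum R₂]
  have hl' : 8 * K ≤ ε * (l + 2) := by nlinarith
  have hn' : 4 * K ≤ ε * (n + 1) := by
    have : (n₂ : ℝ) ≤ n := by exact_mod_cast hn2
    nlinarith
  exact ⟨m R₁ ^ l, m R₂ ^ l, pow_pos (hm1 R₁) l, pow_pos (hm1 R₂) l, T,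
    rate_le_logb_card hK1 hl' hn' (by omega) hε hNn.le (Nat.le_ceil _) (hm1 _),
    rate_le_logb_card hK2 hl' hn' (by omega) hε hNn.le (Nat.le_ceil _) (hm1 _), hT⟩

end Asymptotics

/-! ### Information inequalities for the tests -/

section InformationInequalities

variable {Ω α β γ δ : Type*} [Fintype Ω] [Fintype α] [Fintype β] [Fintype γ] [Fintype δ] {p : Ω → ℝ}

theorem condMutualInfo_eq (p : Ω → ℝ) (f : Ω → α) (g : Ω → β) (h : Ω → γ) :
    condMutualInfo p f g h = condEntropy p g h - condEntropy p g fun ω => (f ω, h ω) := by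
  simp only [condMutualInfo, condEntropy]
  rw [entropy_congr p (f := fun ω => (f ω, g ω, h ω)) (g := fun ω => (g ω, f ω, h ω))
    (by simp only [Prod.mk.injEq]; tauto)]
  ring

theorem condEntropy_chain (p : Ω → ℝ) (f : Ω → α) (g : Ω → β) (h : Ω → γ) :
    condEntropy p f h + condEntropy p g (fun ω => (f ω, h ω)) =
      condEntropy p g h + condEntropy p f (fun ω => (g ω, h ω)) := by
  have := condMutualInfo_eq p f g h
  simp only [condMutualInfo] at this
  linarith

theorem mutualInfo_pair (p : Ω → ℝ) (f : Ω → α) (g : Ω → β) (h : Ω → γ) :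
    mutualInfo p f (fun ω => (g ω, h ω)) =
      mutualInfo p f h + (condEntropy p g h - condEntropy p g fun ω => (f ω, h ω)) := by
  rw [← condMutualInfo_eq]
  simp only [mutualInfo, condMutualInfo]
  ring

theorem condEntropy_pair_le (hp : p ∈ stdSimplex ℝ Ω) (f : Ω → α) (g : Ω → β) (h : Ω → γ) :
    condEntropy p g (fun ω => (f ω, h ω)) ≤ condEntropy p g h :=
  condEntropy_anti hp g fun _ _ he => (Prod.mk.injEq _ _ _ _ ▸ he).2

theorem mutualInfo_nonneg (hp : p ∈ stdSimplex ℝ Ω) (f : Ω → α) (g : Ω → β) :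
    0 ≤ mutualInfo p f g := by
  have h0 : entropy p (fun _ => ()) = 0 := by
    simp only [entropy, prob, if_true, Fintype.sum_unique, hp.2, Real.logb_one, mul_zero, neg_zero]
  have h1 := condEntropy_anti hp f (g := g) (h := fun _ => ()) fun _ _ _ => rfl
  rw [condEntropy, condEntropy, h0, entropy_congr p (f := fun ω => (f ω, ())) (g := f)
    (by simp)] at h1
  rw [mutualInfo, condEntropy]
  linarith

/-- A lower bound for the information that a strategy has about the outputs in two blocks. -/
theorem le_mutualInfo_two_blocks (hp : p ∈ stdSimplex ℝ Ω) {τ : Type*} [Fintype τ]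
    (T : Ω → τ) (Y : Ω → α) (C : Ω → β) (Y' : Ω → γ) (V : Ω → δ) :
    (condEntropy p Y' V - condEntropy p Y' fun ω => (T ω, V ω)) +
      (condEntropy p Y (fun ω => (C ω, Y' ω, V ω)) -
        condEntropy p Y fun ω => (T ω, C ω, Y' ω, V ω)) ≤
      mutualInfo p T fun ω => (Y ω, C ω, Y' ω, V ω) := by
  -- Chain rule in the order `V`, `Y'`, `C`, `Y`; the nonnegative informations about `V` and about
  -- `C` are dropped.
  rw [mutualInfo_pair p T Y, mutualInfo_pair p T C, mutualInfo_pair p T Y']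
  linarith [mutualInfo_nonneg hp T V, condEntropy_pair_le hp T C fun ω => (Y' ω, V ω)]

variable {𝒰 𝒜 ℬ 𝒳₁ 𝒳₂ 𝒴 𝒮 τ : Type*} [Fintype 𝒰] [Fintype 𝒜] [Fintype ℬ] [Fintype 𝒳₁] [Fintype 𝒳₂]
  [Fintype 𝒴] [Fintype 𝒮] [Fintype τ]
  {T : Ω → τ} {u ut : Ω → 𝒰} {a at' : Ω → 𝒜} {b bt : Ω → ℬ} {x₁ x₁t : Ω → 𝒳₁} {x₂ x₂t : Ω → 𝒳₂}
  {y yt : Ω → 𝒴} {s : Ω → 𝒮}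

/-- The information used by an encoder. -/
theorem le_mutualInfo_encoder (hp : p ∈ stdSimplex ℝ Ω)
    (hs : ∀ ω ω', s ω = s ω' ↔ ut ω = ut ω' ∧ at' ω = at' ω' ∧ bt ω = bt ω' ∧ yt ω = yt ω')
    (hx : ∀ ω ω', T ω = T ω' → ut ω = ut ω' → at' ω = at' ω' → x₁t ω = x₁t ω')
    (ha : ∀ ω ω', T ω = T ω' → s ω = s ω' → a ω = a ω')
    (h₁ : condEntropy p yt (fun ω => (ut ω, at' ω, bt ω, x₂t ω)) =
      condEntropy p y fun ω => (u ω, a ω, b ω, x₂ ω))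
    (h₂ : condEntropy p yt (fun ω => (x₁t ω, x₂t ω)) = condEntropy p y fun ω => (x₁ ω, x₂ ω))
    (h₃ : condEntropy p y (fun ω => (x₁ ω, x₂ ω)) ≤
      condEntropy p y fun ω => (x₁ ω, x₂ ω, b ω, u ω, s ω, x₂t ω)) :
    condMutualInfo p x₁ y (fun ω => (x₂ ω, b ω, u ω, s ω, x₂t ω)) ≤
      mutualInfo p T fun ω => (y ω, (u ω, b ω, x₂ ω), yt ω, (ut ω, at' ω, bt ω, x₂t ω)) := by
  refine le_trans ?_ (le_mutualInfo_two_blocks hp T y (fun ω => (u ω, b ω, x₂ ω)) yt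
    fun ω => (ut ω, at' ω, bt ω, x₂t ω))
  rw [condMutualInfo_eq]
  have k1 : condEntropy p yt (fun ω => (T ω, ut ω, at' ω, bt ω, x₂t ω)) ≤
      condEntropy p yt fun ω => (x₁t ω, x₂t ω) := by
    refine condEntropy_anti hp _ fun ω ω' => ?_
    have := hx ω ω'
    simp only [Prod.mk.injEq]; tauto
  -- The first state is among the conditions, so the strategy determines `a`. The resulting entropy
  -- of `y` given `u, a, b, x₂` cancels, by `h₁`, against the one from the first block.
  have k2 : condEntropy p y (fun ω => (T ω, (u ω, b ω, x₂ ω), yt ω, (ut ω, at' ω, bt ω, x₂t ω))) ≤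
      condEntropy p y fun ω => (u ω, a ω, b ω, x₂ ω) := by
    refine condEntropy_anti hp _ fun ω ω' => ?_
    have h1 := ha ω ω'
    have h2 := hs ω ω'
    simp only [Prod.mk.injEq]; tauto
  have k3 : condEntropy p y (fun ω => (x₂ ω, b ω, u ω, s ω, x₂t ω)) ≤
      condEntropy p y fun ω => ((u ω, b ω, x₂ ω), yt ω, (ut ω, at' ω, bt ω, x₂t ω)) := by
    refine condEntropy_anti hp _ fun ω ω' => ?_
    have h2 := hs ω ω'
    simp only [Prod.mk.injEq]; tauto
  linarith

/-- The information used by the decoder for one of the users. -/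
theorem le_mutualInfo_decoder (hp : p ∈ stdSimplex ℝ Ω)
    (hs : ∀ ω ω', s ω = s ω' ↔ ut ω = ut ω' ∧ at' ω = at' ω' ∧ bt ω = bt ω' ∧ yt ω = yt ω')
    (hx : ∀ ω ω', T ω = T ω' → ut ω = ut ω' → at' ω = at' ω' → x₁t ω = x₁t ω')
    (ha : ∀ ω ω', T ω = T ω' → s ω = s ω' → a ω = a ω')
    (h₁ : condEntropy p yt (fun ω => (ut ω, at' ω, bt ω, x₂t ω)) =
      condEntropy p y fun ω => (u ω, a ω, b ω, x₂ ω))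
    (h₂ : condEntropy p yt (fun ω => (x₁t ω, x₂t ω)) = condEntropy p y fun ω => (x₁ ω, x₂ ω))
    (h₃ : condEntropy p y (fun ω => (x₁ ω, x₂ ω)) ≤
      condEntropy p y fun ω => (x₁ ω, x₂ ω, b ω, u ω, s ω, x₂t ω)) :
    condMutualInfo p x₁ y (fun ω => (x₂ ω, b ω, u ω, s ω, x₂t ω)) -
        condMutualInfo p a x₂ (fun ω => (y ω, b ω, u ω, s ω, x₂t ω)) ≤
      mutualInfo p T fun ω => (y ω, (u ω, b ω), yt ω, (ut ω, at' ω, bt ω, x₂t ω)) := by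
  refine le_trans ?_ (le_mutualInfo_two_blocks hp T y (fun ω => (u ω, b ω)) yt
    fun ω => (ut ω, at' ω, bt ω, x₂t ω))
  rw [condMutualInfo_eq, condMutualInfo_eq]
  have k1 : condEntropy p yt (fun ω => (T ω, ut ω, at' ω, bt ω, x₂t ω)) ≤
      condEntropy p yt fun ω => (x₁t ω, x₂t ω) := by
    refine condEntropy_anti hp _ fun ω ω' => ?_
    have := hx ω ω'
    simp only [Prod.mk.injEq]; tauto
  have k2 : condEntropy p y (fun ω => (T ω, (u ω, b ω), yt ω, (ut ω, at' ω, bt ω, x₂t ω))) ≤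
      condEntropy p y fun ω => (a ω, b ω, u ω, s ω, x₂t ω) := by
    refine condEntropy_anti hp _ fun ω ω' => ?_
    have h1 := ha ω ω'
    have h2 := hs ω ω'
    simp only [Prod.mk.injEq]; tauto
  have k3 : condEntropy p y (fun ω => (b ω, u ω, s ω, x₂t ω)) ≤
      condEntropy p y fun ω => ((u ω, b ω), yt ω, (ut ω, at' ω, bt ω, x₂t ω)) := by
    refine condEntropy_anti hp _ fun ω ω' => ?_
    have h2 := hs ω ω'
    simp only [Prod.mk.injEq]; tauto
  -- With a common condition understood, I(a;y) = I(a;y|x₂) + I(a;x₂) - I(a;x₂|y). The middle term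
  -- is discarded by `k6`, and the last is the price of not knowing `x₂`.
  have k4 := condEntropy_chain p x₂ y fun ω => (b ω, u ω, s ω, x₂t ω)
  have k5 := condEntropy_chain p x₂ y fun ω => (a ω, b ω, u ω, s ω, x₂t ω)
  have k6 := condEntropy_pair_le hp a x₂ fun ω => (b ω, u ω, s ω, x₂t ω)
  have k7 : condEntropy p y (fun ω => (x₂ ω, a ω, b ω, u ω, s ω, x₂t ω)) ≤
      condEntropy p y fun ω => (u ω, a ω, b ω, x₂ ω) := by
    refine condEntropy_anti hp _ fun ω ω' => ?_
    simp only [Prod.mk.injEq]; tauto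
  have k8 : condEntropy p x₂ (fun ω => (a ω, y ω, b ω, u ω, s ω, x₂t ω)) =
      condEntropy p x₂ fun ω => (y ω, a ω, b ω, u ω, s ω, x₂t ω) :=
    condEntropy_congr p (fun _ _ => Iff.rfl) fun ω ω' => by simp only [Prod.mk.injEq]; tauto
  linarith

/-- The information used by the decoder for both users. -/
theorem le_mutualInfo_decoder_both (hp : p ∈ stdSimplex ℝ Ω)
    (hs : ∀ ω ω', s ω = s ω' ↔ ut ω = ut ω' ∧ at' ω = at' ω' ∧ bt ω = bt ω' ∧ yt ω = yt ω')
    (hx₁ : ∀ ω ω', T ω = T ω' → ut ω = ut ω' → at' ω = at' ω' → x₁t ω = x₁t ω')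
    (hx₂ : ∀ ω ω', T ω = T ω' → ut ω = ut ω' → bt ω = bt ω' → x₂t ω = x₂t ω')
    (ha : ∀ ω ω', T ω = T ω' → s ω = s ω' → a ω = a ω')
    (hb : ∀ ω ω', T ω = T ω' → s ω = s ω' → b ω = b ω')
    (h₁ : condEntropy p yt (fun ω => (ut ω, at' ω, bt ω)) =
      condEntropy p y fun ω => (u ω, a ω, b ω))
    (h₂ : condEntropy p yt (fun ω => (x₁t ω, x₂t ω)) = condEntropy p y fun ω => (x₁ ω, x₂ ω))
    (h₃ : condEntropy p y (fun ω => (x₁ ω, x₂ ω)) ≤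
      condEntropy p y fun ω => ((x₁ ω, x₂ ω), u ω, s ω)) :
    condMutualInfo p (fun ω => (x₁ ω, x₂ ω)) y (fun ω => (u ω, s ω)) ≤
      mutualInfo p T fun ω => (y ω, u ω, yt ω, (ut ω, at' ω, bt ω)) := by
  refine le_trans ?_ (le_mutualInfo_two_blocks hp T y u yt
    fun ω => (ut ω, at' ω, bt ω))
  rw [condMutualInfo_eq]
  have k1 : condEntropy p yt (fun ω => (T ω, ut ω, at' ω, bt ω)) ≤
      condEntropy p yt fun ω => (x₁t ω, x₂t ω) := by
    refine condEntropy_anti hp _ fun ω ω' => ?_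
    have h1 := hx₁ ω ω'
    have h2 := hx₂ ω ω'
    simp only [Prod.mk.injEq]; tauto
  have k2 : condEntropy p y (fun ω => (T ω, u ω, yt ω, (ut ω, at' ω, bt ω))) ≤
      condEntropy p y fun ω => (u ω, a ω, b ω) := by
    refine condEntropy_anti hp _ fun ω ω' => ?_
    have h1 := ha ω ω'
    have h2 := hb ω ω'
    have h3 := hs ω ω'
    simp only [Prod.mk.injEq]; tauto
  have k3 : condEntropy p y (fun ω => (u ω, s ω)) ≤
      condEntropy p y fun ω => (u ω, yt ω, (ut ω, at' ω, bt ω)) := by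
    refine condEntropy_anti hp _ fun ω ω' => ?_
    have h2 := hs ω ω'
    simp only [Prod.mk.injEq]; tauto
  linarith

/-- The information used for the common letter. -/
theorem le_mutualInfo_common (hp : p ∈ stdSimplex ℝ Ω) (f : Ω → α) (g : Ω → β) (h : Ω → γ) :
    condMutualInfo p f g h ≤ mutualInfo p f fun ω => (g ω, h ω) := by
  rw [mutualInfo_pair, condMutualInfo_eq]
  linarith [mutualInfo_nonneg hp f h]

end InformationInequalities

/-! ### The single-letter law of two consecutive blocks -/

section TwoBlocks

variable {𝒰 𝒜 ℬ 𝒳₁ 𝒳₂ 𝒴 T₁ T₂ Z : Type*}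

namespace Strategies

variable (S : Strategies 𝒰 𝒜 ℬ 𝒳₁ 𝒳₂ 𝒴 T₁ T₂ Z)

/-- The state and the channel inputs of a block. -/
def block (d : 𝒜 × ℬ) (σ : Seed 𝒰 T₁ T₂ Z) : State 𝒰 𝒜 ℬ 𝒴 × 𝒳₁ × 𝒳₂ :=
  (S.state d σ, S.inp₁ σ.2.1 σ.1 d.1, S.inp₂ σ.2.2.1 σ.1 d.2)

/-- The states and the channel inputs of the first two blocks of a window. -/
def sample (w : Window 𝒰 𝒜 ℬ T₁ T₂ Z) : Sample 𝒰 𝒜 ℬ 𝒳₁ 𝒳₂ 𝒴 :=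
  (S.block w.1 w.2.1, S.block (S.next w.1 w.2.1) w.2.2.1)

end Strategies

/-- Replace the noise of the second block of a window. -/
def setNoise (w : Window 𝒰 𝒜 ℬ T₁ T₂ Z) (z : Z) : Window 𝒰 𝒜 ℬ T₁ T₂ Z :=
  (w.1, w.2.1, (w.2.2.1.1, w.2.2.1.2.1, w.2.2.1.2.2.1, z), w.2.2.2)

/-! ### Variables of two blocks determined by strategies and states -/

section Determination

variable {S : Strategies 𝒰 𝒜 ℬ 𝒳₁ 𝒳₂ 𝒴 T₁ T₂ Z} {w w' : Window 𝒰 𝒜 ℬ T₁ T₂ Z}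

/-- `Ã` -/
def At (ω : Sample 𝒰 𝒜 ℬ 𝒳₁ 𝒳₂ 𝒴) : 𝒜 := ω.1.1.2.1

/-- `B̃` -/
def Bt (ω : Sample 𝒰 𝒜 ℬ 𝒳₁ 𝒳₂ 𝒴) : ℬ := ω.1.1.2.2.1

theorem St_eq_iff (ω ω' : Sample 𝒰 𝒜 ℬ 𝒳₁ 𝒳₂ 𝒴) :
    St ω = St ω' ↔ Ut ω = Ut ω' ∧ At ω = At ω' ∧ Bt ω = Bt ω' ∧ Yt ω = Yt ω' := by
  rw [Prod.ext_iff, Prod.ext_iff, Prod.ext_iff]; rfl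

theorem St_eq_iff' (ω ω' : Sample 𝒰 𝒜 ℬ 𝒳₁ 𝒳₂ 𝒴) :
    St ω = St ω' ↔ Ut ω = Ut ω' ∧ Bt ω = Bt ω' ∧ At ω = At ω' ∧ Yt ω = Yt ω' := by
  rw [St_eq_iff]; tauto

theorem X₁t_eq (h : w.2.1.2.1 = w'.2.1.2.1) (hu : Ut (S.sample w) = Ut (S.sample w'))
    (ha : At (S.sample w) = At (S.sample w')) : X₁t (S.sample w) = X₁t (S.sample w') := by
  change S.inp₁ w.2.1.2.1 (Ut (S.sample w)) (At (S.sample w)) =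
    S.inp₁ w'.2.1.2.1 (Ut (S.sample w')) (At (S.sample w'))
  rw [h, hu, ha]

theorem X₂t_eq (h : w.2.1.2.2.1 = w'.2.1.2.2.1) (hu : Ut (S.sample w) = Ut (S.sample w'))
    (hb : Bt (S.sample w) = Bt (S.sample w')) : X₂t (S.sample w) = X₂t (S.sample w') := by
  change S.inp₂ w.2.1.2.2.1 (Ut (S.sample w)) (Bt (S.sample w)) =
    S.inp₂ w'.2.1.2.2.1 (Ut (S.sample w')) (Bt (S.sample w'))
  rw [h, hu, hb]

theorem A_eq (h : w.2.1.2.1 = w'.2.1.2.1) (hs : St (S.sample w) = St (S.sample w')) :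
    A (S.sample w) = A (S.sample w') := by
  change S.upd₁ w.2.1.2.1 (St (S.sample w)) = S.upd₁ w'.2.1.2.1 (St (S.sample w'))
  rw [h, hs]

theorem B_eq (h : w.2.1.2.2.1 = w'.2.1.2.2.1) (hs : St (S.sample w) = St (S.sample w')) :
    B (S.sample w) = B (S.sample w') := by
  change S.upd₂ w.2.1.2.2.1 (St (S.sample w)) = S.upd₂ w'.2.1.2.2.1 (St (S.sample w'))
  rw [h, hs]

end Determination

variable [Fintype 𝒰] [Fintype 𝒜] [Fintype ℬ] [Fintype T₁] [Fintype T₂] [Fintype Z]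
  {Λ : Laws 𝒰 𝒜 ℬ T₁ T₂ Z} {S : Strategies 𝒰 𝒜 ℬ 𝒳₁ 𝒳₂ 𝒴 T₁ T₂ Z}

theorem Laws.expect_window_eq (F : 𝒜 × ℬ → Seed 𝒰 T₁ T₂ Z → Seed 𝒰 T₁ T₂ Z → ℝ) :
    expect Λ.window (fun w => F w.1 w.2.1 w.2.2.1) =
      expect Λ.d.1 fun d => expect Λ.seed fun σ => expect Λ.seed fun σ' => F d σ σ' := by
  simp only [Laws.window, expect_prodLaw, expect_const Λ.seed_mem]

/-- Once the first seed is integrated out, the private letters of the second block have the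
stationary law again. -/
theorem Laws.Stationary.expect_window_shift (hS : Λ.Stationary S)
    (F : 𝒜 × ℬ → Seed 𝒰 T₁ T₂ Z → Seed 𝒰 T₁ T₂ Z → ℝ) :
    expect Λ.window (fun w => F (S.next w.1 w.2.1) w.2.2.1 w.2.2.2) =
      expect Λ.window fun w => F w.1 w.2.1 w.2.2.1 := by
  rw [Laws.expect_window_eq]
  simp only [Laws.window, expect_prodLaw]
  exact hS fun d => expect Λ.seed fun σ => expect Λ.seed fun σ' => F d σ σ'

theorem Laws.Stationary.expect_block (hS : Λ.Stationary S) (f : State 𝒰 𝒜 ℬ 𝒴 × 𝒳₁ × 𝒳₂ → ℝ) :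
    expect Λ.window (fun w => f (S.sample w).2) = expect Λ.window fun w => f (S.sample w).1 := by
  refine (Laws.expect_window_eq fun d σ σ' => f (S.block (S.next d σ) σ')).trans
    (Eq.trans ?_ (Laws.expect_window_eq fun d σ σ' => f (S.block d σ)).symm)
  rw [hS fun d => expect Λ.seed fun σ' => f (S.block d σ')]
  simp only [expect_const Λ.seed_mem]

theorem Laws.Stationary.entropy_block (hS : Λ.Stationary S) {α : Type*} [Fintype α]
    (f : State 𝒰 𝒜 ℬ 𝒴 × 𝒳₁ × 𝒳₂ → α) :
    entropy Λ.window (fun w => f (S.sample w).1) = entropy Λ.window fun w => f (S.sample w).2 := by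
  simp only [entropy, prob_eq_expect]
  simp only [fun a => hS.expect_block fun x => ind (f x = a)]

theorem Laws.Stationary.condEntropy_block (hS : Λ.Stationary S) {α β : Type*} [Fintype α]
    [Fintype β] (f : State 𝒰 𝒜 ℬ 𝒴 × 𝒳₁ × 𝒳₂ → α) (g : State 𝒰 𝒜 ℬ 𝒴 × 𝒳₁ × 𝒳₂ → β) :
    condEntropy Λ.window (fun w => f (S.sample w).1) (fun w => g (S.sample w).1) =
      condEntropy Λ.window (fun w => f (S.sample w).2) fun w => g (S.sample w).2 := by
  rw [condEntropy, condEntropy, hS.entropy_block g, hS.entropy_block fun x => (f x, g x)]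

theorem Laws.expect_window_setNoise (F : Window 𝒰 𝒜 ℬ T₁ T₂ Z → ℝ) :
    expect Λ.window F = expect Λ.window fun w => expect Λ.z.1 fun z => F (setNoise w z) := by
  simp only [Laws.window, Laws.seed, expect_prodLaw, setNoise, expect_const Λ.z.2]
  refine expect_congr fun d => ?_
  refine expect_congr fun u => expect_congr fun t₁ => expect_congr fun t₂ => expect_congr fun z => ?_
  refine expect_congr fun u' => expect_congr fun t₁' => expect_congr fun t₂' => ?_
  rw [expect_comm]
  refine expect_congr fun u'' => ?_
  rw [expect_comm]
  refine expect_congr fun t₁'' => ?_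
  rw [expect_comm]
  refine expect_congr fun t₂'' => ?_
  rw [expect_comm]

/-- The entropy of the output in the second block, given the inputs and anything else that does not
depend on the noise in that block. -/
theorem condEntropy_output [Fintype 𝒴] {W : 𝒳₁ → 𝒳₂ → stdSimplex ℝ 𝒴}
    (hW : ∀ x₁ x₂ y, expect Λ.z.1 (fun z => ind (S.chan z x₁ x₂ = y)) = W x₁ x₂ y)
    {γ : Type*} [Fintype γ] (g : Window 𝒰 𝒜 ℬ T₁ T₂ Z → γ) (hg : ∀ w z, g (setNoise w z) = g w)
    (hx : ∀ w w', g w = g w' → X₁ (S.sample w) = X₁ (S.sample w') ∧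
      X₂ (S.sample w) = X₂ (S.sample w')) :
    condEntropy Λ.window (fun w => Y (S.sample w)) g = -expect Λ.window fun w =>
      Real.logb 2 (W (X₁ (S.sample w)) (X₂ (S.sample w)) (Y (S.sample w))) := by
  refine condEntropy_eq_of_kernel Λ.window_mem _ _ _ fun w => ?_
  rw [prob_eq_expect, prob_eq_expect, Laws.expect_window_setNoise, ← expect_mul_right]
  refine expect_congr fun w' => ?_
  rw [← hW, ← expect_mul_left]
  refine expect_congr fun z => ?_
  rw [hg]
  by_cases h : g w' = g w
  · obtain ⟨h1, h2⟩ := hx _ _ h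
    rw [ind_of h, one_mul, ← h1, ← h2]
    simp only [Prod.mk.injEq, h, and_true]
    rfl
  · rw [ind_of_not h, zero_mul, ind_of_not]; simp [h]

theorem expect_ind_eq {α : Type*} [Fintype α] (p : α → ℝ) (a : α) :
    expect p (fun x => ind (x = a)) = p a := by
  rw [expect, Finset.sum_eq_single a]
  · rw [ind_of rfl, mul_one]
  · intro b _ hb; rw [ind_of_not hb, mul_zero]
  · exact fun ha => absurd (Finset.mem_univ a) ha

theorem prob_eq_of_expect {Ω α : Type*} [Fintype Ω] [Fintype α] {p : Ω → ℝ} {f : Ω → α}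
    {q : α → ℝ} (h : ∀ g : α → ℝ, expect p (fun ω => g (f ω)) = expect q g) : prob p f = q := by
  ext a
  rw [prob_eq_expect, h fun x => ind (x = a), expect_ind_eq]

theorem Laws.expect_window_t₁ (g : T₁ → ℝ) :
    expect Λ.window (fun w => g w.2.1.2.1) = expect Λ.t₁.1 g := by
  simp only [Laws.window, Laws.seed, expect_prodLaw, expect_const Λ.z.2, expect_const Λ.t₁.2,
    expect_const Λ.t₂.2, expect_const Λ.u.2, expect_const Λ.d.2]

theorem Laws.expect_window_t₂ (g : T₂ → ℝ) :
    expect Λ.window (fun w => g w.2.1.2.2.1) = expect Λ.t₂.1 g := by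
  simp only [Laws.window, Laws.seed, expect_prodLaw, expect_const Λ.z.2, expect_const Λ.t₁.2,
    expect_const Λ.t₂.2, expect_const Λ.u.2, expect_const Λ.d.2]

theorem Laws.expect_window_t₁_t₂ (g : T₁ × T₂ → ℝ) :
    expect Λ.window (fun w => g (w.2.1.2.1, w.2.1.2.2.1)) =
      expect Λ.t₁.1 fun t => expect Λ.t₂.1 fun t' => g (t, t') := by
  simp only [Laws.window, Laws.seed, expect_prodLaw, expect_const Λ.z.2, expect_const Λ.t₁.2,
    expect_const Λ.t₂.2, expect_const Λ.u.2, expect_const Λ.d.2]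

theorem Laws.expect_window_u (g : 𝒰 → ℝ) :
    expect Λ.window (fun w => g w.2.2.1.1) = expect Λ.u.1 g := by
  simp only [Laws.window, Laws.seed, expect_prodLaw, expect_const Λ.z.2, expect_const Λ.t₁.2,
    expect_const Λ.t₂.2, expect_const Λ.u.2, expect_const Λ.d.2]

theorem condMutualInfo_prob {Ω Ω' α β γ : Type*} [Fintype Ω] [Fintype Ω'] [Fintype α] [Fintype β]
    [Fintype γ] (p : Ω → ℝ) (φ : Ω → Ω') (f : Ω' → α) (g : Ω' → β) (h : Ω' → γ) :
    condMutualInfo (prob p φ) f g h =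
      condMutualInfo p (fun ω => f (φ ω)) (fun ω => g (φ ω)) fun ω => h (φ ω) := by
  simp only [condMutualInfo, condEntropy, entropy_prob]

/-! ### Single-letter lower bounds for the information in a window -/

section Bounds

variable [Fintype 𝒴] {W : 𝒳₁ → 𝒳₂ → stdSimplex ℝ 𝒴}

theorem condEntropy_output_congr
    (hW : ∀ x₁ x₂ y, expect Λ.z.1 (fun z => ind (S.chan z x₁ x₂ = y)) = W x₁ x₂ y)
    {γ δ : Type*} [Fintype γ] [Fintype δ] (g : Window 𝒰 𝒜 ℬ T₁ T₂ Z → γ)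
    (h : Window 𝒰 𝒜 ℬ T₁ T₂ Z → δ) (hg : ∀ w z, g (setNoise w z) = g w)
    (hh : ∀ w z, h (setNoise w z) = h w)
    (hgx : ∀ w w', g w = g w' → X₁ (S.sample w) = X₁ (S.sample w') ∧
      X₂ (S.sample w) = X₂ (S.sample w'))
    (hhx : ∀ w w', h w = h w' → X₁ (S.sample w) = X₁ (S.sample w') ∧
      X₂ (S.sample w) = X₂ (S.sample w')) :
    condEntropy Λ.window (fun w => Y (S.sample w)) g =
      condEntropy Λ.window (fun w => Y (S.sample w)) h := by
  rw [condEntropy_output hW g hg hgx, condEntropy_output hW h hh hhx]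

variable [Fintype 𝒳₁] [Fintype 𝒳₂]

theorem condMutualInfo_le_encoder₂
    (hW : ∀ x₁ x₂ y, expect Λ.z.1 (fun z => ind (S.chan z x₁ x₂ = y)) = W x₁ x₂ y)
    (hS : Λ.Stationary S) :
    condMutualInfo Λ.window (fun w => X₁ (S.sample w)) (fun w => Y (S.sample w)) (fun w =>
      (X₂ (S.sample w), B (S.sample w), U (S.sample w), St (S.sample w), X₂t (S.sample w))) ≤
    mutualInfo Λ.window (fun w => w.2.1.2.1) fun w => (Y (S.sample w),
      (U (S.sample w), B (S.sample w), X₂ (S.sample w)), Yt (S.sample w),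
      (Ut (S.sample w), At (S.sample w), Bt (S.sample w), X₂t (S.sample w))) :=
  le_mutualInfo_encoder (a := fun w => A (S.sample w)) (x₁t := fun w => X₁t (S.sample w))
    Λ.window_mem (fun _ _ => St_eq_iff _ _) (fun _ _ => X₁t_eq) (fun _ _ => A_eq)
    (hS.condEntropy_block (fun x => x.1.2.2.2) fun x => (x.1.1, x.1.2.1, x.1.2.2.1, x.2.2))
    (hS.condEntropy_block (fun x => x.1.2.2.2) fun x => (x.2.1, x.2.2))
    (condEntropy_output_congr hW _ _ (fun _ _ => rfl) (fun _ _ => rfl)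
      (fun w w' => by simp only [Prod.mk.injEq]; tauto)
      (fun w w' => by simp only [Prod.mk.injEq]; tauto)).le

theorem condMutualInfo_le_encoder₁
    (hW : ∀ x₁ x₂ y, expect Λ.z.1 (fun z => ind (S.chan z x₁ x₂ = y)) = W x₁ x₂ y)
    (hS : Λ.Stationary S) :
    condMutualInfo Λ.window (fun w => X₂ (S.sample w)) (fun w => Y (S.sample w)) (fun w =>
      (X₁ (S.sample w), A (S.sample w), U (S.sample w), St (S.sample w), X₁t (S.sample w))) ≤
    mutualInfo Λ.window (fun w => w.2.1.2.2.1) fun w => (Y (S.sample w),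
      (U (S.sample w), A (S.sample w), X₁ (S.sample w)), Yt (S.sample w),
      (Ut (S.sample w), Bt (S.sample w), At (S.sample w), X₁t (S.sample w))) :=
  le_mutualInfo_encoder (a := fun w => B (S.sample w)) (x₁t := fun w => X₂t (S.sample w))
    Λ.window_mem (fun _ _ => St_eq_iff' _ _) (fun _ _ => X₂t_eq) (fun _ _ => B_eq)
    (hS.condEntropy_block (fun x => x.1.2.2.2) fun x => (x.1.1, x.1.2.2.1, x.1.2.1, x.2.1))
    (hS.condEntropy_block (fun x => x.1.2.2.2) fun x => (x.2.2, x.2.1))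
    (condEntropy_output_congr hW _ _ (fun _ _ => rfl) (fun _ _ => rfl)
      (fun w w' => by simp only [Prod.mk.injEq]; tauto)
      (fun w w' => by simp only [Prod.mk.injEq]; tauto)).le

theorem condMutualInfo_le_decoder₁
    (hW : ∀ x₁ x₂ y, expect Λ.z.1 (fun z => ind (S.chan z x₁ x₂ = y)) = W x₁ x₂ y)
    (hS : Λ.Stationary S) :
    condMutualInfo Λ.window (fun w => X₁ (S.sample w)) (fun w => Y (S.sample w)) (fun w =>
      (X₂ (S.sample w), B (S.sample w), U (S.sample w), St (S.sample w), X₂t (S.sample w))) -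
    condMutualInfo Λ.window (fun w => A (S.sample w)) (fun w => X₂ (S.sample w)) (fun w =>
      (Y (S.sample w), B (S.sample w), U (S.sample w), St (S.sample w), X₂t (S.sample w))) ≤
    mutualInfo Λ.window (fun w => w.2.1.2.1) fun w => (Y (S.sample w),
      (U (S.sample w), B (S.sample w)), Yt (S.sample w),
      (Ut (S.sample w), At (S.sample w), Bt (S.sample w), X₂t (S.sample w))) :=
  le_mutualInfo_decoder (a := fun w => A (S.sample w)) (x₁t := fun w => X₁t (S.sample w))
    Λ.window_mem (fun _ _ => St_eq_iff _ _) (fun _ _ => X₁t_eq) (fun _ _ => A_eq)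
    (hS.condEntropy_block (fun x => x.1.2.2.2) fun x => (x.1.1, x.1.2.1, x.1.2.2.1, x.2.2))
    (hS.condEntropy_block (fun x => x.1.2.2.2) fun x => (x.2.1, x.2.2))
    (condEntropy_output_congr hW _ _ (fun _ _ => rfl) (fun _ _ => rfl)
      (fun w w' => by simp only [Prod.mk.injEq]; tauto)
      (fun w w' => by simp only [Prod.mk.injEq]; tauto)).le

theorem condMutualInfo_le_decoder₂
    (hW : ∀ x₁ x₂ y, expect Λ.z.1 (fun z => ind (S.chan z x₁ x₂ = y)) = W x₁ x₂ y)
    (hS : Λ.Stationary S) :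
    condMutualInfo Λ.window (fun w => X₂ (S.sample w)) (fun w => Y (S.sample w)) (fun w =>
      (X₁ (S.sample w), A (S.sample w), U (S.sample w), St (S.sample w), X₁t (S.sample w))) -
    condMutualInfo Λ.window (fun w => B (S.sample w)) (fun w => X₁ (S.sample w)) (fun w =>
      (Y (S.sample w), A (S.sample w), U (S.sample w), St (S.sample w), X₁t (S.sample w))) ≤
    mutualInfo Λ.window (fun w => w.2.1.2.2.1) fun w => (Y (S.sample w),
      (U (S.sample w), A (S.sample w)), Yt (S.sample w),
      (Ut (S.sample w), Bt (S.sample w), At (S.sample w), X₁t (S.sample w))) :=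
  le_mutualInfo_decoder (a := fun w => B (S.sample w)) (x₁t := fun w => X₂t (S.sample w))
    Λ.window_mem (fun _ _ => St_eq_iff' _ _) (fun _ _ => X₂t_eq) (fun _ _ => B_eq)
    (hS.condEntropy_block (fun x => x.1.2.2.2) fun x => (x.1.1, x.1.2.2.1, x.1.2.1, x.2.1))
    (hS.condEntropy_block (fun x => x.1.2.2.2) fun x => (x.2.2, x.2.1))
    (condEntropy_output_congr hW _ _ (fun _ _ => rfl) (fun _ _ => rfl)
      (fun w w' => by simp only [Prod.mk.injEq]; tauto)
      (fun w w' => by simp only [Prod.mk.injEq]; tauto)).le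

theorem condMutualInfo_le_decoder₀
    (hW : ∀ x₁ x₂ y, expect Λ.z.1 (fun z => ind (S.chan z x₁ x₂ = y)) = W x₁ x₂ y)
    (hS : Λ.Stationary S) :
    condMutualInfo Λ.window (fun w => (X₁ (S.sample w), X₂ (S.sample w))) (fun w => Y (S.sample w))
      (fun w => (U (S.sample w), St (S.sample w))) ≤
    mutualInfo Λ.window (fun w => (w.2.1.2.1, w.2.1.2.2.1)) fun w => (Y (S.sample w),
      U (S.sample w), Yt (S.sample w),
      (Ut (S.sample w), At (S.sample w), Bt (S.sample w))) :=
  le_mutualInfo_decoder_both (a := fun w => A (S.sample w)) (b := fun w => B (S.sample w))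
    (x₁t := fun w => X₁t (S.sample w)) (x₂t := fun w => X₂t (S.sample w))
    Λ.window_mem (fun _ _ => St_eq_iff _ _) (fun _ _ h => X₁t_eq (Prod.ext_iff.1 h).1)
    (fun _ _ h => X₂t_eq (Prod.ext_iff.1 h).2) (fun _ _ h => A_eq (Prod.ext_iff.1 h).1)
    (fun _ _ h => B_eq (Prod.ext_iff.1 h).2)
    (hS.condEntropy_block (fun x => x.1.2.2.2) fun x => (x.1.1, x.1.2.1, x.1.2.2.1))
    (hS.condEntropy_block (fun x => x.1.2.2.2) fun x => (x.2.1, x.2.2))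
    (condEntropy_output_congr hW _ _ (fun _ _ => rfl) (fun _ _ => rfl)
      (fun w w' => by simp only [Prod.mk.injEq]; tauto)
      (fun w w' => by simp only [Prod.mk.injEq]; tauto)).le

end Bounds

end TwoBlocks

/-! ### From single-letter informations to achievable rates -/

section AchievableOfWindow

variable {𝒰 𝒜 ℬ 𝒳₁ 𝒳₂ 𝒴 T₁ T₂ Z : Type*}

/-- The tests given by likelihood ratios of strategies (or common letters) and observations. -/
def Strategies.tests (S : Strategies 𝒰 𝒜 ℬ 𝒳₁ 𝒳₂ 𝒴 T₁ T₂ Z)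
    (rE₁ : T₂ → 𝒴 × (𝒰 × 𝒜 × 𝒳₁) × 𝒴 × 𝒰 × ℬ × 𝒜 × 𝒳₁ → ℝ)
    (rE₂ : T₁ → 𝒴 × (𝒰 × ℬ × 𝒳₂) × 𝒴 × 𝒰 × 𝒜 × ℬ × 𝒳₂ → ℝ)
    (rD₁ : T₁ → 𝒴 × (𝒰 × ℬ) × 𝒴 × 𝒰 × 𝒜 × ℬ × 𝒳₂ → ℝ)
    (rD₂ : T₂ → 𝒴 × (𝒰 × 𝒜) × 𝒴 × 𝒰 × ℬ × 𝒜 × 𝒳₁ → ℝ)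
    (rD₀ : T₁ × T₂ → 𝒴 × 𝒰 × 𝒴 × 𝒰 × 𝒜 × ℬ → ℝ)
    (rU : 𝒰 → 𝒴 × 𝒰 × 𝒴 → ℝ) : Tests 𝒰 𝒜 ℬ 𝒴 T₁ T₂ where
  e₁ t s t₁ t₁' u y := rE₁ t (y, (u, S.upd₁ t₁ s, S.inp₁ t₁' u (S.upd₁ t₁ s)), s.2.2.2,
    (s.1, s.2.2.1, s.2.1, S.inp₁ t₁ s.1 s.2.1))
  e₂ t s t₂ t₂' u y := rE₂ t (y, (u, S.upd₂ t₂ s, S.inp₂ t₂' u (S.upd₂ t₂ s)), s.2.2.2,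
    (s.1, s.2.1, s.2.2.1, S.inp₂ t₂ s.1 s.2.2.1))
  d₁ t s t₂ u y := rD₁ t (y, (u, S.upd₂ t₂ s), s.2.2.2,
    (s.1, s.2.1, s.2.2.1, S.inp₂ t₂ s.1 s.2.2.1))
  d₂ t s t₁ u y := rD₂ t (y, (u, S.upd₁ t₁ s), s.2.2.2,
    (s.1, s.2.2.1, s.2.1, S.inp₁ t₁ s.1 s.2.1))
  d₀ t t' s u y := rD₀ (t, t') (y, u, s.2.2.2, (s.1, s.2.1, s.2.2.1))
  h u u' y y' := rU u (y', u', y)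

variable [Fintype 𝒰] [Fintype 𝒜] [Fintype ℬ] [Fintype T₁] [Fintype T₂] [Fintype Z]
  {Λ : Laws 𝒰 𝒜 ℬ T₁ T₂ Z} {S : Strategies 𝒰 𝒜 ℬ 𝒳₁ 𝒳₂ 𝒴 T₁ T₂ Z}

theorem Laws.exists_window_test {τ υ : Type*} [Fintype τ] [Fintype υ] {δ : ℝ} (hδ : 0 < δ)
    (T : Window 𝒰 𝒜 ℬ T₁ T₂ Z → τ) (V : Window 𝒰 𝒜 ℬ T₁ T₂ Z → υ) :
    ∃ r : τ → υ → ℝ, (∀ t v, 0 < r t v) ∧ (∀ v, expect Λ.window (fun w => r (T w) v) ≤ 1) ∧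
      mutualInfo Λ.window T V - δ ≤ Λ.gain fun w => r (T w) (V w) := by
  obtain ⟨r, h1, h2, h3⟩ := exists_test Λ.window_mem T V hδ
  refine ⟨r, h1, fun v => ?_, h3⟩
  have := h2 v
  rwa [expect_prob] at this

theorem Laws.gain_mul {f g : Window 𝒰 𝒜 ℬ T₁ T₂ Z → ℝ} (hf : ∀ w, 0 < f w) (hg : ∀ w, 0 < g w) :
    Λ.gain (fun w => f w * g w) = Λ.gain f + Λ.gain g := by
  rw [Laws.gain, Laws.gain, Laws.gain, ← expect_add]
  exact expect_congr fun w => Real.logb_mul (hf w).ne' (hg w).ne'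

/-- The common letter is tested on the second and third blocks of a window, whereas the informations
refer to the first and second; stationarity permits the shift. -/
theorem Laws.Stationary.gain_valU (hS : Λ.Stationary S) (𝒯 : Tests 𝒰 𝒜 ℬ 𝒴 T₁ T₂) :
    Λ.gain (fun w => S.valU 𝒯 w.2.2.2.1 w) = Λ.gain fun w => 𝒯.h (U (S.sample w)) (Ut (S.sample w))
      (Yt (S.sample w)) (Y (S.sample w)) :=
  hS.expect_window_shift fun d σ σ' =>
    Real.logb 2 (𝒯.h σ'.1 σ.1 (S.out d σ) (S.out (S.next d σ) σ'))

theorem Thresholds.Below.mono {γ γ' : Thresholds} {𝒯 : Tests 𝒰 𝒜 ℬ 𝒴 T₁ T₂} (h : γ.Below Λ S 𝒯)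
    (h₁ : γ'.e₁ ≤ γ.e₁) (h₂ : γ'.e₂ ≤ γ.e₂) (h₃ : γ'.d₁ ≤ γ.d₁) (h₄ : γ'.d₂ ≤ γ.d₂)
    (h₅ : γ'.d₀ ≤ γ.d₀) : γ'.Below Λ S 𝒯 :=
  ⟨h₁.trans_lt h.1, h₂.trans_lt h.2, h₃.trans_lt h.3, h₄.trans_lt h.4, h₅.trans_lt h.5⟩

variable [Fintype 𝒳₁] [Fintype 𝒳₂] [Fintype 𝒴] {W : 𝒳₁ → 𝒳₂ → stdSimplex ℝ 𝒴}

theorem Laws.Stationary.exists_tests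
    (hW : ∀ x₁ x₂ y, expect Λ.z.1 (fun z => ind (S.chan z x₁ x₂ = y)) = W x₁ x₂ y)
    (hS : Λ.Stationary S) {δ : ℝ} (hδ : 0 < δ) {i₁ i₂ j₁ j₂ k u : ℝ}
    (hi₁ : i₁ ≤ condMutualInfo Λ.window (fun w => X₁ (S.sample w)) (fun w => Y (S.sample w))
      fun w => (X₂ (S.sample w), B (S.sample w), U (S.sample w), St (S.sample w), X₂t (S.sample w)))
    (hi₂ : i₂ ≤ condMutualInfo Λ.window (fun w => X₂ (S.sample w)) (fun w => Y (S.sample w))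
      fun w => (X₁ (S.sample w), A (S.sample w), U (S.sample w), St (S.sample w), X₁t (S.sample w)))
    (hj₁ : j₁ ≤ condMutualInfo Λ.window (fun w => X₁ (S.sample w)) (fun w => Y (S.sample w))
        (fun w =>
          (X₂ (S.sample w), B (S.sample w), U (S.sample w), St (S.sample w), X₂t (S.sample w))) -
      condMutualInfo Λ.window (fun w => A (S.sample w)) (fun w => X₂ (S.sample w)) fun w =>
        (Y (S.sample w), B (S.sample w), U (S.sample w), St (S.sample w), X₂t (S.sample w)))
    (hj₂ : j₂ ≤ condMutualInfo Λ.window (fun w => X₂ (S.sample w)) (fun w => Y (S.sample w))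
        (fun w =>
          (X₁ (S.sample w), A (S.sample w), U (S.sample w), St (S.sample w), X₁t (S.sample w))) -
      condMutualInfo Λ.window (fun w => B (S.sample w)) (fun w => X₁ (S.sample w)) fun w =>
        (Y (S.sample w), A (S.sample w), U (S.sample w), St (S.sample w), X₁t (S.sample w)))
    (hk : k ≤ condMutualInfo Λ.window (fun w => (X₁ (S.sample w), X₂ (S.sample w)))
      (fun w => Y (S.sample w)) fun w => (U (S.sample w), St (S.sample w)))
    (hu : u = condMutualInfo Λ.window (fun w => U (S.sample w)) (fun w => Y (S.sample w))
      fun w => (Ut (S.sample w), Yt (S.sample w))) :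
    ∃ 𝒯 : Tests 𝒰 𝒜 ℬ 𝒴 T₁ T₂, 𝒯.Valid Λ ∧
      Thresholds.Below ⟨i₂ - δ, i₁ - δ, j₁ + u - δ, j₂ + u - δ, k + u - δ⟩ Λ S 𝒯 := by
  -- Each likelihood ratio loses `δ / 3`; the decoder multiplies two of them, so the loss stays
  -- strictly below `δ`.
  have hε : 0 < δ / 3 := by positivity
  obtain ⟨rE₁, pE₁, lE₁, gE₁⟩ := Λ.exists_window_test hε (fun w => w.2.1.2.2.1) fun w =>
    (Y (S.sample w), (U (S.sample w), A (S.sample w), X₁ (S.sample w)), Yt (S.sample w),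
      (Ut (S.sample w), Bt (S.sample w), At (S.sample w), X₁t (S.sample w)))
  obtain ⟨rE₂, pE₂, lE₂, gE₂⟩ := Λ.exists_window_test hε (fun w => w.2.1.2.1) fun w =>
    (Y (S.sample w), (U (S.sample w), B (S.sample w), X₂ (S.sample w)), Yt (S.sample w),
      (Ut (S.sample w), At (S.sample w), Bt (S.sample w), X₂t (S.sample w)))
  obtain ⟨rD₁, pD₁, lD₁, gD₁⟩ := Λ.exists_window_test hε (fun w => w.2.1.2.1) fun w =>
    (Y (S.sample w), (U (S.sample w), B (S.sample w)), Yt (S.sample w),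
      (Ut (S.sample w), At (S.sample w), Bt (S.sample w), X₂t (S.sample w)))
  obtain ⟨rD₂, pD₂, lD₂, gD₂⟩ := Λ.exists_window_test hε (fun w => w.2.1.2.2.1) fun w =>
    (Y (S.sample w), (U (S.sample w), A (S.sample w)), Yt (S.sample w),
      (Ut (S.sample w), Bt (S.sample w), At (S.sample w), X₁t (S.sample w)))
  obtain ⟨rD₀, pD₀, lD₀, gD₀⟩ := Λ.exists_window_test hε (fun w => (w.2.1.2.1, w.2.1.2.2.1))
    fun w => (Y (S.sample w), U (S.sample w), Yt (S.sample w),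
      (Ut (S.sample w), At (S.sample w), Bt (S.sample w)))
  obtain ⟨rU, pU, lU, gU⟩ := Λ.exists_window_test hε (fun w => w.2.2.1.1) fun w =>
    (Y (S.sample w), Ut (S.sample w), Yt (S.sample w))
  have hcommon := le_mutualInfo_common Λ.window_mem (fun w => U (S.sample w))
    (fun w => Y (S.sample w)) fun w => (Ut (S.sample w), Yt (S.sample w))
  have hE₁ := condMutualInfo_le_encoder₁ hW hS
  have hE₂ := condMutualInfo_le_encoder₂ hW hS
  have hD₁ := condMutualInfo_le_decoder₁ hW hS
  have hD₂ := condMutualInfo_le_decoder₂ hW hS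
  have hD₀ := condMutualInfo_le_decoder₀ hW hS
  let 𝒯 := S.tests rE₁ rE₂ rD₁ rD₂ rD₀ rU
  have hgU := gU.trans_eq (hS.gain_valU 𝒯).symm
  refine ⟨𝒯,
    ⟨fun _ _ _ _ _ _ => pE₁ _ _, fun _ _ _ _ _ _ => pE₂ _ _, fun _ _ _ _ _ => pD₁ _ _,
      fun _ _ _ _ _ => pD₂ _ _, fun _ _ _ _ _ => pD₀ _ _, fun _ _ _ _ => pU _ _,
      fun s t t' u y => ?_, fun s t t' u y => ?_, fun s t u y => ?_, fun s t u y => ?_,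
      fun s u y => ?_, fun u y y' => ?_⟩, ?_, ?_, ?_, ?_, ?_⟩
  · exact (Laws.expect_window_t₂ _).symm.trans_le (lE₁ _)
  · exact (Laws.expect_window_t₁ _).symm.trans_le (lE₂ _)
  · exact (Laws.expect_window_t₁ _).symm.trans_le (lD₁ _)
  · exact (Laws.expect_window_t₂ _).symm.trans_le (lD₂ _)
  · exact (Laws.expect_window_t₁_t₂ fun t => rD₀ t _).symm.trans_le (lD₀ _)
  · exact (Laws.expect_window_u _).symm.trans_le (lU _)
  · refine lt_of_lt_of_le ?_ gE₁
    change i₂ - δ < _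
    linarith
  · refine lt_of_lt_of_le ?_ gE₂
    change i₁ - δ < _
    linarith
  · refine lt_of_lt_of_eq ?_ (Laws.gain_mul (f := fun w => S.valD₁ 𝒯 w.2.1.2.1 w)
      (g := fun w => S.valU 𝒯 w.2.2.2.1 w) (fun _ => pD₁ _ _) fun _ => pU _ _).symm
    refine lt_of_lt_of_le ?_ (add_le_add gD₁ hgU)
    change j₁ + u - δ < _
    change _ ≤ mutualInfo Λ.window (fun w => w.2.2.1.1) _ at hcommon
    linarith
  · refine lt_of_lt_of_eq ?_ (Laws.gain_mul (f := fun w => S.valD₂ 𝒯 w.2.1.2.2.1 w)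
      (g := fun w => S.valU 𝒯 w.2.2.2.1 w) (fun _ => pD₂ _ _) fun _ => pU _ _).symm
    refine lt_of_lt_of_le ?_ (add_le_add gD₂ hgU)
    change j₂ + u - δ < _
    change _ ≤ mutualInfo Λ.window (fun w => w.2.2.1.1) _ at hcommon
    linarith
  · refine lt_of_lt_of_eq ?_ (Laws.gain_mul (f := fun w => S.valD₀ 𝒯 w.2.1.2.1 w.2.1.2.2.1 w)
      (g := fun w => S.valU 𝒯 w.2.2.2.1 w) (fun _ => pD₀ _ _) fun _ => pU _ _).symm
    refine lt_of_lt_of_le ?_ (add_le_add gD₀ hgU)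
    change k + u - δ < _
    change _ ≤ mutualInfo Λ.window (fun w => w.2.2.1.1) _ at hcommon
    linarith

theorem achievable_of_window
    (hW : ∀ x₁ x₂ y, expect Λ.z.1 (fun z => ind (S.chan z x₁ x₂ = y)) = W x₁ x₂ y)
    (hS : Λ.Stationary S) {P : InputLaw 𝒰 𝒜 ℬ 𝒳₁ 𝒳₂} {QA : State 𝒰 𝒜 ℬ 𝒴 → 𝒳₁ → stdSimplex ℝ 𝒜}
    {QB : State 𝒰 𝒜 ℬ 𝒴 → 𝒳₂ → stdSimplex ℝ ℬ} (hq : prob Λ.window S.sample = jointLaw P W QA QB) :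
    rateRegion P W QA QB ⊆ capacityRegion W := by
  rintro ⟨R₁, R₂⟩ ⟨h₁, h₂, h₀⟩
  rw [← hq] at h₁ h₂ h₀
  simp only [condMutualInfo_prob] at h₁ h₂ h₀
  refine achievable_of_tests hW hS fun δ hδ => ?_
  obtain ⟨𝒯, hv, hb⟩ := hS.exists_tests hW hδ le_rfl le_rfl le_rfl le_rfl le_rfl rfl
  -- The positive part encodes two constraints: `r ≤ e` is what the other encoder needs, `r ≤ e - f
  -- + u` what the decoder needs.
  have le_aux : ∀ {r e f u : ℝ}, r ≤ e - max 0 (f - u) → r ≤ e ∧ r ≤ e - f + u := fun h =>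
    ⟨h.trans (sub_le_self _ (le_max_left _ _)),
      h.trans ((sub_le_sub_left (le_max_right _ _) _).trans_eq (by ring))⟩
  refine ⟨𝒯, hv, hb.mono ?_ ?_ ?_ ?_ ?_⟩
  · exact sub_le_sub_right (le_aux h₂).1 _
  · exact sub_le_sub_right (le_aux h₁).1 _
  · exact sub_le_sub_right (le_aux h₁).2 _
  · exact sub_le_sub_right (le_aux h₂).2 _
  · exact sub_le_sub_right h₀ _

end AchievableOfWindow

/-! ### Strategies and laws for a given input law -/

section Model

set_option synthInstance.maxHeartbeats 200000
set_option synthInstance.maxSize 1000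

variable {𝒰 𝒜 ℬ 𝒳₁ 𝒳₂ 𝒴 : Type*}

/-- Strategies that consult tables: for the channel inputs, for the next private letters, and for
the channel outputs. -/
def tableStrategies (𝒰 𝒜 ℬ 𝒳₁ 𝒳₂ 𝒴 : Type*) : Strategies 𝒰 𝒜 ℬ 𝒳₁ 𝒳₂ 𝒴
    ((𝒰 × 𝒜 → 𝒳₁) × (State 𝒰 𝒜 ℬ 𝒴 × 𝒳₁ → 𝒜)) ((𝒰 × ℬ → 𝒳₂) × (State 𝒰 𝒜 ℬ 𝒴 × 𝒳₂ → ℬ))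
    (𝒳₁ × 𝒳₂ → 𝒴) where
  inp₁ t u a := t.1 (u, a)
  inp₂ t u b := t.1 (u, b)
  upd₁ t s := t.2 (s, t.1 (s.1, s.2.1))
  upd₂ t s := t.2 (s, t.1 (s.1, s.2.2.1))
  chan z x₁ x₂ := z (x₁, x₂)

variable [Fintype 𝒰] [Fintype 𝒜] [Fintype ℬ] [Fintype 𝒳₁] [Fintype 𝒳₂] [Fintype 𝒴]

section Mean

variable (P : InputLaw 𝒰 𝒜 ℬ 𝒳₁ 𝒳₂) (W : 𝒳₁ → 𝒳₂ → stdSimplex ℝ 𝒴)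

/-- The mean value of a function of the state and the channel inputs, given the private letters. -/
noncomputable def InputLaw.mean (F : State 𝒰 𝒜 ℬ 𝒴 × 𝒳₁ × 𝒳₂ → ℝ) (d : 𝒜 × ℬ) : ℝ :=
  expect P.PU fun u => expect (P.PX₁ u d.1) fun x₁ => expect (P.PX₂ u d.2) fun x₂ =>
    expect (W x₁ x₂) fun y => F ((u, d.1, d.2, y), x₁, x₂)

theorem InputLaw.expect_mean (r : 𝒜 × ℬ → ℝ) (F : State 𝒰 𝒜 ℬ 𝒴 × 𝒳₁ × 𝒳₂ → ℝ) :
    expect r (P.mean W F) = ∑ s : State 𝒰 𝒜 ℬ 𝒴, ∑ x₁, ∑ x₂,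
      r (s.2.1, s.2.2.1) * P.condLaw W s x₁ x₂ * F (s, x₁, x₂) := by
  unfold InputLaw.mean
  rw [expect_comm]
  simp only [expect, Fintype.sum_prod_type, Finset.mul_sum, InputLaw.condLaw]
  refine Finset.sum_congr rfl fun u _ => Finset.sum_congr rfl fun a _ =>
    Finset.sum_congr rfl fun b _ => ?_
  refine (Finset.sum_congr rfl fun x₁ _ => Finset.sum_comm).trans ?_
  rw [Finset.sum_comm]
  exact Finset.sum_congr rfl fun y _ => Finset.sum_congr rfl fun x₁ _ =>
    Finset.sum_congr rfl fun x₂ _ => by ring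

theorem InputLaw.law_eq (s : State 𝒰 𝒜 ℬ 𝒴) (x₁ : 𝒳₁) (x₂ : 𝒳₂) :
    P.law W s x₁ x₂ = P.PAB.1 (s.2.1, s.2.2.1) * P.condLaw W s x₁ x₂ := by
  change P.PU s.1 * P.PAB (s.2.1, s.2.2.1) * _ * _ * _ = P.PAB (s.2.1, s.2.2.1) * (_ * _ * _ * _)
  ring

end Mean

variable [DecidableEq 𝒰] [DecidableEq 𝒜] [DecidableEq ℬ] [DecidableEq 𝒳₁] [DecidableEq 𝒳₂]
  [DecidableEq 𝒴]
  (P : InputLaw 𝒰 𝒜 ℬ 𝒳₁ 𝒳₂) (W : 𝒳₁ → 𝒳₂ → stdSimplex ℝ 𝒴)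
  (QA : State 𝒰 𝒜 ℬ 𝒴 → 𝒳₁ → stdSimplex ℝ 𝒜) (QB : State 𝒰 𝒜 ℬ 𝒴 → 𝒳₂ → stdSimplex ℝ ℬ)

/-- Independent entries of all tables. -/
noncomputable def tableLaws : Laws 𝒰 𝒜 ℬ
    ((𝒰 × 𝒜 → 𝒳₁) × (State 𝒰 𝒜 ℬ 𝒴 × 𝒳₁ → 𝒜)) ((𝒰 × ℬ → 𝒳₂) × (State 𝒰 𝒜 ℬ 𝒴 × 𝒳₂ → ℬ))
    (𝒳₁ × 𝒳₂ → 𝒴) where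
  d := P.PAB
  u := P.PU
  t₁ := ⟨_, prodLaw_mem (piLaw_mem fun i : 𝒰 × 𝒜 => (P.PX₁ i.1 i.2).2)
    (piLaw_mem fun i : State 𝒰 𝒜 ℬ 𝒴 × 𝒳₁ => (QA i.1 i.2).2)⟩
  t₂ := ⟨_, prodLaw_mem (piLaw_mem fun i : 𝒰 × ℬ => (P.PX₂ i.1 i.2).2)
    (piLaw_mem fun i : State 𝒰 𝒜 ℬ 𝒴 × 𝒳₂ => (QB i.1 i.2).2)⟩
  z := ⟨_, piLaw_mem fun i : 𝒳₁ × 𝒳₂ => (W i.1 i.2).2⟩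

theorem expect_chan (x₁ : 𝒳₁) (x₂ : 𝒳₂) (f : 𝒴 → ℝ) :
    expect (tableLaws P W QA QB).z.1 (fun z => f ((tableStrategies 𝒰 𝒜 ℬ 𝒳₁ 𝒳₂ 𝒴).chan z x₁ x₂)) =
      expect (W x₁ x₂) f :=
  expect_piLaw_eval (fun i : 𝒳₁ × 𝒳₂ => (W i.1 i.2).2) (x₁, x₂) f

/-- The law of one block and of the next private letters, given the private letters. -/
theorem expect_block_next (d : 𝒜 × ℬ) (F : State 𝒰 𝒜 ℬ 𝒴 × 𝒳₁ × 𝒳₂ → 𝒜 × ℬ → ℝ) :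
    expect (tableLaws P W QA QB).seed (fun σ => F ((tableStrategies 𝒰 𝒜 ℬ 𝒳₁ 𝒳₂ 𝒴).block d σ)
      ((tableStrategies 𝒰 𝒜 ℬ 𝒳₁ 𝒳₂ 𝒴).next d σ)) =
    P.mean W (fun x => expect (prodLaw (QA x.1 x.2.1) (QB x.1 x.2.2)) (F x)) d := by
  simp only [Laws.seed, expect_prodLaw, InputLaw.mean]
  refine expect_congr fun u => ?_
  have hz : ∀ t₁ t₂, expect (tableLaws P W QA QB).z.1 (fun z =>
      F ((tableStrategies 𝒰 𝒜 ℬ 𝒳₁ 𝒳₂ 𝒴).block d (u, t₁, t₂, z))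
        ((tableStrategies 𝒰 𝒜 ℬ 𝒳₁ 𝒳₂ 𝒴).next d (u, t₁, t₂, z))) =
      expect (W (t₁.1 (u, d.1)) (t₂.1 (u, d.2))) fun y =>
        F ((u, d.1, d.2, y), t₁.1 (u, d.1), t₂.1 (u, d.2))
          (t₁.2 ((u, d.1, d.2, y), t₁.1 (u, d.1)), t₂.2 ((u, d.1, d.2, y), t₂.1 (u, d.2))) :=
    fun t₁ t₂ => expect_chan P W QA QB (t₁.1 (u, d.1)) (t₂.1 (u, d.2)) fun y =>
      F ((u, d.1, d.2, y), t₁.1 (u, d.1), t₂.1 (u, d.2))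
        (t₁.2 ((u, d.1, d.2, y), t₁.1 (u, d.1)), t₂.2 ((u, d.1, d.2, y), t₂.1 (u, d.2)))
  refine (expect_congr fun t₁ => expect_congr fun t₂ => hz t₁ t₂).trans ?_
  refine (expect_congr fun t₁ => expect_prodLaw _ _ _).trans ?_
  refine (expect_prodLaw _ _ _).trans ?_
  -- Within a block each table is read at a single index, chosen independently of that table, so a
  -- fresh letter with the law of that entry may replace it. Tables at later stages are averaged
  -- first, because their index depends on earlier results.
  have h₂ : ∀ (x₁ : 𝒳₁) (q : State 𝒰 𝒜 ℬ 𝒴 × 𝒳₁ → 𝒜),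
      (expect (piLaw fun i : 𝒰 × ℬ => (P.PX₂ i.1 i.2).1) fun p₂ =>
        expect (piLaw fun i : State 𝒰 𝒜 ℬ 𝒴 × 𝒳₂ => (QB i.1 i.2).1) fun q₂ =>
          expect (W x₁ (p₂ (u, d.2))) fun y => F ((u, d.1, d.2, y), x₁, p₂ (u, d.2))
            (q ((u, d.1, d.2, y), x₁), q₂ ((u, d.1, d.2, y), p₂ (u, d.2)))) =
      expect (P.PX₂ u d.2) fun x₂ => expect (W x₁ x₂) fun y =>
        expect (QB (u, d.1, d.2, y) x₂) fun b =>
          F ((u, d.1, d.2, y), x₁, x₂) (q ((u, d.1, d.2, y), x₁), b) := fun x₁ q => by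
    refine Eq.trans (expect_congr fun p₂ => ?_)
      (expect_piLaw_eval (fun i : 𝒰 × ℬ => (P.PX₂ i.1 i.2).2) (u, d.2) _)
    rw [expect_comm]
    exact expect_congr fun y => expect_piLaw_eval
      (fun i : State 𝒰 𝒜 ℬ 𝒴 × 𝒳₂ => (QB i.1 i.2).2) ((u, d.1, d.2, y), p₂ (u, d.2))
      fun b => F ((u, d.1, d.2, y), x₁, p₂ (u, d.2)) (q ((u, d.1, d.2, y), x₁), b)
  refine Eq.trans (expect_congr fun p₁ => ?_)
    (expect_piLaw_eval (fun i : 𝒰 × 𝒜 => (P.PX₁ i.1 i.2).2) (u, d.1) _)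
  refine Eq.trans (expect_congr fun q₁ => h₂ (p₁ (u, d.1)) q₁) ?_
  rw [expect_comm]
  refine expect_congr fun x₂ => ?_
  rw [expect_comm]
  exact expect_congr fun y => expect_piLaw_eval
    (fun i : State 𝒰 𝒜 ℬ 𝒴 × 𝒳₁ => (QA i.1 i.2).2) ((u, d.1, d.2, y), p₁ (u, d.1))
    fun a => expect (QB (u, d.1, d.2, y) x₂) fun b => F ((u, d.1, d.2, y), p₁ (u, d.1), x₂) (a, b)

variable {P W QA QB}

/-- When the private letters have law `P_AB`, the sum in `Consistent` is precisely the law of the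
pair drawn for the next block. -/
theorem tableLaws_stationary (h : Consistent P W QA QB) :
    (tableLaws P W QA QB).Stationary (tableStrategies 𝒰 𝒜 ℬ 𝒳₁ 𝒳₂ 𝒴) := by
  intro φ
  simp only [expect_block_next P W QA QB _ fun _ => φ]
  refine (P.expect_mean W _ _).trans ?_
  change _ = expect P.PAB.1 φ
  simp only [tableLaws, ← P.law_eq]
  simp only [expect, Finset.mul_sum]
  simp only [prodLaw]
  simp only [Finset.sum_comm (t := (Finset.univ : Finset (𝒜 × ℬ)))]
  refine Finset.sum_congr rfl fun d _ => ?_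
  refine Eq.trans ?_ (congrArg (fun r => r * φ d) (h d.1 d.2))
  simp only [Finset.sum_mul]
  refine Finset.sum_congr rfl fun s _ => Finset.sum_congr rfl fun x₁ _ =>
    Finset.sum_congr rfl fun x₂ _ => by ring

/-- Both blocks are averaged by `expect_block_next`: first the second block given its private
letters, then the first block together with those letters. -/
theorem prob_sample :
    prob (tableLaws P W QA QB).window (tableStrategies 𝒰 𝒜 ℬ 𝒳₁ 𝒳₂ 𝒴).sample =
      jointLaw P W QA QB := by
  refine prob_eq_of_expect fun g => ?_
  have hmean : ∀ d σ, expect (tableLaws P W QA QB).seed (fun σ' =>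
      g ((tableStrategies 𝒰 𝒜 ℬ 𝒳₁ 𝒳₂ 𝒴).block d σ, (tableStrategies 𝒰 𝒜 ℬ 𝒳₁ 𝒳₂ 𝒴).block
        ((tableStrategies 𝒰 𝒜 ℬ 𝒳₁ 𝒳₂ 𝒴).next d σ) σ')) =
      P.mean W (fun x => g ((tableStrategies 𝒰 𝒜 ℬ 𝒳₁ 𝒳₂ 𝒴).block d σ, x))
        ((tableStrategies 𝒰 𝒜 ℬ 𝒳₁ 𝒳₂ 𝒴).next d σ) := fun d σ => by
    refine (expect_block_next P W QA QB _ fun x _ => g (_, x)).trans ?_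
    exact congrArg (fun F => P.mean W F _) (funext fun x =>
      expect_const (prodLaw_mem (QA x.1 x.2.1).2 (QB x.1 x.2.2).2) _)
  refine (Laws.expect_window_eq fun d σ σ' =>
    g ((tableStrategies 𝒰 𝒜 ℬ 𝒳₁ 𝒳₂ 𝒴).block d σ, (tableStrategies 𝒰 𝒜 ℬ 𝒳₁ 𝒳₂ 𝒴).block
      ((tableStrategies 𝒰 𝒜 ℬ 𝒳₁ 𝒳₂ 𝒴).next d σ) σ')).trans ?_
  refine (expect_congr fun d => (expect_congr fun σ => hmean d σ).trans
    (expect_block_next P W QA QB d fun x => P.mean W fun x' => g (x, x'))).trans ?_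
  refine (P.expect_mean W _ _).trans ?_
  simp only [P.expect_mean]
  conv_rhs => rw [expect, Fintype.sum_prod_type, Fintype.sum_prod_type]
  refine Finset.sum_congr rfl fun s _ => ?_
  conv_rhs => rw [Fintype.sum_prod_type]
  refine Finset.sum_congr rfl fun x₁ _ => Finset.sum_congr rfl fun x₂ _ => ?_
  rw [Finset.mul_sum]
  conv_rhs => rw [Fintype.sum_prod_type]
  refine Finset.sum_congr rfl fun s' _ => ?_
  rw [Finset.mul_sum]
  conv_rhs => rw [Fintype.sum_prod_type]
  refine Finset.sum_congr rfl fun x₁' _ => ?_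
  rw [Finset.mul_sum]
  refine Finset.sum_congr rfl fun x₂' _ => ?_
  change _ = P.law W s x₁ x₂ * QA s x₁ s'.2.1 * QB s x₂ s'.2.2.1 * P.condLaw W s' x₁' x₂' * _
  rw [P.law_eq]
  change P.PAB.1 _ * _ * ((QA s x₁ s'.2.1 * QB s x₂ s'.2.2.1) * _ * _) = _
  ring

theorem rateRegion_subset_capacityRegion (h : Consistent P W QA QB) :
    rateRegion P W QA QB ⊆ capacityRegion W :=
  achievable_of_window
    (fun x₁ x₂ y => (expect_chan P W QA QB x₁ x₂ fun y' => ind (y' = y)).trans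
      (expect_ind_eq _ _))
    (tableLaws_stationary h) prob_sample

end Model

/-! ### Independent pairs -/

section Independence

variable {Ω Ω' α β γ δ η : Type*} [Fintype Ω] [Fintype Ω']

theorem prob_prodLaw (p : Ω' → ℝ) (q : Ω → ℝ) (f : Ω → α) (k : Ω' → δ) (a : α) (d : δ) :
    prob (prodLaw p q) (fun ω => (f ω.2, k ω.1)) (a, d) = prob q f a * prob p k d := by
  rw [prob_eq_expect, prob_eq_expect, prob_eq_expect, expect_prodLaw, ← expect_mul_left]
  refine expect_congr fun ω' => ?_
  rw [← expect_mul_right]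
  refine expect_congr fun ω => ?_
  by_cases h : f ω = a <;> by_cases h' : k ω' = d <;> simp [ind, h, h']

variable [Fintype α] [Fintype β] [Fintype γ] [Fintype δ] [Fintype η] {p : Ω' → ℝ} {q : Ω → ℝ}

theorem entropy_prodLaw (hp : p ∈ stdSimplex ℝ Ω') (hq : q ∈ stdSimplex ℝ Ω) (f : Ω → α)
    (k : Ω' → δ) :
    entropy (prodLaw p q) (fun ω => (f ω.2, k ω.1)) = entropy q f + entropy p k := by
  rw [entropy_eq_expect, entropy_eq_expect, entropy_eq_expect, expect_congr_supp (prodLaw_mem hp hq)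
    (g := fun ω => Real.logb 2 (prob q f (f ω.2)) + Real.logb 2 (prob p k (k ω.1))),
    expect_prodLaw]
  · simp only [expect_add, expect_const hq, expect_const hp]; ring
  · intro ω hω
    have hp0 : 0 < p ω.1 := (hp.1 _).lt_of_ne' fun h => hω.ne' (by rw [prodLaw, h, zero_mul])
    have hq0 : 0 < q ω.2 := (hq.1 _).lt_of_ne' fun h => hω.ne' (by rw [prodLaw, h, mul_zero])
    rw [prob_prodLaw, Real.logb_mul (prob_pos hq f hq0).ne' (prob_pos hp k hp0).ne']

/-- The independent factor `k` adds the same entropy with and without `f`, so it cancels. -/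
theorem condEntropy_prodLaw (hp : p ∈ stdSimplex ℝ Ω') (hq : q ∈ stdSimplex ℝ Ω) (f : Ω → α)
    (h : Ω → γ) (k : Ω' → δ) {h' : Ω' × Ω → η}
    (hh : ∀ ω ω', h' ω = h' ω' ↔ h ω.2 = h ω'.2 ∧ k ω.1 = k ω'.1) :
    condEntropy (prodLaw p q) (fun ω => f ω.2) h' = condEntropy q f h := by
  rw [condEntropy, condEntropy, entropy_congr _ (g := fun ω => (h ω.2, k ω.1))
    (f := h') (fun ω ω' => by rw [hh, Prod.mk.injEq]),
    entropy_congr _ (f := fun ω => (f ω.2, h' ω)) (g := fun ω => ((f ω.2, h ω.2), k ω.1))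
    (fun ω ω' => by simp only [Prod.mk.injEq, hh, and_assoc]),
    entropy_prodLaw hp hq h, entropy_prodLaw hp hq fun ω => (f ω, h ω)]
  ring

theorem condMutualInfo_prodLaw (hp : p ∈ stdSimplex ℝ Ω') (hq : q ∈ stdSimplex ℝ Ω) (f : Ω → α)
    (g : Ω → β) (h : Ω → γ) (k : Ω' → δ) {h' : Ω' × Ω → η}
    (hh : ∀ ω ω', h' ω = h' ω' ↔ h ω.2 = h ω'.2 ∧ k ω.1 = k ω'.1) :
    condMutualInfo (prodLaw p q) (fun ω => f ω.2) (fun ω => g ω.2) h' = condMutualInfo q f g h := by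
  rw [condMutualInfo, condMutualInfo, condEntropy_prodLaw hp hq f h k hh,
    condEntropy_prodLaw hp hq f (fun ω => (g ω, h ω)) k]
  intro ω ω'
  rw [Prod.mk.injEq, Prod.mk.injEq, hh, and_assoc]

theorem condMutualInfo_unit (hq : q ∈ stdSimplex ℝ Ω) (f : Ω → α) (g : Ω → β) :
    condMutualInfo q f g (fun _ => ()) = mutualInfo q f g := by
  have h0 : entropy q (fun _ => ()) = 0 := by
    simp only [entropy, prob, if_true, Fintype.sum_unique, hq.2, Real.logb_one, mul_zero, neg_zero]
  rw [condMutualInfo, mutualInfo, condEntropy_congr q (g := fun ω => (g ω, ())) (f' := f) (h := g)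
    (fun _ _ => Iff.rfl) (by simp), condEntropy, h0,
    entropy_congr q (f := fun ω => (f ω, ())) (g := f) (by simp), sub_zero]

theorem condEntropy_of_subsingleton [Subsingleton α] (q : Ω → ℝ) (f : Ω → α) (h : Ω → γ) :
    condEntropy q f h = 0 := by
  rw [condEntropy, entropy_congr q (g := h), sub_self]
  intro ω ω'
  simp [Subsingleton.elim (f ω) (f ω')]

theorem condMutualInfo_of_subsingleton [Subsingleton α] (q : Ω → ℝ) (f : Ω → α) (g : Ω → β)
    (h : Ω → γ) : condMutualInfo q f g h = 0 := by
  rw [condMutualInfo, condEntropy_of_subsingleton, condEntropy_of_subsingleton, sub_self]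

end Independence

/-! ### The Cover–Leung region -/

section CoverLeung

theorem expect_coe_const {α : Type*} [Fintype α] (p : stdSimplex ℝ α) (c : ℝ) :
    expect p (fun _ => c) = c :=
  expect_const p.2 c

variable {𝒰 𝒳₁ 𝒳₂ 𝒴 : Type*} [Fintype 𝒰] [Fintype 𝒳₁] [Fintype 𝒳₂] [Fintype 𝒴]

/-- The law `P_U P_{X₁|U} P_{X₂|U} P_{Y|X₁X₂}`. -/
noncomputable def coverLeungLaw (PU : stdSimplex ℝ 𝒰) (PX₁ : 𝒰 → stdSimplex ℝ 𝒳₁)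
    (PX₂ : 𝒰 → stdSimplex ℝ 𝒳₂) (W : 𝒳₁ → 𝒳₂ → stdSimplex ℝ 𝒴) : 𝒰 × 𝒳₁ × 𝒳₂ × 𝒴 → ℝ :=
  fun (u, x₁, x₂, y) => PU u * PX₁ u x₁ * PX₂ u x₂ * W x₁ x₂ y

variable (PU : stdSimplex ℝ 𝒰) (PX₁ : 𝒰 → stdSimplex ℝ 𝒳₁) (PX₂ : 𝒰 → stdSimplex ℝ 𝒳₂)
  (W : 𝒳₁ → 𝒳₂ → stdSimplex ℝ 𝒴)

theorem expect_coverLeungLaw (F : 𝒰 × 𝒳₁ × 𝒳₂ × 𝒴 → ℝ) :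
    expect (coverLeungLaw PU PX₁ PX₂ W) F = expect PU fun u => expect (PX₁ u) fun x₁ =>
      expect (PX₂ u) fun x₂ => expect (W x₁ x₂) fun y => F (u, x₁, x₂, y) := by
  simp only [expect, Fintype.sum_prod_type, Finset.mul_sum, coverLeungLaw, mul_assoc]

theorem coverLeungLaw_mem : coverLeungLaw PU PX₁ PX₂ W ∈ stdSimplex ℝ (𝒰 × 𝒳₁ × 𝒳₂ × 𝒴) := by
  refine ⟨fun ⟨u, x₁, x₂, y⟩ => mul_nonneg (mul_nonneg (mul_nonneg (PU.2.1 u) ((PX₁ u).2.1 x₁))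
    ((PX₂ u).2.1 x₂)) ((W x₁ x₂).2.1 y), ?_⟩
  have h := expect_coverLeungLaw PU PX₁ PX₂ W fun _ => 1
  simp only [expect_coe_const] at h
  simpa [expect] using h

/-- The output entropy given the inputs, and possibly the common letter. -/
theorem condEntropy_coverLeungLaw {γ : Type*} [Fintype γ] (g : 𝒰 × 𝒳₁ × 𝒳₂ → γ)
    (hg : ∀ a a', g a = g a' → a.2 = a'.2) :
    condEntropy (coverLeungLaw PU PX₁ PX₂ W) (fun ω => ω.2.2.2)
      (fun ω => g (ω.1, ω.2.1, ω.2.2.1)) =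
    -expect (coverLeungLaw PU PX₁ PX₂ W) fun ω => Real.logb 2 (W ω.2.1 ω.2.2.1 ω.2.2.2) := by
  classical
  refine condEntropy_eq_of_kernel (coverLeungLaw_mem PU PX₁ PX₂ W) _ _ _ fun ω => ?_
  rw [prob_eq_expect, prob_eq_expect, expect_coverLeungLaw, expect_coverLeungLaw,
    ← expect_mul_right]
  refine expect_congr fun u => ?_
  rw [← expect_mul_right]
  refine expect_congr fun x₁ => ?_
  rw [← expect_mul_right]
  refine expect_congr fun x₂ => ?_
  change _ = expect (W x₁ x₂) (fun _ => ind (g (u, x₁, x₂) = g (ω.1, ω.2.1, ω.2.2.1))) * _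
  rw [expect_coe_const]
  by_cases h : g (u, x₁, x₂) = g (ω.1, ω.2.1, ω.2.2.1)
  · have hx := hg _ _ h
    rw [Prod.mk.injEq] at hx
    have hV : W x₁ x₂ = W ω.2.1 ω.2.2.1 := by rw [hx.1, hx.2]
    rw [ind_of h, one_mul, hV, ← expect_ind_eq (W ω.2.1 ω.2.2.1)]
    exact expect_congr fun y => by simp only [Prod.mk.injEq, h, and_true]
  · rw [ind_of_not h, zero_mul]
    simp only [Prod.mk.injEq, h, and_false, ind_of_not not_false]
    exact expect_coe_const _ 0

/-- Given the inputs, the output does not depend on the common letter, so its entropy given the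
inputs is the same with and without U; the two terms H(Y|U) cancel. -/
theorem condMutualInfo_add_mutualInfo_coverLeungLaw :
    condMutualInfo (coverLeungLaw PU PX₁ PX₂ W) (fun ω => (ω.2.1, ω.2.2.1)) (fun ω => ω.2.2.2)
        (fun ω => ω.1) +
      mutualInfo (coverLeungLaw PU PX₁ PX₂ W) (fun ω => ω.1) (fun ω => ω.2.2.2) =
    mutualInfo (coverLeungLaw PU PX₁ PX₂ W) (fun ω => (ω.2.1, ω.2.2.1)) (fun ω => ω.2.2.2) := by
  have hq := coverLeungLaw_mem PU PX₁ PX₂ W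
  have hc : condEntropy (coverLeungLaw PU PX₁ PX₂ W) (fun ω => ω.2.2.2) (fun ω => (ω.1, ())) =
      condEntropy (coverLeungLaw PU PX₁ PX₂ W) (fun ω => ω.2.2.2) fun ω => ω.1 :=
    condEntropy_congr _ (fun _ _ => Iff.rfl) (by simp)
  rw [← condMutualInfo_unit hq, ← condMutualInfo_unit hq, condMutualInfo_eq, condMutualInfo_eq,
    condMutualInfo_eq, condEntropy_coverLeungLaw PU PX₁ PX₂ W (fun a => ((a.2.1, a.2.2), a.1))
      (fun a a' h => (Prod.ext_iff.1 h).1), condEntropy_coverLeungLaw PU PX₁ PX₂ W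
      (fun a => ((a.2.1, a.2.2), ())) (fun a a' h => (Prod.ext_iff.1 h).1), hc]
  ring

theorem stdSimplex_apply {ι : Type*} [Fintype ι] [Subsingleton ι] (p : stdSimplex ℝ ι) (i : ι) :
    p i = 1 := by
  rw [← p.2.2]
  exact (Fintype.sum_subsingleton _ i).symm

/-- Two independent blocks, arranged as a sample. -/
def pairSample (𝒰 𝒳₁ 𝒳₂ 𝒴 : Type*) :
    (𝒰 × 𝒳₁ × 𝒳₂ × 𝒴) × (𝒰 × 𝒳₁ × 𝒳₂ × 𝒴) ≃ Sample 𝒰 Unit Unit 𝒳₁ 𝒳₂ 𝒴 where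
  toFun := fun ((u', x₁', x₂', y'), (u, x₁, x₂, y)) =>
    (((u', (), (), y'), x₁', x₂'), ((u, (), (), y), x₁, x₂))
  invFun := fun (((u', _, _, y'), x₁', x₂'), ((u, _, _, y), x₁, x₂)) =>
    ((u', x₁', x₂', y'), (u, x₁, x₂, y))
  left_inv _ := rfl
  right_inv _ := rfl

variable (P : InputLaw 𝒰 Unit Unit 𝒳₁ 𝒳₂)
  (QA : State 𝒰 Unit Unit 𝒴 → 𝒳₁ → stdSimplex ℝ Unit)
  (QB : State 𝒰 Unit Unit 𝒴 → 𝒳₂ → stdSimplex ℝ Unit)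

/-- One-point private letters carry nothing from the first block to the second, and their laws are
constantly one. -/
theorem prob_pairSample :
    prob (prodLaw (coverLeungLaw P.PU (fun u => P.PX₁ u ()) (fun u => P.PX₂ u ()) W)
      (coverLeungLaw P.PU (fun u => P.PX₁ u ()) (fun u => P.PX₂ u ()) W))
      (pairSample 𝒰 𝒳₁ 𝒳₂ 𝒴) = jointLaw P W QA QB := by
  refine prob_eq_of_expect fun g => ?_
  rw [← expect_comp_equiv (pairSample 𝒰 𝒳₁ 𝒳₂ 𝒴)]
  congr 1
  ext ⟨⟨u', x₁', x₂', y'⟩, ⟨u, x₁, x₂, y⟩⟩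
  simp only [prodLaw, coverLeungLaw, pairSample, Equiv.coe_fn_mk, jointLaw, InputLaw.law,
    InputLaw.condLaw, stdSimplex_apply, mul_one]

theorem consistent_unit : Consistent P W QA QB := by
  intro a b
  have h : ∀ s x₁ x₂, P.law W s x₁ x₂ * QA s x₁ a * QB s x₂ b =
      P.PAB.1 (s.2.1, s.2.2.1) * P.condLaw W s x₁ x₂ * 1 := fun s x₁ x₂ => by
    rw [P.law_eq, stdSimplex_apply, stdSimplex_apply]
    ring
  simp only [h]
  rw [← P.expect_mean W _ fun _ => 1]
  have hm : ∀ d, P.mean W (fun _ => 1) d = 1 := fun d => by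
    simp only [InputLaw.mean, expect_coe_const]
  rw [expect_congr hm, expect_const P.PAB.2, stdSimplex_apply]

/-- By independence the tilde variables drop out of every condition. The information about a
one-point letter is zero, so each positive part is max(0, -I(U;Y)) = 0, and the sum bound becomes
I(X₁X₂;Y|U) + I(U;Y). -/
theorem rateRegion_unit : rateRegion P W QA QB =
    coverLeungRegion P.PU (fun u => P.PX₁ u ()) (fun u => P.PX₂ u ()) W := by
  have hq := coverLeungLaw_mem P.PU (fun u => P.PX₁ u ()) (fun u => P.PX₂ u ()) W
  have h₀ := condMutualInfo_add_mutualInfo_coverLeungLaw P.PU (fun u => P.PX₁ u ())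
    (fun u => P.PX₂ u ()) W
  change _ = {R : ℝ × ℝ | R.1 ≤ condMutualInfo (coverLeungLaw P.PU (fun u => P.PX₁ u ())
    (fun u => P.PX₂ u ()) W) (fun ω => ω.2.1) (fun ω => ω.2.2.2) (fun ω => (ω.2.2.1, ω.1)) ∧
    R.2 ≤ condMutualInfo (coverLeungLaw P.PU (fun u => P.PX₁ u ())
    (fun u => P.PX₂ u ()) W) (fun ω => ω.2.2.1) (fun ω => ω.2.2.2) (fun ω => (ω.2.1, ω.1)) ∧
    R.1 + R.2 ≤ mutualInfo (coverLeungLaw P.PU (fun u => P.PX₁ u ()) (fun u => P.PX₂ u ()) W)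
      (fun ω => (ω.2.1, ω.2.2.1)) (fun ω => ω.2.2.2)}
  rw [rateRegion, ← prob_pairSample]
  simp only [condMutualInfo_prob, condMutualInfo_of_subsingleton]
  set q := coverLeungLaw P.PU (fun u => P.PX₁ u ()) (fun u => P.PX₂ u ()) W
  have hu := condMutualInfo_prodLaw hq hq (fun ω => ω.1) (fun ω => ω.2.2.2) (fun _ => ())
    (fun ω => (ω.1, ω.2.2.2)) (h' := fun ω => (Ut (pairSample 𝒰 𝒳₁ 𝒳₂ 𝒴 ω),
      Yt (pairSample 𝒰 𝒳₁ 𝒳₂ 𝒴 ω))) fun ω ω' => by simp [pairSample, Ut, Yt]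
  have h₁ := condMutualInfo_prodLaw hq hq (fun ω => ω.2.1) (fun ω => ω.2.2.2)
    (fun ω => (ω.2.2.1, ω.1)) (fun ω => (ω.1, ω.2.2.2, ω.2.2.1))
    (h' := fun ω => (X₂ (pairSample 𝒰 𝒳₁ 𝒳₂ 𝒴 ω), B (pairSample 𝒰 𝒳₁ 𝒳₂ 𝒴 ω),
      U (pairSample 𝒰 𝒳₁ 𝒳₂ 𝒴 ω), St (pairSample 𝒰 𝒳₁ 𝒳₂ 𝒴 ω), X₂t (pairSample 𝒰 𝒳₁ 𝒳₂ 𝒴 ω)))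
    fun ω ω' => by simp [pairSample, X₂, B, U, St, X₂t]; tauto
  have h₂ := condMutualInfo_prodLaw hq hq (fun ω => ω.2.2.1) (fun ω => ω.2.2.2)
    (fun ω => (ω.2.1, ω.1)) (fun ω => (ω.1, ω.2.1, ω.2.2.2))
    (h' := fun ω => (X₁ (pairSample 𝒰 𝒳₁ 𝒳₂ 𝒴 ω), A (pairSample 𝒰 𝒳₁ 𝒳₂ 𝒴 ω),
      U (pairSample 𝒰 𝒳₁ 𝒳₂ 𝒴 ω), St (pairSample 𝒰 𝒳₁ 𝒳₂ 𝒴 ω), X₁t (pairSample 𝒰 𝒳₁ 𝒳₂ 𝒴 ω)))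
    fun ω ω' => by simp [pairSample, X₁, A, U, St, X₁t]; tauto
  have h₃ := condMutualInfo_prodLaw hq hq (fun ω => (ω.2.1, ω.2.2.1)) (fun ω => ω.2.2.2)
    (fun ω => ω.1) (fun ω => (ω.1, ω.2.2.2))
    (h' := fun ω => (U (pairSample 𝒰 𝒳₁ 𝒳₂ 𝒴 ω), St (pairSample 𝒰 𝒳₁ 𝒳₂ 𝒴 ω)))
    fun ω ω' => by simp [pairSample, U, St]
  rw [condMutualInfo_unit hq] at hu
  have h0 : max 0 (0 - mutualInfo q (fun ω => ω.1) fun ω => ω.2.2.2) = 0 :=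
    max_eq_left (by linarith [mutualInfo_nonneg hq (fun ω => ω.1) fun ω => ω.2.2.2])
  rw [← hu] at h0
  have key : ∀ e, e - max 0 (0 - condMutualInfo (prodLaw q q) (fun ω => ω.2.1)
      (fun ω => ω.2.2.2.2) fun ω => (Ut (pairSample 𝒰 𝒳₁ 𝒳₂ 𝒴 ω), Yt (pairSample 𝒰 𝒳₁ 𝒳₂ 𝒴 ω))) =
      e := fun e => by rw [h0, sub_zero]
  ext R
  rw [← h₁, ← h₂, ← h₀, ← h₃, ← hu]
  exact and_congr (iff_of_eq (congrArg (R.1 ≤ ·) (key _)))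
    (and_congr (iff_of_eq (congrArg (R.2 ≤ ·) (key _))) Iff.rfl)

end CoverLeung

end MACFeedback

/-- For every channel, the rate region of every input law and every consistent pair of conditional
laws is achievable with feedback; with one-point `A` and `B`, every pair of conditional laws is
consistent and the region is the Cover–Leung region. -/
theorem theorem1 {𝒳₁ 𝒳₂ 𝒴 𝒰 𝒜 ℬ : Type*}
    [Fintype 𝒳₁] [Fintype 𝒳₂] [Fintype 𝒴] [Fintype 𝒰] [Fintype 𝒜] [Fintype ℬ]
    (W : 𝒳₁ → 𝒳₂ → stdSimplex ℝ 𝒴) :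
    (∀ (P : MACFeedback.InputLaw 𝒰 𝒜 ℬ 𝒳₁ 𝒳₂)
        (QA : MACFeedback.State 𝒰 𝒜 ℬ 𝒴 → 𝒳₁ → stdSimplex ℝ 𝒜)
        (QB : MACFeedback.State 𝒰 𝒜 ℬ 𝒴 → 𝒳₂ → stdSimplex ℝ ℬ),
        MACFeedback.Consistent P W QA QB →
        MACFeedback.rateRegion P W QA QB ⊆ MACFeedback.capacityRegion W) ∧
    (∀ (P : MACFeedback.InputLaw 𝒰 Unit Unit 𝒳₁ 𝒳₂)
        (QA : MACFeedback.State 𝒰 Unit Unit 𝒴 → 𝒳₁ → stdSimplex ℝ Unit)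
        (QB : MACFeedback.State 𝒰 Unit Unit 𝒴 → 𝒳₂ → stdSimplex ℝ Unit),
        MACFeedback.Consistent P W QA QB ∧
        MACFeedback.rateRegion P W QA QB =
          MACFeedback.coverLeungRegion P.PU (fun u => P.PX₁ u ()) (fun u => P.PX₂ u ()) W) := by
  classical
  exact ⟨fun P QA QB h => MACFeedback.rateRegion_subset_capacityRegion h, fun P QA QB =>
    ⟨MACFeedback.consistent_unit W P QA QB, MACFeedback.rateRegion_unit W P QA QB⟩⟩
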